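/- Let $n\ge 4$. A coherent tangent bundle $(M^n,\mathcal E,\langle\,,\rangle,D,\phi)$ over an $n$-manifold $M^n$ consists of a rank-$n$ smooth vector bundle $\mathcal E\to M^n$ with a fibre metric $\langle\,,\rangle$, a metric connection $D$, and a smooth bundle homomorphism $\phi:TM^n\to\mathcal E$ such that $D_X\phi(Y)-D_Y\phi(X)-\phi([X,Y])=0$ for all smooth vector fields $X,Y$. A point $p$ is regular if $\phi_p$ is injective; let $\mathcal R$ be the set of regular points, and let $g=\phi^*\langle\,,\rangle$, a Riemannian metric on $\mathcal R$. For $n\ge 3$ it is a GCF-manifold if $\mathcal R$ is dense and $g$ is conformally flat on $\mathcal R$ (locally $e^{2\sigma}g$ has vanishing sectional curvature for some smooth $\sigma$). Let $A=\frac1{n-2}\bigl(\mathrm{Ric}_g-\frac{S_g}{2(n-1)}g\bigr)$ be the Schouten tensor of $g$ on $\mathcal R$, where $\mathrm{Ric}_g$ and $S_g$ are the Ricci tensor and the scalar curvature of $g$, and let $\hat A$ be the field of endomorphisms of $TM^n|_{\mathcal R}$ with $g(\hat A v,w)=A(v,w)$. A GCF-manifold is admissible if the set of points of $\mathcal R$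 at which $A$ is non-degenerate is dense in $M^n$, and the homomorphism $\phi\circ\hat A$ on $TM^n|_{\mathcal R}$ extends to a smooth bundle homomorphism $TM^n\to\mathcal E$. **Proposition.** For every $n\ge 4$ there is a compact, connected and simply connected admissible GCF-manifold of dimension $n$ that is not homeomorphic to a sphere (of any dimension), namely $M=S^2\times S^{n-2}$ with a structure of the following kind. Let $\boldsymbol L^{n+2}$ be Lorentz–Minkowski space of signature $(-,+,\dots,+)$, let $H^{n+1}=\{z:\langle z,z\rangle=-1,\ z^0>0\}$ and $Q^{n+1}_+=\{z:\langle z,z\rangle=0,\ z^0>0\}$. For all $r_1,r_2>0$ with $r_1^2+r_2^2=1$ there are a conformal transformation $T$ of $S^{n+1}$ that maps the generalized Clifford torus $S^2(r_1)\times S^{n-2}(r_2)\subset S^{n+1}$ into the open hemisphere $\{z^0>0\}$, and a smooth unit normal vector field $\nu:M\to\boldsymbol L^{n+2}$ along the resulting map $f:M\to H^{n+1}$, where the hemisphere is identified with $H^{n+1}$ by the conformal map $(z^0,z')\mapsto\frac1{z^0}(1,z')$, such that $x:=(f-\nu)/\sqrt2$ takes values in $Q^{n+1}_+$ and the bundle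 $\mathcal E=\{f,\nu\}^\perp\subset M\times\boldsymbol L^{n+2}$ (identified with $TM$ by $df$) with the metric induced from $\boldsymbol L^{n+2}$, the homomorphism $\phi=dx$ and a suitable metric connection $D$ is an admissible GCF-manifold. -/

import Mathlib

open Bundle Module
open scoped Manifold ContDiff

noncomputable section

/-! ## Curvature in local coordinates

`G u` is the matrix of the metric coefficients at the coordinate vector `u`, where `u` runs through
a finite-dimensional real vector space `E`, whose coordinates `u^1, …, u^n` are taken with respect
to the fixed basis `Module.finBasis ℝ E`. -/

namespace Coord

variable {E : Type*} [NormedAddCommGroup E] [NormedSpace ℝ E] [FiniteDimensional ℝ E]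

/-- The partial derivative `∂h/∂u^i`. -/
def partialDeriv (h : E → ℝ) (i : Fin (finrank ℝ E)) (u : E) : ℝ :=
  fderiv ℝ h u (finBasis ℝ E i)

variable (G : E → Matrix (Fin (finrank ℝ E)) (Fin (finrank ℝ E)) ℝ)

/-- The Christoffel symbol `Γ^k_{ij} = ½ ∑_a g^{ka} (∂_i g_{ja} + ∂_j g_{ia} - ∂_a g_{ij})`. -/
def christoffel (k i j : Fin (finrank ℝ E)) (u : E) : ℝ :=
  (1 / 2) * ∑ a, (G u)⁻¹ k a *
    (partialDeriv (fun w => G w j a) i u + partialDeriv (fun w => G w i a) j u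
      - partialDeriv (fun w => G w i j) a u)

/-- The curvature coefficient `R^l_{kij}`, where `R(∂_i, ∂_j) ∂_k = ∑_l R^l_{kij} ∂_l` and
`R(X, Y) = ∇_X ∇_Y - ∇_Y ∇_X - ∇_{[X, Y]}`. -/
def riemann (l k i j : Fin (finrank ℝ E)) (u : E) : ℝ :=
  partialDeriv (christoffel G l j k) i u - partialDeriv (christoffel G l i k) j u
    + ∑ m, (christoffel G l i m u * christoffel G m j k u
      - christoffel G l j m u * christoffel G m i k u)

/-- The Ricci tensor `R_{jk} = ∑_i R^i_{kij}` (positive on round spheres). -/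
def ricci (u : E) : Matrix (Fin (finrank ℝ E)) (Fin (finrank ℝ E)) ℝ :=
  fun j k => ∑ i, riemann G i k i j u

/-- The scalar curvature `S_g = ∑_{j,k} g^{jk} R_{jk}`. -/
def scalarCurvature (u : E) : ℝ :=
  ∑ j, ∑ k, (G u)⁻¹ j k * ricci G u j k

/-- The Schouten tensor `A_{ij} = (R_{ij} - S_g / (2 (n - 1)) g_{ij}) / (n - 2)`, `n = dim E`. -/
def schouten (u : E) : Matrix (Fin (finrank ℝ E)) (Fin (finrank ℝ E)) ℝ :=
  fun i j => (1 / ((finrank ℝ E : ℝ) - 2)) *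
    (ricci G u i j - scalarCurvature G u / (2 * ((finrank ℝ E : ℝ) - 1)) * G u i j)

end Coord

/-! ## Curvature of a Riemannian metric on (an open subset of) a manifold -/

section Manifold

variable {E : Type*} [NormedAddCommGroup E] [NormedSpace ℝ E] [FiniteDimensional ℝ E]
  {H : Type*} [TopologicalSpace H] (I : ModelWithCorners ℝ E H) [I.Boundaryless]
  {M : Type*} [TopologicalSpace M] [ChartedSpace H M] [IsManifold I ∞ M]

/-- The coordinate vector fields `∂/∂u^i` at the point `q` of the preferred chart at `q`. In
Mathlib `T_q M` is the model space `E`, read in the preferred chart at `q`, so that they form the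
chosen basis of `E`; see `coordFrame_eq`. -/
def coordFrame (q : M) : Basis (Fin (finrank ℝ E)) ℝ (TangentSpace I q) :=
  finBasis ℝ E

/-- The coordinate vector field `∂/∂u^i` of the preferred chart at `q`, at the point with
coordinate vector `u`. -/
def coordVector (q : M) (u : E) (i : Fin (finrank ℝ E)) :
    TangentSpace I ((extChartAt I q).symm u) :=
  mfderiv 𝓘(ℝ, E) I (extChartAt I q).symm u (finBasis ℝ E i)

theorem coordFrame_eq (q : M) (i : Fin (finrank ℝ E)) :
    (mfderiv 𝓘(ℝ, E) I (extChartAt I q).symm (extChartAt I q q) (finBasis ℝ E i) : E)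
      = coordFrame I q i := by
  haveI : IsManifold I 1 M := IsManifold.of_le (n := ∞) (by norm_cast)
  have h := mfderivWithin_range_extChartAt_symm (I := I) (x := q)
  rw [I.range_eq_univ, mfderivWithin_univ] at h
  rw [h]
  rfl

variable (g : ∀ p : M, TangentSpace I p → TangentSpace I p → ℝ)

/-- The coefficients `g_{ij}` of the metric `g` in the preferred chart at `q`. -/
def coordMetric (q : M) (u : E) : Matrix (Fin (finrank ℝ E)) (Fin (finrank ℝ E)) ℝ :=
  fun i j => g ((extChartAt I q).symm u) (coordVector I q u i) (coordVector I q u j)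

/-- The sectional curvature
`K(v, w) = g(R(v, w) w, v) / (g(v, v) g(w, w) - g(v, w)^2)` of `g` at `q`. -/
def sectionalCurvature (q : M) (v w : TangentSpace I q) : ℝ :=
  (∑ i, ∑ j, ∑ k, ∑ l, ∑ m,
      (coordFrame I q).repr v i * (coordFrame I q).repr w j * (coordFrame I q).repr w k *
        (coordFrame I q).repr v m *
        Coord.riemann (coordMetric I g q) l k i j (extChartAt I q q) *
        coordMetric I g q (extChartAt I q q) l m) /
    (g q v v * g q w w - g q v w ^ 2)

/-- The Riemannian metric `g` on the open set `R` is conformally flat: locally there is a smooth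
function `σ` such that `e^{2σ} g` has vanishing sectional curvature. -/
def IsConformallyFlatOn (R : Set M) : Prop :=
  ∀ p ∈ R, ∃ U : Set M, IsOpen U ∧ p ∈ U ∧ U ⊆ R ∧
    ∃ σ : M → ℝ, ContMDiffOn I 𝓘(ℝ, ℝ) ∞ σ U ∧
      ∀ q ∈ U, ∀ v w : TangentSpace I q, LinearIndependent ℝ ![v, w] →
        sectionalCurvature I (fun x a b => Real.exp (2 * σ x) * g x a b) q v w = 0

/-- The matrix `A_{ij}` of the Schouten tensor of `g` at `q` in the coordinate frame at `q`. -/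
def schoutenMatrix (q : M) : Matrix (Fin (finrank ℝ E)) (Fin (finrank ℝ E)) ℝ :=
  Coord.schouten (coordMetric I g q) (extChartAt I q q)

/-- The Schouten tensor `A(v, w) = ∑_{i,j} A_{ij} v^i w^j` of `g` at `q`. -/
def schoutenTensor (q : M) (v w : TangentSpace I q) : ℝ :=
  ∑ i, ∑ j, schoutenMatrix I g q i j * (coordFrame I q).repr v i * (coordFrame I q).repr w j

/-- The endomorphism `Â = ∑_{i,j,a} g^{ia} A_{aj} ∂_i ⊗ du^j` of `T_q M`. -/
def schoutenEndo (q : M) : TangentSpace I q →ₗ[ℝ] TangentSpace I q :=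
  Matrix.toLin (coordFrame I q) (coordFrame I q)
    ((coordMetric I g q (extChartAt I q q))⁻¹ * schoutenMatrix I g q)

end Manifold

/-! ## Coherent tangent bundles and generalized conformally flat manifolds -/

section Coherent

variable {E : Type*} [NormedAddCommGroup E] [NormedSpace ℝ E] [FiniteDimensional ℝ E]
  {H : Type*} [TopologicalSpace H] (I : ModelWithCorners ℝ E H) [I.Boundaryless]
  (M : Type*) [TopologicalSpace M] [T2Space M] [ChartedSpace H M] [IsManifold I ∞ M]
  (F : Type*) [NormedAddCommGroup F] [NormedSpace ℝ F]
  (V : M → Type*) [TopologicalSpace (TotalSpace F V)]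
  [∀ x, TopologicalSpace (V x)] [∀ x, AddCommGroup (V x)] [∀ x, Module ℝ (V x)]
  [∀ x, IsTopologicalAddGroup (V x)] [∀ x, ContinuousSMul ℝ (V x)]
  [FiberBundle F V] [VectorBundle ℝ F V] [ContMDiffVectorBundle ∞ F V I]

/-- A smooth bundle homomorphism `TM → V` covering the identity of `M`. -/
def IsSmoothBundleHom {I : ModelWithCorners ℝ E H} [I.Boundaryless]
    {M : Type*} [TopologicalSpace M] [T2Space M] [ChartedSpace H M] [IsManifold I ∞ M]
    (F : Type*) [NormedAddCommGroup F] [NormedSpace ℝ F]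
    {V : M → Type*} [TopologicalSpace (TotalSpace F V)]
    [∀ x, TopologicalSpace (V x)] [∀ x, AddCommGroup (V x)] [∀ x, Module ℝ (V x)]
    [∀ x, IsTopologicalAddGroup (V x)] [∀ x, ContinuousSMul ℝ (V x)]
    [FiberBundle F V] [VectorBundle ℝ F V] [ContMDiffVectorBundle ∞ F V I]
    (φ : ∀ p : M, TangentSpace I p →L[ℝ] V p) : Prop :=
  ContMDiff I (I.prod 𝓘(ℝ, E →L[ℝ] F)) ∞
    (fun p => TotalSpace.mk' (E →L[ℝ] F) (E := fun x => TangentSpace I x →L[ℝ] V x) p (φ p))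

/-- A coherent tangent bundle `(M, V, ⟨ , ⟩, D, φ)`: the smooth vector bundle `V` over `M` has rank
`dim M`, `metric` is a smooth fibre metric, `D` a smooth metric connection (`D s p X` is
`D_X s` at `p`), and `φ : TM → V` a smooth bundle homomorphism with
`D_X φ(Y) - D_Y φ(X) - φ([X, Y]) = 0` for all smooth vector fields `X`, `Y`. -/
structure CoherentTangentBundle where
  rank_eq : finrank ℝ F = finrank ℝ E
  metric : ContMDiffRiemannianMetric I ∞ F V
  D : CovariantDerivative I F V
  D_smooth : ContMDiffCovariantDerivativeOn F ∞ D.toFun Set.univ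
  D_metric : ∀ s t : (∀ p, V p),
    ContMDiff I (I.prod 𝓘(ℝ, F)) ∞ (fun p => TotalSpace.mk' F p (s p)) →
    ContMDiff I (I.prod 𝓘(ℝ, F)) ∞ (fun p => TotalSpace.mk' F p (t p)) →
    ∀ (p : M) (X : TangentSpace I p),
      (mfderiv I 𝓘(ℝ, ℝ) (fun q => metric.inner q (s q) (t q)) p X : ℝ)
        = metric.inner p (D s p X) (t p) + metric.inner p (s p) (D t p X)
  φ : ∀ p : M, TangentSpace I p →L[ℝ] V p
  φ_smooth : IsSmoothBundleHom F φ
  coherent : ∀ X Y : (∀ p : M, TangentSpace I p),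
    ContMDiff I (I.prod 𝓘(ℝ, E)) ∞ (fun p => TotalSpace.mk' E p (X p)) →
    ContMDiff I (I.prod 𝓘(ℝ, E)) ∞ (fun p => TotalSpace.mk' E p (Y p)) →
    ∀ p : M, D (fun q => φ q (Y q)) p (X p) - D (fun q => φ q (X q)) p (Y p)
      - φ p (VectorField.mlieBracket I X Y p) = 0

namespace CoherentTangentBundle

variable {I M F V}
variable (C : CoherentTangentBundle I M F V)

/-- The set of regular points of `φ`. -/
def regularSet : Set M := {p | Function.Injective (C.φ p)}

/-- The induced metric `g = φ^*⟨ , ⟩`. -/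
def inducedMetric (p : M) (v w : TangentSpace I p) : ℝ :=
  C.metric.inner p (C.φ p v) (C.φ p w)

/-- The set of regular points that are not parabolic, i.e. at which the Schouten tensor of the
induced metric is non-degenerate. -/
def nonparabolicSet : Set M :=
  {p | p ∈ C.regularSet ∧
    ∀ v, (∀ w, schoutenTensor I C.inducedMetric p v w = 0) → v = 0}

/-- A generalized conformally flat manifold (GCF-manifold), of dimension `n ≥ 3`. -/
def IsGCF : Prop :=
  3 ≤ finrank ℝ E ∧ Dense C.regularSet ∧ IsConformallyFlatOn I C.inducedMetric C.regularSet

/-- An admissible GCF-manifold: the non-parabolic regular points are dense, and the homomorphism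
`φ ∘ Â` on the regular set extends to a smooth bundle homomorphism on `TM`. -/
def IsAdmissibleGCF : Prop :=
  C.IsGCF ∧ Dense C.nonparabolicSet ∧
    ∃ ψ : ∀ p : M, TangentSpace I p →L[ℝ] V p, IsSmoothBundleHom F ψ ∧
      ∀ p ∈ C.regularSet, ∀ v, ψ p v = C.φ p (schoutenEndo I C.inducedMetric p v)

end CoherentTangentBundle

end Coherent

/-! ## Spheres, Lorentz-Minkowski space and the generalized Clifford torus -/

/-- The unit sphere `S^m` in `ℝ^{m+1}`. -/
abbrev Sph (m : ℕ) : Type := Metric.sphere (0 : EuclideanSpace ℝ (Fin (m + 1))) 1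

/-- The product manifold `S^2 × S^k`. -/
abbrev SphProd (k : ℕ) : Type := Sph 2 × Sph k

/-- The model with corners of the `(k + 2)`-manifold `S^2 × S^k`. -/
abbrev modelSphProd (k : ℕ) := (𝓡 2).prod (𝓡 k)

/-- The Lorentz product of signature `(-, +, …, +)` on `L^{N+1} = ℝ^{N+1}`. -/
def lorentz {N : ℕ} (z w : EuclideanSpace ℝ (Fin (N + 1))) : ℝ :=
  -(z 0 * w 0) + ∑ i : Fin N, z i.succ * w i.succ

/-- The upper lightcone `Q^N_+` in `L^{N+1}`. -/
def upperLightcone (N : ℕ) : Set (EuclideanSpace ℝ (Fin (N + 1))) :=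
  {z | lorentz z z = 0 ∧ 0 < z 0}

/-- The hyperbolic space `H^N` in `L^{N+1}`. -/
def hyperbolicSpace (N : ℕ) : Set (EuclideanSpace ℝ (Fin (N + 1))) :=
  {z | lorentz z z = -1 ∧ 0 < z 0}

/-- The conformal identification `(z^0, z') ↦ (1 / z^0) (1, z')` of the open hemisphere `z^0 > 0`
of `S^N` with `H^N`. -/
def hemisphereToHyperbolic {N : ℕ} (z : EuclideanSpace ℝ (Fin (N + 1))) :
    EuclideanSpace ℝ (Fin (N + 1)) :=
  WithLp.toLp 2 (Fin.cons (1 / z 0) (fun i : Fin N => z i.succ / z 0))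

/-- The hemisphere model takes values in the hyperbolic space. -/
theorem hemisphereToHyperbolic_mem {N : ℕ} (z : Sph N) (hz : 0 < z.1 0) :
    hemisphereToHyperbolic z.1 ∈ hyperbolicSpace N := by
  have hn : ‖z.1‖ = 1 := by simpa using z.2
  have h1 : z.1 0 ^ 2 + ∑ i : Fin N, z.1 i.succ ^ 2 = 1 := by
    have h := EuclideanSpace.real_norm_sq_eq z.1
    rw [hn, Fin.sum_univ_succ] at h
    linarith
  have h2 : ∑ i : Fin N, z.1 i.succ / z.1 0 * (z.1 i.succ / z.1 0)
      = (∑ i : Fin N, z.1 i.succ ^ 2) / z.1 0 ^ 2 := by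
    rw [Finset.sum_div]
    exact Finset.sum_congr rfl fun i _ => by ring
  refine ⟨?_, ?_⟩
  · simp only [lorentz, hemisphereToHyperbolic, Fin.cons_zero, Fin.cons_succ]
    rw [h2]
    field_simp
    linarith
  · simpa [hemisphereToHyperbolic] using hz

/-- The generalized Clifford torus `S^2(r₁) × S^k(r₂) ⊂ S^{k+3} ⊂ ℝ^{k+1} × ℝ^3`, for
`r₁² + r₂² = 1`, as a map `(u, v) ↦ (r₂ v, r₁ u)` on `S^2 × S^k`. -/
def cliffordTorus (k : ℕ) (r₁ r₂ : ℝ) (p : SphProd k) : EuclideanSpace ℝ (Fin (k + 3 + 1)) :=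
  WithLp.toLp 2 (Fin.append (m := k + 1) (n := 3) (fun i => r₂ * p.2.1 i) (fun i => r₁ * p.1.1 i))

/-- The generalized Clifford torus lies on the unit sphere. -/
theorem cliffordTorus_mem (k : ℕ) {r₁ r₂ : ℝ} (h : r₁ ^ 2 + r₂ ^ 2 = 1) (p : SphProd k) :
    cliffordTorus k r₁ r₂ p ∈ Metric.sphere (0 : EuclideanSpace ℝ (Fin (k + 3 + 1))) 1 := by
  have hu : ‖p.1.1‖ = 1 := by simpa using p.1.2
  have hv : ‖p.2.1‖ = 1 := by simpa using p.2.2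
  have hu' := EuclideanSpace.real_norm_sq_eq p.1.1
  have hv' := EuclideanSpace.real_norm_sq_eq p.2.1
  rw [hu] at hu'
  rw [hv] at hv'
  have hs : ‖cliffordTorus k r₁ r₂ p‖ ^ 2 = 1 := by
    rw [EuclideanSpace.real_norm_sq_eq]
    have e : ∑ i : Fin (k + 1 + 3), (cliffordTorus k r₁ r₂ p i) ^ 2 = 1 := by
      rw [Fin.sum_univ_add]
      simp only [cliffordTorus, Fin.append_left, Fin.append_right, mul_pow]
      rw [← Finset.mul_sum, ← Finset.mul_sum, ← hu', ← hv']
      linarith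
    exact e
  have h0 := norm_nonneg (cliffordTorus k r₁ r₂ p)
  simp only [mem_sphere_iff_norm, sub_zero]
  nlinarith

/-- A diffeomorphism of the round sphere `S^N` is a conformal transformation: its differential
rescales the metric at every point by a positive factor. -/
def IsConformalTransformation {N : ℕ}
    (T : Diffeomorph (𝓡 N) (𝓡 N) (Sph N) (Sph N) ∞) : Prop :=
  ∀ p : Sph N, ∃ c : ℝ, 0 < c ∧ ∀ v w : TangentSpace (𝓡 N) p,
    inner ℝ
      (mfderiv (𝓡 N) 𝓘(ℝ, EuclideanSpace ℝ (Fin (N + 1))) (fun z => (T z).1) p v :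
        EuclideanSpace ℝ (Fin (N + 1)))
      (mfderiv (𝓡 N) 𝓘(ℝ, EuclideanSpace ℝ (Fin (N + 1))) (fun z => (T z).1) p w :
        EuclideanSpace ℝ (Fin (N + 1)))
    = c * inner ℝ
      (mfderiv (𝓡 N) 𝓘(ℝ, EuclideanSpace ℝ (Fin (N + 1))) (fun z : Sph N => z.1) p v :
        EuclideanSpace ℝ (Fin (N + 1)))
      (mfderiv (𝓡 N) 𝓘(ℝ, EuclideanSpace ℝ (Fin (N + 1))) (fun z : Sph N => z.1) p w :
        EuclideanSpace ℝ (Fin (N + 1)))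

/-- The differential `dh_p(v) ∈ ℝ^{k+4}` of a map `h : S^2 × S^k → ℝ^{k+4}`. -/
def diffAt {k : ℕ} (h : SphProd k → EuclideanSpace ℝ (Fin (k + 3 + 1))) (p : SphProd k)
    (v : TangentSpace (modelSphProd k) p) : EuclideanSpace ℝ (Fin (k + 3 + 1)) :=
  mfderiv (modelSphProd k) 𝓘(ℝ, EuclideanSpace ℝ (Fin (k + 3 + 1))) h p v

/-- `ν` is a smooth unit normal vector field along the hypersurface `f : S^2 × S^k → H^{k+3}`. -/
def IsUnitNormal {k : ℕ} (f ν : SphProd k → EuclideanSpace ℝ (Fin (k + 3 + 1))) : Prop :=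
  ContMDiff (modelSphProd k) 𝓘(ℝ, EuclideanSpace ℝ (Fin (k + 3 + 1))) ∞ ν ∧
    ∀ p, lorentz (ν p) (ν p) = 1 ∧ lorentz (ν p) (f p) = 0 ∧
      ∀ v, lorentz (diffAt f p v) (ν p) = 0

end

section NoRetraction

open MeasureTheory Metric Set

/-- `det (1 + t A)` is a cubic polynomial in `t` with coefficients continuous in `A`. -/
theorem exists_det_one_add_smul_eq :
    ∃ c : Fin 3 → (EuclideanSpace ℝ (Fin 3) →L[ℝ] EuclideanSpace ℝ (Fin 3)) → ℝ,
      (∀ i, Continuous (c i)) ∧ ∀ A t, (ContinuousLinearMap.id ℝ _ + t • A).det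
        = 1 + t * c 0 A + t ^ 2 * c 1 A + t ^ 3 * c 2 A := by
  let b := EuclideanSpace.basisFun (Fin 3) ℝ
  let e : Fin 3 → Fin 3 → (EuclideanSpace ℝ (Fin 3) →L[ℝ] EuclideanSpace ℝ (Fin 3)) → ℝ :=
    fun i j A => A (b j) i
  have he : ∀ i j, Continuous (e i j) := fun i j => by
    have h1 : Continuous fun A : EuclideanSpace ℝ (Fin 3) →L[ℝ] EuclideanSpace ℝ (Fin 3) =>
      A (b j) := continuous_id.clm_apply continuous_const
    exact (EuclideanSpace.proj (𝕜 := ℝ) i).continuous.comp h1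
  refine ⟨![fun A => e 0 0 A + e 1 1 A + e 2 2 A,
    fun A => e 0 0 A * e 1 1 A - e 0 1 A * e 1 0 A + (e 0 0 A * e 2 2 A - e 0 2 A * e 2 0 A)
      + (e 1 1 A * e 2 2 A - e 1 2 A * e 2 1 A),
    fun A => e 0 0 A * e 1 1 A * e 2 2 A - e 0 0 A * e 1 2 A * e 2 1 A
      - e 0 1 A * e 1 0 A * e 2 2 A + e 0 1 A * e 1 2 A * e 2 0 A
      + e 0 2 A * e 1 0 A * e 2 1 A - e 0 2 A * e 1 1 A * e 2 0 A], ?_, ?_⟩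
  · intro i
    fin_cases i <;> simp only [Fin.zero_eta, Fin.mk_one, Fin.reduceFinMk, Matrix.cons_val] <;>
      fun_prop
  · intro A t
    have h : (ContinuousLinearMap.id ℝ (EuclideanSpace ℝ (Fin 3)) + t • A).det
        = (LinearMap.toMatrix b.toBasis b.toBasis
          (ContinuousLinearMap.id ℝ (EuclideanSpace ℝ (Fin 3)) + t • A).toLinearMap).det :=
      (LinearMap.det_toMatrix b.toBasis _).symm
    rw [h, Matrix.det_fin_three]
    have hij : ∀ i j, LinearMap.toMatrix b.toBasis b.toBasis
        (ContinuousLinearMap.id ℝ (EuclideanSpace ℝ (Fin 3)) + t • A).toLinearMap i j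
          = (if i = j then 1 else 0) + t * e i j A := by
      intro i j
      rw [LinearMap.toMatrix_apply]
      simp [b, e, EuclideanSpace.basisFun_repr, PiLp.single_apply]
    simp only [hij]
    simp [Matrix.cons_val_zero]
    ring

/-- A cubic that is constant on a nondegenerate interval `(0, ε)` is constant. -/
theorem cubic_eq_of_eq_on_Ioo {a b c d v ε : ℝ} (hε : 0 < ε)
    (h : ∀ t, 0 < t → t < ε → a + t * b + t ^ 2 * c + t ^ 3 * d = v) (t : ℝ) :
    a + t * b + t ^ 2 * c + t ^ 3 * d = v := by
  open Polynomial in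
  have key : (C a + X * C b + X ^ 2 * C c + X ^ 3 * C d : ℝ[X]) = C v := by
    refine Polynomial.eq_of_infinite_eval_eq _ _ ((Ioo_infinite hε).mono ?_)
    intro s hs
    have := h s hs.1 hs.2
    simp
    linarith
  have := congrArg (Polynomial.eval t) key
  simp only [Polynomial.eval_add, Polynomial.eval_mul, Polynomial.eval_C, Polynomial.eval_X,
    Polynomial.eval_pow] at this
  linarith

theorem lipschitz_extend_zero {F : Type*} [NormedAddCommGroup F] [NormedSpace ℝ F] {g : F → F}
    {K : NNReal} (hg : LipschitzOnWith K g (closedBall 0 1)) (h0 : ∀ x, ‖x‖ = 1 → g x = 0)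
    (hout : ∀ x, 1 ≤ ‖x‖ → g x = 0) : LipschitzWith K g := by
  have hmix : ∀ x y, ‖x‖ ≤ 1 → 1 ≤ ‖y‖ → dist (g x) (g y) ≤ K * dist x y := by
    intro x y hx hy
    have hc : ContinuousOn (fun s : ℝ => ‖AffineMap.lineMap (k := ℝ) x y s‖) (Icc 0 1) := by
      have : Continuous fun s : ℝ => AffineMap.lineMap (k := ℝ) x y s :=
        AffineMap.lineMap_continuous
      exact this.norm.continuousOn
    have h1 : (1 : ℝ) ∈ Icc ‖AffineMap.lineMap (k := ℝ) x y (0 : ℝ)‖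
        ‖AffineMap.lineMap (k := ℝ) x y (1 : ℝ)‖ := by simp [hx, hy]
    obtain ⟨s, hs, hs1⟩ := intermediate_value_Icc (zero_le_one) hc h1
    have h2 := hg.dist_le_mul x (by simpa using hx) (AffineMap.lineMap (k := ℝ) x y s)
      (by simpa using hs1.le)
    rw [hout y hy, ← h0 _ hs1]
    refine h2.trans ?_
    gcongr
    rw [dist_left_lineMap, Real.norm_of_nonneg hs.1]
    nlinarith [hs.2, dist_nonneg (x := x) (y := y)]
  refine LipschitzWith.of_dist_le_mul fun x y => ?_
  rcases le_total ‖x‖ 1 with hx | hx <;> rcases le_total ‖y‖ 1 with hy | hy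
  · exact hg.dist_le_mul x (by simpa using hx) y (by simpa using hy)
  · exact hmix x y hx hy
  · rw [dist_comm, dist_comm x]; exact hmix y x hy hx
  · rw [hout x hx, hout y hy, dist_self]; positivity

/-- There is no `C^1` retraction of the unit ball of `ℝ^3` onto its boundary. -/
theorem not_exists_smooth_retraction (r : EuclideanSpace ℝ (Fin 3) → EuclideanSpace ℝ (Fin 3))
    (hr : ContDiff ℝ 1 r) (hr1 : ∀ x, ‖x‖ = 1 → r x = x) : ¬ ∀ x, ‖r x‖ = 1 := by
  intro hn
  classical
  let V := EuclideanSpace ℝ (Fin 3)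
  obtain ⟨c, hc, hdet⟩ := exists_det_one_add_smul_eq
  let A : V → (V →L[ℝ] V) := fun x => fderiv ℝ r x - ContinuousLinearMap.id ℝ V
  have hdet' : ∀ x t, (ContinuousLinearMap.id ℝ V + t • A x).det
      = 1 + t * c 0 (A x) + t ^ 2 * c 1 (A x) + t ^ 3 * c 2 (A x) := fun x t => hdet (A x) t
  have hA : Continuous A := (hr.continuous_fderiv one_ne_zero).sub continuous_const
  have hcA : ∀ i, Continuous fun x => c i (A x) := fun i => (hc i).comp hA
  have hcpt : IsCompact (closedBall (0 : V) 1) := isCompact_closedBall 0 1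
  have hbd : ∀ i, ∃ C, ∀ x ∈ closedBall (0 : V) 1, ‖c i (A x)‖ ≤ C := fun i =>
    hcpt.exists_bound_of_continuousOn (hcA i).continuousOn
  choose C hC using hbd
  obtain ⟨K, hK⟩ := hcpt.exists_bound_of_continuousOn hA.continuousOn
  have hK0 : 0 ≤ K := (norm_nonneg _).trans (hK 0 (by simp))
  have hC0 : ∀ i, 0 ≤ C i := fun i => (norm_nonneg _).trans (hC i 0 (by simp))
  let g : V → V := fun x => if ‖x‖ ≤ 1 then r x - x else 0
  have hgin : ∀ x, ‖x‖ ≤ 1 → g x = r x - x := fun x hx => if_pos hx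
  have hgb : ∀ x, ‖x‖ = 1 → g x = 0 := fun x hx => by rw [hgin x hx.le, hr1 x hx, sub_self]
  have hgout : ∀ x, 1 ≤ ‖x‖ → g x = 0 := fun x hx => by
    rcases hx.eq_or_lt with h | h
    · exact hgb x h.symm
    · exact if_neg (not_le.2 h)
  have hAd : ∀ x, HasFDerivAt (fun x => r x - x) (A x) x := fun x =>
    ((hr.differentiable one_ne_zero) x).hasFDerivAt.sub (hasFDerivAt_id x)
  have hgL : LipschitzWith K.toNNReal g := by
    refine lipschitz_extend_zero ?_ hgb hgout
    have h1 : LipschitzOnWith K.toNNReal (fun x => r x - x) (closedBall (0 : V) 1) := by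
      refine (convex_closedBall (0 : V) 1).lipschitzOnWith_of_nnnorm_hasFDerivWithin_le
        (fun x _ => (hAd x).hasFDerivWithinAt) fun x hx => ?_
      rw [← NNReal.coe_le_coe, coe_nnnorm, Real.coe_toNNReal _ hK0]
      exact hK x hx
    intro x hx y hy
    rw [hgin x (by simpa using hx), hgin y (by simpa using hy)]
    exact h1 hx hy
  have hint : ∀ i, IntegrableOn (fun x => c i (A x)) (ball (0 : V) 1) := fun i =>
    ((hcA i).continuousOn.integrableOn_compact hcpt).mono_set ball_subset_closedBall
  have h1int : IntegrableOn (fun _ : V => (1 : ℝ)) (ball (0 : V) 1) :=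
    (continuous_const.continuousOn.integrableOn_compact hcpt).mono_set ball_subset_closedBall
  let v : ℝ := (volume (ball (0 : V) 1)).toReal
  have hexp : ∀ t, ∫ x in ball (0 : V) 1, (ContinuousLinearMap.id ℝ V + t • A x).det
      = v + t * (∫ x in ball (0 : V) 1, c 0 (A x)) + t ^ 2 * (∫ x in ball (0 : V) 1, c 1 (A x))
        + t ^ 3 * ∫ x in ball (0 : V) 1, c 2 (A x) := by
    intro t
    simp only [hdet']
    rw [integral_add, integral_add, integral_add, integral_const_mul, integral_const_mul,
      integral_const_mul]
    · simp [v, Measure.real]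
    · exact h1int
    · exact (hint 0).const_mul _
    · exact h1int.add ((hint 0).const_mul _)
    · exact (hint 1).const_mul _
    · exact (h1int.add ((hint 0).const_mul _)).add ((hint 1).const_mul _)
    · exact (hint 2).const_mul _
  let ε : ℝ := 1 / (1 + K + C 0 + C 1 + C 2)
  have hden : 0 < 1 + K + C 0 + C 1 + C 2 := by linarith [hC0 0, hC0 1, hC0 2]
  have hε : 0 < ε := by positivity
  have hsmall : ∀ t, 0 < t → t < ε →
      v + t * (∫ x in ball (0 : V) 1, c 0 (A x)) + t ^ 2 * (∫ x in ball (0 : V) 1, c 1 (A x))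
        + t ^ 3 * (∫ x in ball (0 : V) 1, c 2 (A x)) = v := by
    intro t ht0 htε
    rw [← hexp]
    have hden1 : t * (1 + K + C 0 + C 1 + C 2) < 1 := by rwa [← lt_div_iff₀ hden]
    have hz : ∀ i, 0 ≤ t * C i := fun i => mul_nonneg ht0.le (hC0 i)
    have hz' : 0 ≤ t * K := mul_nonneg ht0.le hK0
    have ht1 : t < 1 := by linarith [hz 0, hz 1, hz 2]
    have htK : t * K < 1 := by linarith [hz 0, hz 1, hz 2]
    let f : V → V := fun x => x + t • g x
    have hfL : ApproximatesLinearOn f ((ContinuousLinearEquiv.refl ℝ V : V ≃L[ℝ] V) : V →L[ℝ] V)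
        univ (t * K).toNNReal := by
      intro x _ y _
      have : f x - f y - ((ContinuousLinearEquiv.refl ℝ V : V ≃L[ℝ] V) : V →L[ℝ] V) (x - y)
          = t • (g x - g y) := by
        simp [f, smul_sub]; abel
      rw [this, norm_smul, Real.norm_of_nonneg ht0.le, Real.coe_toNNReal _ hz', mul_assoc]
      refine mul_le_mul_of_nonneg_left ?_ ht0.le
      have := hgL.dist_le_mul x y
      rwa [dist_eq_norm, dist_eq_norm, Real.coe_toNNReal _ hK0] at this
    have hcond : Subsingleton V ∨ (t * K).toNNReal <
        ‖((ContinuousLinearEquiv.refl ℝ V : V ≃L[ℝ] V).symm : V →L[ℝ] V)‖₊⁻¹ := by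
      right
      have : ‖((ContinuousLinearEquiv.refl ℝ V : V ≃L[ℝ] V).symm : V →L[ℝ] V)‖₊ = 1 := by
        ext
        exact ContinuousLinearMap.norm_id
      rw [this, inv_one, ← NNReal.coe_lt_coe, Real.coe_toNNReal _ hz']
      exact htK
    have hinj : Function.Injective f := injOn_univ.1 (hfL.injOn hcond)
    have hsurj : Function.Surjective f := hfL.surjective hcond
    have hfout : ∀ x, 1 ≤ ‖x‖ → f x = x := fun x hx => by simp [f, hgout x hx]
    have himg : f '' ball (0 : V) 1 = ball (0 : V) 1 := by
      ext y
      constructor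
      · rintro ⟨x, hx, rfl⟩
        have hx1 : ‖x‖ < 1 := by simpa using hx
        have h2 : f x = (1 - t) • x + t • r x := by
          simp only [f, hgin x hx1.le]; module
        rw [mem_ball_zero_iff, h2]
        calc ‖(1 - t) • x + t • r x‖ ≤ ‖(1 - t) • x‖ + ‖t • r x‖ := norm_add_le _ _
          _ = (1 - t) * ‖x‖ + t * 1 := by
            rw [norm_smul, norm_smul, hn, Real.norm_of_nonneg (by linarith),
              Real.norm_of_nonneg ht0.le]
          _ < 1 := by nlinarith
      · intro hy
        obtain ⟨x, rfl⟩ := hsurj y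
        refine ⟨x, ?_, rfl⟩
        by_contra hx
        rw [mem_ball_zero_iff, not_lt] at hx
        rw [hfout x hx, mem_ball_zero_iff] at hy
        linarith
    have hpos : ∀ x ∈ ball (0 : V) 1, 0 ≤ (ContinuousLinearMap.id ℝ V + t • A x).det := by
      intro x hx
      rw [hdet']
      have hb := fun i => (abs_le.1 (hC i x (ball_subset_closedBall hx))).1
      have e1 : -(t * C 0) ≤ t * c 0 (A x) := by nlinarith [hb 0]
      have e2 : -(t * C 1) ≤ t ^ 2 * c 1 (A x) := by
        have : t ^ 2 * C 1 ≤ t * C 1 := by nlinarith [hz 1]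
        nlinarith [hb 1, sq_nonneg t]
      have e3 : -(t * C 2) ≤ t ^ 3 * c 2 (A x) := by
        have h3 : t ^ 3 ≤ t := by nlinarith [mul_pos ht0 ht0]
        have : t ^ 3 * C 2 ≤ t * C 2 := mul_le_mul_of_nonneg_right h3 (hC0 2)
        nlinarith [hb 2, pow_pos ht0 3]
      linarith
    have hchange := lintegral_abs_det_fderiv_eq_addHaar_image (μ := volume) (s := ball (0 : V) 1)
      (f := f) (f' := fun x => ContinuousLinearMap.id ℝ V + t • A x) measurableSet_ball (by
        intro x hx
        refine HasFDerivWithinAt.congr (f := fun x => x + t • (r x - x)) ?_ ?_ ?_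
        · exact ((hasFDerivAt_id x).add ((hAd x).const_smul t)).hasFDerivWithinAt
        · intro y hy
          simp only [f, hgin y (by simpa using (ball_subset_closedBall hy))]
        · simp only [f, hgin x (by simpa using (ball_subset_closedBall hx))]) hinj.injOn
    rw [himg] at hchange
    rw [integral_eq_lintegral_of_nonneg_ae]
    · simp only [v]
      rw [← hchange]
      congr 1
      refine setLIntegral_congr_fun measurableSet_ball fun x hx => ?_
      simp only [abs_of_nonneg (hpos x hx)]
    · exact (ae_restrict_iff' measurableSet_ball).2 (ae_of_all _ hpos)
    · simp only [hdet']
      exact (((continuous_const.add (continuous_const.mul (hcA 0))).add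
        (continuous_const.mul (hcA 1))).add (continuous_const.mul (hcA 2))).aestronglyMeasurable
  have h1 := cubic_eq_of_eq_on_Ioo hε hsmall 1
  rw [← hexp] at h1
  have hzero : ∀ x : V, (ContinuousLinearMap.id ℝ V + (1 : ℝ) • A x).det = 0 := by
    intro x
    have e : ContinuousLinearMap.id ℝ V + (1 : ℝ) • A x = fderiv ℝ r x := by simp [A]
    rw [e]
    by_contra hne
    have hd := ((hr.differentiable one_ne_zero) x).hasFDerivAt
    have h2 : HasFDerivAt (fun y => inner ℝ (r y) (r y)) _ x := hd.inner ℝ hd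
    have h3 : (fun y => inner ℝ (r y) (r y)) = fun _ => (1 : ℝ) := by
      funext y
      rw [real_inner_self_eq_norm_sq, hn, one_pow]
    rw [h3] at h2
    have h4 := h2.unique (hasFDerivAt_const (1 : ℝ) x)
    have hunit : IsUnit (LinearMap.det (fderiv ℝ r x).toLinearMap) := isUnit_iff_ne_zero.2 hne
    have hsurj : Function.Surjective (fderiv ℝ r x) :=
      ((LinearEquiv.ofIsUnitDet (v := (EuclideanSpace.basisFun (Fin 3) ℝ).toBasis)
        (v' := (EuclideanSpace.basisFun (Fin 3) ℝ).toBasis) (f := (fderiv ℝ r x).toLinearMap)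
        (by rwa [LinearMap.det_toMatrix])).surjective)
    obtain ⟨w, hw⟩ := hsurj (r x)
    have h5 := congrArg (fun L : V →L[ℝ] ℝ => L w) h4
    simp [hw, hn] at h5
  simp only [hzero, integral_zero] at h1
  have : 0 < v := ENNReal.toReal_pos (measure_ball_pos volume (0 : V) one_pos).ne'
    measure_ball_lt_top.ne
  linarith

end NoRetraction

section SphereTopology

open Metric Set

open Classical in
/-- The radial projection of a normed space to its unit sphere, with the value `e` at the origin. -/
noncomputable def radialProj {V : Type*} [NormedAddCommGroup V] [NormedSpace ℝ V]
    (e : sphere (0 : V) 1) (x : V) :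
    sphere (0 : V) 1 :=
  if h : x = 0 then e else ⟨‖x‖⁻¹ • x, by simp [norm_smul, h]⟩

section radialProj

variable {V : Type*} [NormedAddCommGroup V] [NormedSpace ℝ V] (e : sphere (0 : V) 1)

theorem coe_radialProj {x : V} (hx : x ≠ 0) : (radialProj e x : V) = ‖x‖⁻¹ • x := by
  simp [radialProj, hx]

theorem radialProj_coe (x : sphere (0 : V) 1) : radialProj e x = x := by
  have hx : ‖(x : V)‖ = 1 := norm_eq_of_mem_sphere x
  ext1
  rw [coe_radialProj e (by rintro h; simp [h] at hx), hx, inv_one, one_smul]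

theorem continuousAt_radialProj {x : V} (hx : x ≠ 0) : ContinuousAt (radialProj e) x := by
  rw [Topology.IsInducing.subtypeVal.continuousAt_iff]
  have h : ContinuousAt (fun y : V => ‖y‖⁻¹ • y) x :=
    (continuousAt_id.norm.inv₀ (norm_ne_zero_iff.2 hx)).smul continuousAt_id
  refine h.congr ?_
  filter_upwards [isOpen_ne.mem_nhds hx] with y hy
  exact (coe_radialProj e hy).symm

theorem norm_smul_radialProj (x : V) : ‖x‖ • (radialProj e x : V) = x := by
  rcases eq_or_ne x 0 with rfl | hx
  · simp
  · rw [coe_radialProj e hx, smul_smul, mul_inv_cancel₀ (norm_ne_zero_iff.2 hx), one_smul]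

end radialProj

theorem not_nullhomotopic_id_sphere_two : ¬ (ContinuousMap.id (Sph 2)).Nullhomotopic := by
  rintro ⟨p, ⟨H⟩⟩
  let V := EuclideanSpace ℝ (Fin 3)
  let F : V → V := fun x => max ‖x‖ (1 / 2) •
    (H (projIcc 0 1 zero_le_one (2 - 4 * ‖x‖), radialProj p x) : V)
  have hFc : Continuous F := by
    rw [continuous_iff_continuousAt]
    intro x
    rcases eq_or_ne x 0 with rfl | hx
    · have : F =ᶠ[nhds 0] fun _ => (1 / 2 : ℝ) • (p : V) := by
        filter_upwards [ball_mem_nhds (0 : V) (show (0 : ℝ) < 1 / 4 by norm_num)] with y hy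
        have hy' : ‖y‖ < 1 / 4 := by simpa using hy
        simp only [F]
        rw [projIcc_of_right_le _ (by linarith), max_eq_right (by linarith)]
        have := H.apply_one (radialProj p y)
        erw [this]
        rfl
      exact continuousAt_const.congr this.symm
    · have h1 : ContinuousAt (fun x : V => (projIcc (0 : ℝ) 1 zero_le_one (2 - 4 * ‖x‖),
          radialProj p x)) x := by
        refine ContinuousAt.prodMk ?_ (continuousAt_radialProj p hx)
        have : Continuous fun x : V => projIcc (0 : ℝ) 1 zero_le_one (2 - 4 * ‖x‖) :=
          continuous_projIcc.comp (by fun_prop)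
        exact this.continuousAt
      have h2 : ContinuousAt (fun z => (H z : V)) (projIcc (0 : ℝ) 1 zero_le_one (2 - 4 * ‖x‖),
          radialProj p x) := (continuous_subtype_val.comp H.continuous).continuousAt
      exact (continuous_norm.max continuous_const).continuousAt.smul (h2.comp_of_eq h1 rfl)
  have hFn : ∀ x, 1 / 2 ≤ ‖F x‖ := by
    intro x
    have h1 : ‖(H (projIcc 0 1 zero_le_one (2 - 4 * ‖x‖), radialProj p x) : V)‖ = 1 :=
      norm_eq_of_mem_sphere _
    simp only [F]
    rw [norm_smul, h1, mul_one, Real.norm_of_nonneg (by positivity)]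
    exact le_max_right _ _
  have hFid : ∀ x, 1 / 2 ≤ ‖x‖ → F x = x := by
    intro x hx
    simp only [F]
    rw [projIcc_of_le_left _ (by linarith), max_eq_left hx]
    have := H.apply_zero (radialProj p x)
    erw [this]
    exact norm_smul_radialProj p x
  obtain ⟨G, hG, hGF, hGid, -⟩ := hFc.exists_contDiff_approx_and_eqOn 1
    (ε := fun _ => (1 / 2 : ℝ)) continuous_const (fun _ => by norm_num)
    (S := {x : V | 1 ≤ ‖x‖}) (U := {x : V | 1 / 2 < ‖x‖})
    (isClosed_le continuous_const continuous_norm)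
    ((isOpen_lt continuous_const continuous_norm).mem_nhdsSet.2 fun x hx => by
      simp only [mem_ofPred_eq] at hx ⊢; linarith)
    (contDiffOn_id.congr fun x hx => hFid x (le_of_lt hx))
  have hG0 : ∀ x, G x ≠ 0 := by
    intro x hx
    have h1 := hGF x
    rw [hx, dist_zero_left] at h1
    linarith [hFn x]
  refine not_exists_smooth_retraction (fun x => ‖G x‖⁻¹ • G x) ?_ ?_ ?_
  · exact ((hG.norm ℝ hG0).inv fun x => norm_ne_zero_iff.2 (hG0 x)).smul hG
  · intro x hx
    have : G x = x := (hGid (by simp [hx])).trans (hFid x (by linarith))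
    simp [this, hx]
  · intro x
    rw [norm_smul, norm_inv, norm_norm, inv_mul_cancel₀ (norm_ne_zero_iff.2 (hG0 x))]

theorem contractibleSpace_sphere_compl_singleton {m : ℕ} (q : Sph m) :
    ContractibleSpace ({q}ᶜ : Set (Sph m)) := by
  have hq : ‖(q : EuclideanSpace ℝ (Fin (m + 1)))‖ = 1 := norm_eq_of_mem_sphere q
  let s := stereographic hq
  have hs : s.source = ({q}ᶜ : Set (Sph m)) := stereographic_source hq
  have ht : s.target = univ := stereographic_target hq
  let h1 := s.toHomeomorphSourceTarget
  let h2 : s.source ≃ₜ (ℝ ∙ (q : EuclideanSpace ℝ (Fin (m + 1))))ᗮ :=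
    (h1.trans (Homeomorph.setCongr ht)).trans (Homeomorph.Set.univ _)
  have h3 := ((Homeomorph.setCongr hs).symm.trans h2)
  exact h3.contractibleSpace

/-- A loop in a sphere that avoids a point is null-homotopic. -/
theorem homotopic_refl_of_forall_ne {m : ℕ} {x q : Sph m} (γ : Path x x) (h : ∀ t, γ t ≠ q) :
    Path.Homotopic γ (Path.refl x) := by
  have := contractibleSpace_sphere_compl_singleton q
  have hx : x ≠ q := by simpa using h 0
  let γ' : Path (⟨x, hx⟩ : ({q}ᶜ : Set (Sph m))) ⟨x, hx⟩ :=
    { toFun := fun t => ⟨γ t, h t⟩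
      source' := by simp
      target' := by simp }
  have h1 : Path.Homotopic γ' (Path.refl _) := SimplyConnectedSpace.paths_homotopic _ _
  have h2 := h1.map ⟨Subtype.val, continuous_subtype_val⟩
  exact h2

/-- Two loops in a sphere at distance less than `1` are homotopic. -/
theorem homotopic_of_dist_lt {m : ℕ} {x : Sph m} (γ δ : Path x x)
    (h : ∀ t, dist (γ t) (δ t) < 1) : Path.Homotopic γ δ := by
  let V := EuclideanSpace ℝ (Fin (m + 1))
  let Φ : unitInterval × unitInterval → V := fun z =>
    AffineMap.lineMap (k := ℝ) (γ z.2 : V) (δ z.2 : V) (z.1 : ℝ)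
  have hΦc : Continuous Φ := by
    simp only [Φ, AffineMap.lineMap_apply_module]
    have h1 : Continuous fun z : unitInterval × unitInterval => (γ z.2 : V) := by fun_prop
    have h2 : Continuous fun z : unitInterval × unitInterval => (δ z.2 : V) := by fun_prop
    have h3 : Continuous fun z : unitInterval × unitInterval => (z.1 : ℝ) := by fun_prop
    exact ((continuous_const.sub h3).smul h1).add (h3.smul h2)
  have hΦ0 : ∀ z, Φ z ≠ 0 := by
    intro z hz
    have h1 : dist (γ z.2 : V) (Φ z) < 1 := by
      simp only [Φ]
      rw [dist_left_lineMap, Real.norm_of_nonneg z.1.2.1]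
      have h2 : dist (γ z.2 : V) (δ z.2 : V) < 1 := h z.2
      nlinarith [z.1.2.1, z.1.2.2, dist_nonneg (x := (γ z.2 : V)) (y := (δ z.2 : V))]
    rw [hz, dist_zero_right, norm_eq_of_mem_sphere] at h1
    exact lt_irrefl _ h1
  exact ⟨{
    toFun := fun z => radialProj x (Φ z)
    continuous_toFun := continuous_iff_continuousAt.2 fun z =>
      (continuousAt_radialProj x (hΦ0 z)).comp hΦc.continuousAt
    map_zero_left := fun t => by simp [Φ, radialProj_coe]
    map_one_left := fun t => by simp [Φ, radialProj_coe]
    prop' := fun s t ht => by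
      rcases ht with rfl | rfl <;> simp [Φ, radialProj_coe] }⟩

/-- A loop of a sphere of dimension at least `2` is homotopic to one that avoids a point. -/
theorem exists_homotopic_forall_ne {m : ℕ} (hm : 2 ≤ m) {x : Sph m} (γ : Path x x) :
    ∃ (δ : Path x x) (q : Sph m), Path.Homotopic γ δ ∧ ∀ t, δ t ≠ q := by
  let V := EuclideanSpace ℝ (Fin (m + 1))
  let c : C(unitInterval, V) := ⟨fun t => (γ t : V), by fun_prop⟩
  have hlim := bernsteinApproximation_uniform c
  obtain ⟨n, hn, hn0⟩ := ((Metric.tendsto_nhds.1 hlim (1 / 2) (by norm_num)).and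
    (Filter.eventually_ne_atTop 0)).exists
  have hd : ∀ t, dist (bernsteinApproximation n c t) (γ t : V) < 1 / 2 := fun t =>
    (ContinuousMap.dist_apply_le_dist t).trans_lt hn
  have hb0 : ∀ t, bernsteinApproximation n c t ≠ 0 := by
    intro t ht
    have h1 := hd t
    rw [ht, dist_zero_left, norm_eq_of_mem_sphere] at h1
    linarith
  let δ : Path x x :=
    { toFun := fun t => radialProj x (bernsteinApproximation n c t)
      continuous_toFun := continuous_iff_continuousAt.2 fun t =>
        (continuousAt_radialProj x (hb0 t)).comp (map_continuous _).continuousAt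
      source' := by simp [c, radialProj_coe]
      target' := by simp [c, hn0, radialProj_coe] }
  let B : ℝ × ℝ → V := fun z =>
    z.1 • ∑ k : Fin (n + 1), (bernsteinPolynomial ℝ n k).eval z.2 • c (bernstein.z k)
  have hB : ContDiff ℝ 1 B := by
    refine contDiff_fst.smul (ContDiff.sum fun k _ => ContDiff.fun_smul ?_ contDiff_const)
    exact (Polynomial.contDiff_aeval _ _).comp contDiff_snd
  have hdense := hB.dense_compl_range_of_finrank_lt_finrank (by
    rw [finrank_euclideanSpace_fin]; simp; omega)
  obtain ⟨q₀, hq₀⟩ := hdense.nonempty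
  have hq0 : q₀ ≠ 0 := by
    rintro rfl
    exact hq₀ ⟨(0, 0), by simp [B]⟩
  refine ⟨δ, radialProj x q₀, homotopic_of_dist_lt _ _ fun t => ?_, fun t ht => hq₀ ?_⟩
  · have e : (δ t : V) = ‖bernsteinApproximation n c t‖⁻¹ • bernsteinApproximation n c t :=
      coe_radialProj x (hb0 t)
    have h1 := hd t
    have h2 : dist (δ t : V) (bernsteinApproximation n c t)
        = |1 - ‖bernsteinApproximation n c t‖| := by
      have hp := norm_pos_iff.2 (hb0 t)
      rw [e, dist_eq_norm]
      nth_rw 3 [← one_smul ℝ (bernsteinApproximation n c t)]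
      rw [← sub_smul, norm_smul, Real.norm_eq_abs]
      nth_rw 2 [← abs_of_pos hp]
      rw [← abs_mul, sub_mul, inv_mul_cancel₀ hp.ne', one_mul]
    have h3 : |1 - ‖bernsteinApproximation n c t‖| < 1 / 2 := by
      have : |‖bernsteinApproximation n c t‖ - ‖(γ t : V)‖| ≤ _ := abs_norm_sub_norm_le _ _
      rw [norm_eq_of_mem_sphere, abs_sub_comm, ← dist_eq_norm] at this
      exact this.trans_lt h1
    have h4 := dist_triangle (γ t : V) (bernsteinApproximation n c t) (δ t : V)
    rw [dist_comm (γ t : V) (bernsteinApproximation n c t),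
      dist_comm (bernsteinApproximation n c t) (δ t : V), h2] at h4
    change dist (γ t : V) (δ t : V) < 1
    linarith
  · have h1 : (δ t : V) = (radialProj x q₀ : V) := congrArg Subtype.val ht
    have e : (δ t : V) = ‖bernsteinApproximation n c t‖⁻¹ • bernsteinApproximation n c t :=
      coe_radialProj x (hb0 t)
    refine ⟨(‖q₀‖ * ‖bernsteinApproximation n c t‖⁻¹, t), ?_⟩
    have h2 : ∑ k : Fin (n + 1), (bernsteinPolynomial ℝ n k).eval (t : ℝ) • c (bernstein.z k)
        = bernsteinApproximation n c t := by
      rw [bernsteinApproximation.apply]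
      rfl
    simp only [B]
    rw [h2, mul_smul, ← e, h1, norm_smul_radialProj]

theorem simplyConnectedSpace_sphere {m : ℕ} (hm : 2 ≤ m) : SimplyConnectedSpace (Sph m) := by
  rw [simply_connected_iff_loops_nullhomotopic]
  refine ⟨?_, fun x γ => ?_⟩
  · rw [← isPathConnected_iff_pathConnectedSpace]
    refine isPathConnected_sphere ?_ _ zero_le_one
    rw [← finrank_eq_rank, finrank_euclideanSpace_fin]
    exact_mod_cast (by omega : 1 < m + 1)
  · obtain ⟨δ, q, h1, h2⟩ := exists_homotopic_forall_ne hm γ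
    exact h1.trans (homotopic_refl_of_forall_ne δ h2)

theorem simplyConnectedSpace_prod {X Y : Type*} [TopologicalSpace X] [TopologicalSpace Y]
    [SimplyConnectedSpace X] [SimplyConnectedSpace Y] : SimplyConnectedSpace (X × Y) := by
  rw [simply_connected_iff_paths_homotopic]
  refine ⟨inferInstance, fun x y => ⟨fun a b => ?_⟩⟩
  rw [← Path.Homotopic.prod_projLeft_projRight a, ← Path.Homotopic.prod_projLeft_projRight b,
    Subsingleton.elim (Path.Homotopic.projLeft a) (Path.Homotopic.projLeft b),
    Subsingleton.elim (Path.Homotopic.projRight a) (Path.Homotopic.projRight b)]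

theorem isEmpty_sphProd_homeomorph_sphere (k m : ℕ) : IsEmpty (SphProd k ≃ₜ Sph m) := by
  refine ⟨fun h => not_nullhomotopic_id_sphere_two ?_⟩
  have hne : (sphere (0 : EuclideanSpace ℝ (Fin (k + 1))) 1).Nonempty :=
    NormedSpace.sphere_nonempty.2 zero_le_one
  have hne2 : (sphere (0 : EuclideanSpace ℝ (Fin 3)) 1).Nonempty :=
    NormedSpace.sphere_nonempty.2 zero_le_one
  obtain ⟨b, hb⟩ := hne
  obtain ⟨a, ha⟩ := hne2
  let b' : Sph k := ⟨b, hb⟩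
  let q := h (⟨a, ha⟩, b')
  have := contractibleSpace_sphere_compl_singleton q
  let i : C(Sph 2, ({q}ᶜ : Set (Sph m))) := ⟨fun u => ⟨h (u, -b'), fun hu => by
    have h1 := congrArg Prod.snd (h.injective hu)
    exact ne_neg_of_mem_unit_sphere ℝ b' h1.symm⟩, by fun_prop⟩
  let j : C(({q}ᶜ : Set (Sph m)), Sph 2) := ⟨fun z => (h.symm z.1).1, by fun_prop⟩
  have hji : j.comp i = ContinuousMap.id _ := by
    ext1 u
    simp [i, j]
  rw [← hji]
  have h1 := id_nullhomotopic ({q}ᶜ : Set (Sph m))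
  have h2 := (h1.comp_left i).comp_right j
  simpa using h2

end SphereTopology

section PseudoEuclideanFrame

/-- In a space of dimension `n + 2` with a symmetric bilinear form, `n` vectors with invertible Gram
matrix together with a null pair orthogonal to them leave no room for another orthogonal vector. -/
theorem eq_zero_of_orthogonal_frame {W : Type*} [AddCommGroup W] [Module ℝ W]
    [FiniteDimensional ℝ W] (B : W →ₗ[ℝ] W →ₗ[ℝ] ℝ) (hB : ∀ v w, B v w = B w v) {n : ℕ}
    (hn : finrank ℝ W = n + 2) (e : Fin n → W) (x y : W)
    (hG : (Matrix.of fun i j => B (e i) (e j)).det ≠ 0)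
    (hxx : B x x = 0) (hyy : B y y = 0) (hxy : B x y = -1) (hex : ∀ i, B (e i) x = 0)
    (hey : ∀ i, B (e i) y = 0) {z : W} (hze : ∀ i, B z (e i) = 0) (hzx : B z x = 0)
    (hzy : B z y = 0) : z = 0 := by
  let Ψ : W →ₗ[ℝ] (Fin n → ℝ) × ℝ × ℝ :=
    (LinearMap.pi fun i => B.flip (e i)).prod ((B.flip x).prod (B.flip y))
  have hΨ : ∀ w, Ψ w = (fun i => B w (e i), B w x, B w y) := fun w => rfl
  have hdim : finrank ℝ W = finrank ℝ ((Fin n → ℝ) × ℝ × ℝ) := by simp [hn]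
  have hsurj : Function.Surjective Ψ := by
    rintro ⟨t, r, s⟩
    let G : Matrix (Fin n) (Fin n) ℝ := Matrix.of fun i j => B (e i) (e j)
    let a := Matrix.vecMul t G⁻¹
    have ha : Matrix.vecMul a G = t := by
      rw [Matrix.vecMul_vecMul, Matrix.nonsing_inv_mul _ (isUnit_iff_ne_zero.2 hG),
        Matrix.vecMul_one]
    refine ⟨∑ i, a i • e i - s • x - r • y, ?_⟩
    rw [hΨ]
    refine Prod.ext ?_ (Prod.ext ?_ ?_)
    · funext j
      have := congrFun ha j
      simp only [Matrix.vecMul, dotProduct, G, Matrix.of_apply] at this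
      simp [hB x (e j), hB y (e j), hex, hey, this]
    · simp [hex, hxx, hB y x, hxy]
    · simp [hey, hyy, hxy]
  have hinj := (LinearMap.injective_iff_surjective_of_finrank_eq_finrank hdim).2 hsurj
  refine hinj ?_
  rw [map_zero, hΨ, hzx, hzy]
  simp only [hze]
  rfl

end PseudoEuclideanFrame

namespace Coord

open Filter Topology

section Calculus

variable {E : Type*} [NormedAddCommGroup E] [NormedSpace ℝ E] [FiniteDimensional ℝ E]
  {W : Type*} [NormedAddCommGroup W] [NormedSpace ℝ W]

/-- The partial derivative `∂X/∂u^i` of a vector-valued function. -/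
noncomputable def vecDeriv (X : E → W) (i : Fin (finrank ℝ E)) (u : E) : W :=
  fderiv ℝ X u (finBasis ℝ E i)

theorem _root_.ContDiffAt.vecDeriv {X : E → W} {u : E} {m n : ℕ∞ω} (hX : ContDiffAt ℝ n X u)
    (hmn : m + 1 ≤ n) (i : Fin (finrank ℝ E)) : ContDiffAt ℝ m (vecDeriv X i) u :=
  (hX.fderiv_right hmn).clm_apply contDiffAt_const

theorem vecDeriv_congr {X Y : E → W} {u : E} (h : X =ᶠ[𝓝 u] Y) (i : Fin (finrank ℝ E)) :
    vecDeriv X i u = vecDeriv Y i u := by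
  rw [vecDeriv, h.fderiv_eq, vecDeriv]

theorem vecDeriv_comm {X : E → W} {u : E} (hX : ContDiffAt ℝ 2 X u) (i j : Fin (finrank ℝ E)) :
    vecDeriv (vecDeriv X j) i u = vecDeriv (vecDeriv X i) j u := by
  have hd : DifferentiableAt ℝ (fderiv ℝ X) u :=
    (hX.fderiv_right (m := 1) (by norm_num)).differentiableAt one_ne_zero
  have h : ∀ i j, vecDeriv (vecDeriv X j) i u
      = fderiv ℝ (fderiv ℝ X) u (finBasis ℝ E i) (finBasis ℝ E j) := by
    intro i j
    unfold vecDeriv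
    rw [fderiv_clm_apply hd (differentiableAt_const _)]
    simp
  rw [h, h]
  exact (hX.isSymmSndFDerivAt (by simp)).eq _ _

theorem partialDeriv_bilin (B : W →L[ℝ] W →L[ℝ] ℝ) {X Y : E → W} {u : E}
    (hX : DifferentiableAt ℝ X u) (hY : DifferentiableAt ℝ Y u) (i : Fin (finrank ℝ E)) :
    partialDeriv (fun w => B (X w) (Y w)) i u
      = B (vecDeriv X i u) (Y u) + B (X u) (vecDeriv Y i u) := by
  have h := (B.hasFDerivAt_of_bilinear hX.hasFDerivAt hY.hasFDerivAt).fderiv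
  unfold partialDeriv
  rw [h]
  simp [vecDeriv, add_comm]

theorem partialDeriv_congr {h h' : E → ℝ} {u : E} (hh : h =ᶠ[𝓝 u] h') (i : Fin (finrank ℝ E)) :
    partialDeriv h i u = partialDeriv h' i u :=
  vecDeriv_congr hh i

theorem partialDeriv_sum_mul {ι : Type*} [Fintype ι] {p q : ι → E → ℝ} {u : E}
    (hp : ∀ l, DifferentiableAt ℝ (p l) u) (hq : ∀ l, DifferentiableAt ℝ (q l) u)
    (i : Fin (finrank ℝ E)) :
    partialDeriv (fun w => ∑ l, p l w * q l w) i u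
      = ∑ l, (partialDeriv (p l) i u * q l u + p l u * partialDeriv (q l) i u) := by
  unfold partialDeriv
  rw [fderiv_fun_sum (A := fun l w => p l w * q l w) fun l _ => (hp l).mul (hq l),
    sum_apply]
  refine Finset.sum_congr rfl fun l _ => ?_
  rw [fderiv_fun_mul (hp l) (hq l)]
  simp
  ring

theorem differentiableAt_det {n : Type*} [Fintype n] [DecidableEq n] {A : E → Matrix n n ℝ} {u : E}
    (h : ∀ i j, DifferentiableAt ℝ (fun w => A w i j) u) :
    DifferentiableAt ℝ (fun w => (A w).det) u := by
  simp only [Matrix.det_apply']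
  refine DifferentiableAt.fun_sum fun σ _ => (differentiableAt_const _).mul ?_
  classical
  exact ((HasFDerivAt.finsetProd (u := Finset.univ) (g := fun i w => A w (σ i) i)
    fun i _ => (h (σ i) i).hasFDerivAt).differentiableAt).congr_of_eventuallyEq
      (Eventually.of_forall fun w => by simp)

theorem differentiableAt_inv {n : Type*} [Fintype n] [DecidableEq n] {A : E → Matrix n n ℝ} {u : E}
    (h : ∀ i j, DifferentiableAt ℝ (fun w => A w i j) u) (hdet : (A u).det ≠ 0) (i j : n) :
    DifferentiableAt ℝ (fun w => (A w)⁻¹ i j) u := by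
  simp only [Matrix.inv_def, Matrix.smul_apply, Ring.inverse_eq_inv', smul_eq_mul,
    Matrix.adjugate_apply]
  refine ((differentiableAt_det h).inv hdet).mul (differentiableAt_det fun k l => ?_)
  by_cases hk : k = j
  · subst hk; simp
  · simpa [Matrix.updateRow_ne hk] using h k l

end Calculus

section Gauss

variable {E : Type*} [NormedAddCommGroup E] [NormedSpace ℝ E] [FiniteDimensional ℝ E]
  {W : Type*} [NormedAddCommGroup W] [NormedSpace ℝ W] (B : W →L[ℝ] W →L[ℝ] ℝ)

/-- The metric coefficients induced on the parameter space by `X` from a bilinear form `B`. -/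
noncomputable def gram (X : E → W) (u : E) : Matrix (Fin (finrank ℝ E)) (Fin (finrank ℝ E)) ℝ :=
  fun i j => B (vecDeriv X i u) (vecDeriv X j u)

theorem christoffel_congr {G G' : E → Matrix (Fin (finrank ℝ E)) (Fin (finrank ℝ E)) ℝ} {u : E}
    (h : G =ᶠ[𝓝 u] G') (k i j : Fin (finrank ℝ E)) :
    christoffel G k i j u = christoffel G' k i j u := by
  have h' : ∀ a b, (fun w => G w a b) =ᶠ[𝓝 u] fun w => G' w a b := fun a b =>
    h.mono fun w hw => congrFun (congrFun hw a) b
  unfold christoffel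
  rw [h.eq_of_nhds]
  simp only [partialDeriv_congr (h' _ _)]

theorem riemann_congr {G G' : E → Matrix (Fin (finrank ℝ E)) (Fin (finrank ℝ E)) ℝ} {u : E}
    (h : G =ᶠ[𝓝 u] G') (l k i j : Fin (finrank ℝ E)) :
    riemann G l k i j u = riemann G' l k i j u := by
  have h' : ∀ a b c, christoffel G a b c =ᶠ[𝓝 u] christoffel G' a b c := fun a b c =>
    h.eventuallyEq_nhds.mono fun w hw => christoffel_congr hw a b c
  unfold riemann
  simp only [partialDeriv_congr (h' _ _ _), (h' _ _ _).eq_of_nhds]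

theorem schouten_congr {G G' : E → Matrix (Fin (finrank ℝ E)) (Fin (finrank ℝ E)) ℝ} {u : E}
    (h : G =ᶠ[𝓝 u] G') : schouten G u = schouten G' u := by
  have hr : ricci G u = ricci G' u := by
    funext j k
    simp only [ricci, riemann_congr h]
  unfold schouten scalarCurvature
  rw [hr, h.eq_of_nhds]

variable {B}

theorem gram_symm (hB : ∀ v w, B v w = B w v)
    (X : E → W) (u : E) (i j : Fin (finrank ℝ E)) :
    gram B X u i j = gram B X u j i := hB _ _

theorem partialDeriv_gram (hB : ∀ v w, B v w = B w v)
    {X : E → W} {u : E} (hX : ContDiffAt ℝ 2 X u)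
    (i j k : Fin (finrank ℝ E)) :
    partialDeriv (fun w => gram B X w j k) i u
      = B (vecDeriv (vecDeriv X j) i u) (vecDeriv X k u)
        + B (vecDeriv (vecDeriv X k) i u) (vecDeriv X j u) := by
  have h := fun j => (hX.vecDeriv (m := 1) (by norm_num) j).differentiableAt one_ne_zero
  rw [hB (vecDeriv (vecDeriv X k) i u)]
  exact partialDeriv_bilin B (h j) (h k) i

theorem christoffel_gram (hB : ∀ v w, B v w = B w v)
    {X : E → W} {u : E} (hX : ContDiffAt ℝ 2 X u)
    (k i j : Fin (finrank ℝ E)) :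
    christoffel (gram B X) k i j u
      = ∑ a, (gram B X u)⁻¹ k a * B (vecDeriv (vecDeriv X j) i u) (vecDeriv X a u) := by
  unfold christoffel
  rw [Finset.mul_sum]
  refine Finset.sum_congr rfl fun a _ => ?_
  rw [partialDeriv_gram hB hX, partialDeriv_gram hB hX, partialDeriv_gram hB hX,
    vecDeriv_comm hX i j, vecDeriv_comm hX i a, vecDeriv_comm hX j a]
  ring

theorem sum_christoffel_mul_gram (hB : ∀ v w, B v w = B w v)
    {X : E → W} {u : E} (hX : ContDiffAt ℝ 2 X u)
    (hdet : (gram B X u).det ≠ 0) (i j m : Fin (finrank ℝ E)) :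
    ∑ l, christoffel (gram B X) l i j u * gram B X u l m
      = B (vecDeriv (vecDeriv X j) i u) (vecDeriv X m u) := by
  have h1 : Matrix.vecMul (fun a => B (vecDeriv (vecDeriv X j) i u) (vecDeriv X a u))
      (gram B X u)⁻¹ = fun l => christoffel (gram B X) l i j u := by
    funext l
    rw [christoffel_gram hB hX]
    simp only [Matrix.vecMul, dotProduct]
    have hs : ((gram B X u)⁻¹).transpose = (gram B X u)⁻¹ := by
      rw [Matrix.transpose_nonsing_inv]
      congr 1
      ext a b
      exact gram_symm hB X u b a
    refine Finset.sum_congr rfl fun a _ => ?_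
    rw [mul_comm, ← Matrix.transpose_apply (gram B X u)⁻¹, hs]
  have h2 : Matrix.vecMul (fun l => christoffel (gram B X) l i j u) (gram B X u)
      = fun a => B (vecDeriv (vecDeriv X j) i u) (vecDeriv X a u) := by
    rw [← h1, Matrix.vecMul_vecMul, Matrix.nonsing_inv_mul _ (isUnit_iff_ne_zero.2 hdet),
      Matrix.vecMul_one]
  exact congrFun h2 m

theorem differentiableAt_gram {X : E → W} {u : E} (hX : ContDiffAt ℝ 2 X u)
    (i j : Fin (finrank ℝ E)) : DifferentiableAt ℝ (fun w => gram B X w i j) u := by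
  have h := fun j => (hX.vecDeriv (m := 1) (by norm_num) j).differentiableAt one_ne_zero
  exact (B.hasFDerivAt_of_bilinear (h i).hasFDerivAt (h j).hasFDerivAt).differentiableAt

theorem differentiableAt_christoffel_gram (hB : ∀ v w, B v w = B w v)
    {X : E → W} {u : E} (hX : ContDiffAt ℝ 3 X u)
    (hdet : (gram B X u).det ≠ 0) (k i j : Fin (finrank ℝ E)) :
    DifferentiableAt ℝ (christoffel (gram B X) k i j) u := by
  have hX2 : ContDiffAt ℝ 2 X u := hX.of_le (by norm_num)
  have h1 := fun j => hX.vecDeriv (m := 2) (by norm_num) j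
  have hev : ∀ᶠ w in 𝓝 u, ContDiffAt ℝ 2 X w := hX2.eventually (by simp)
  have heq : (christoffel (gram B X) k i j) =ᶠ[𝓝 u] fun w =>
      ∑ a, (gram B X w)⁻¹ k a * B (vecDeriv (vecDeriv X j) i w) (vecDeriv X a w) :=
    hev.mono fun w hw => christoffel_gram hB hw k i j
  refine DifferentiableAt.congr_of_eventuallyEq ?_ heq
  refine DifferentiableAt.fun_sum fun a _ => ?_
  refine (differentiableAt_inv (differentiableAt_gram hX2) hdet k a).mul ?_
  exact (B.hasFDerivAt_of_bilinear
    (((h1 j).vecDeriv (m := 1) (by norm_num) i).differentiableAt one_ne_zero).hasFDerivAt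
    ((h1 a).differentiableAt two_ne_zero).hasFDerivAt).differentiableAt

/-- The Gauss equation. -/
theorem sum_riemann_mul_gram (hB : ∀ v w, B v w = B w v)
    {X : E → W} {u : E} (hX : ContDiffAt ℝ 3 X u)
    (hdet : (gram B X u).det ≠ 0) (k i j m : Fin (finrank ℝ E)) :
    ∑ l, riemann (gram B X) l k i j u * gram B X u l m
      = B (vecDeriv (vecDeriv X k) j u
            - ∑ l, christoffel (gram B X) l j k u • vecDeriv X l u) (vecDeriv (vecDeriv X m) i u)
        - B (vecDeriv (vecDeriv X k) i u
            - ∑ l, christoffel (gram B X) l i k u • vecDeriv X l u)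
              (vecDeriv (vecDeriv X m) j u) := by
  have hX2 : ContDiffAt ℝ 2 X u := hX.of_le (by norm_num)
  have h1 := fun j => hX.vecDeriv (m := 2) (by norm_num) j
  have hev : ∀ᶠ w in 𝓝 u, ContDiffAt ℝ 2 X w := hX2.eventually (by simp)
  have hevd : ∀ᶠ w in 𝓝 u, (gram B X w).det ≠ 0 :=
    (differentiableAt_det (differentiableAt_gram hX2)).continuousAt.eventually_ne hdet
  have hder : ∀ i j, ∑ l, (partialDeriv (christoffel (gram B X) l j k) i u * gram B X u l m
        + christoffel (gram B X) l j k u * (B (vecDeriv (vecDeriv X l) i u) (vecDeriv X m u)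
            + B (vecDeriv (vecDeriv X m) i u) (vecDeriv X l u)))
      = B (vecDeriv (vecDeriv (vecDeriv X k) j) i u) (vecDeriv X m u)
        + B (vecDeriv (vecDeriv X k) j u) (vecDeriv (vecDeriv X m) i u) := by
    intro i j
    have heq : (fun w => ∑ l, christoffel (gram B X) l j k w * gram B X w l m) =ᶠ[𝓝 u]
        fun w => B (vecDeriv (vecDeriv X k) j w) (vecDeriv X m w) := by
      filter_upwards [hev, hevd] with w hw hwd
      exact sum_christoffel_mul_gram hB hw hwd j k m
    have h2 := partialDeriv_congr heq i
    rw [partialDeriv_sum_mul (fun l => differentiableAt_christoffel_gram hB hX hdet l j k)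
      (fun l => differentiableAt_gram hX2 l m), partialDeriv_bilin B
      (((h1 k).vecDeriv (m := 1) (by norm_num) j).differentiableAt one_ne_zero)
      ((h1 m).differentiableAt two_ne_zero)] at h2
    simp only [partialDeriv_gram hB hX2] at h2
    exact h2
  have hquad : ∀ i j, ∑ l, (∑ a, christoffel (gram B X) l i a u * christoffel (gram B X) a j k u)
        * gram B X u l m
      = ∑ a, christoffel (gram B X) a j k u
        * B (vecDeriv (vecDeriv X a) i u) (vecDeriv X m u) := by
    intro i j
    simp only [Finset.sum_mul]
    rw [Finset.sum_comm]
    refine Finset.sum_congr rfl fun a _ => ?_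
    rw [← sum_christoffel_mul_gram hB hX2 hdet i a m, Finset.mul_sum]
    refine Finset.sum_congr rfl fun l _ => ?_
    ring
  have hsym : vecDeriv (vecDeriv (vecDeriv X k) j) i u = vecDeriv (vecDeriv (vecDeriv X k) i) j u :=
    vecDeriv_comm (h1 k) i j
  have e1 := hder i j
  have e2 := hder j i
  have q1 := hquad i j
  have q2 := hquad j i
  rw [hsym] at e1
  simp only [mul_add, Finset.sum_add_distrib] at e1 e2
  simp only [riemann, Finset.sum_sub_distrib, add_mul, sub_mul, Finset.sum_add_distrib, map_sub,
    map_sum, map_smul, sub_apply, sum_apply,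
    smul_apply, smul_eq_mul]
  simp only [hB (vecDeriv (vecDeriv X m) _ u)] at e1 e2
  linarith

variable [FiniteDimensional ℝ W]

/-- The curvature of the metric induced by a map `X` into the null cone of `B`: with `y` the null
normal vector with `B X y = -1`, only the component of the second fundamental form along `X`
enters. -/
theorem sum_riemann_mul_gram_of_null (hB : ∀ v w, B v w = B w v)
    (hdim : finrank ℝ W = finrank ℝ E + 2) {X : E → W} {u : E} (hX : ContDiffAt ℝ 3 X u)
    (hdet : (gram B X u).det ≠ 0) (hnull : ∀ᶠ w in 𝓝 u, B (X w) (X w) = 0) {y : W}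
    (hyy : B y y = 0) (hXy : B (X u) y = -1) (hy : ∀ i, B (vecDeriv X i u) y = 0)
    {a : Matrix (Fin (finrank ℝ E)) (Fin (finrank ℝ E)) ℝ}
    (ha : ∀ i j, a i j = -B (vecDeriv (vecDeriv X j) i u) y) (k i j m : Fin (finrank ℝ E)) :
    ∑ l, riemann (gram B X) l k i j u * gram B X u l m
      = a i k * gram B X u j m + gram B X u i k * a j m
        - (a j k * gram B X u i m + gram B X u j k * a i m) := by
  have hX2 : ContDiffAt ℝ 2 X u := hX.of_le (by norm_num)
  have hev : ∀ᶠ w in 𝓝 u, ContDiffAt ℝ 2 X w := hX2.eventually (by simp)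
  have hXX : ∀ i, ∀ᶠ w in 𝓝 u, B (vecDeriv X i w) (X w) = 0 := by
    intro i
    filter_upwards [hev, hnull.eventually_nhds] with w hw hn
    have hd := hw.differentiableAt two_ne_zero
    have h1 := partialDeriv_bilin B hd hd i
    have h2 : partialDeriv (fun w => B (X w) (X w)) i w = 0 := by
      have h3 : (fun w => B (X w) (X w)) =ᶠ[𝓝 w] fun _ => (0 : ℝ) := hn
      rw [partialDeriv_congr h3]
      simp [partialDeriv]
    rw [h2, hB (X w)] at h1
    linarith
  have hXXj : ∀ i j, B (vecDeriv (vecDeriv X j) i u) (X u) = -gram B X u i j := by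
    intro i j
    have h1 := partialDeriv_bilin B
      ((hX2.vecDeriv (m := 1) (by norm_num) j).differentiableAt one_ne_zero)
      (hX2.differentiableAt two_ne_zero) i
    have h2 : partialDeriv (fun w => B (vecDeriv X j w) (X w)) i u = 0 := by
      have h3 : (fun w => B (vecDeriv X j w) (X w)) =ᶠ[𝓝 u] fun _ => (0 : ℝ) := hXX j
      rw [partialDeriv_congr h3]
      simp [partialDeriv]
    rw [h2, hB (vecDeriv X j u)] at h1
    simp only [gram]
    linarith
  have hII : ∀ j k, vecDeriv (vecDeriv X k) j u
      - ∑ l, christoffel (gram B X) l j k u • vecDeriv X l u = a j k • X u + gram B X u j k • y := by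
    intro j k
    rw [← sub_eq_zero]
    refine eq_zero_of_orthogonal_frame
      (B.toLinearMap₁₂) hB hdim
      (fun i => vecDeriv X i u) (X u) y hdet hnull.self_of_nhds hyy hXy
      (fun i => (hXX i).self_of_nhds) hy ?_ ?_ ?_
    · intro i
      have h1 := sum_christoffel_mul_gram hB hX2 hdet j k i
      simp only [gram] at h1
      have h2 : B (X u) (vecDeriv X i u) = 0 := by rw [hB]; exact (hXX i).self_of_nhds
      have h3 : B y (vecDeriv X i u) = 0 := by rw [hB]; exact hy i
      change B (_ - _ - (_ + _)) _ = 0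
      simp [h1, h2, h3]
    · have h3 : B y (X u) = -1 := by rw [hB]; exact hXy
      change B (_ - _ - (_ + _)) _ = 0
      simp [hXXj, (hXX _).self_of_nhds, hnull.self_of_nhds, h3]
    · change B (_ - _ - (_ + _)) _ = 0
      simp [hy, hXy, hyy, ha]
  have hyX : ∀ i j, B y (vecDeriv (vecDeriv X j) i u) = -a i j := fun i j => by rw [hB, ha, neg_neg]
  have hXX' : ∀ i j, B (X u) (vecDeriv (vecDeriv X j) i u) = -gram B X u i j := fun i j => by
    rw [hB, hXXj]
  rw [sum_riemann_mul_gram hB hX hdet, hII, hII]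
  simp only [map_add, map_smul, add_apply, smul_apply,
    hyX, hXX', smul_eq_mul]
  ring

/-- The Schouten tensor of the metric induced by a map into the null cone. -/
theorem schouten_gram_of_null (hB : ∀ v w, B v w = B w v)
    (hdim : finrank ℝ W = finrank ℝ E + 2) (hE : 3 ≤ finrank ℝ E)
    {X : E → W} {u : E} (hX : ContDiffAt ℝ 3 X u)
    (hdet : (gram B X u).det ≠ 0) (hnull : ∀ᶠ w in 𝓝 u, B (X w) (X w) = 0) {y : W}
    (hyy : B y y = 0) (hXy : B (X u) y = -1) (hy : ∀ i, B (vecDeriv X i u) y = 0)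
    {a : Matrix (Fin (finrank ℝ E)) (Fin (finrank ℝ E)) ℝ}
    (ha : ∀ i j, a i j = -B (vecDeriv (vecDeriv X j) i u) y) :
    schouten (gram B X) u = -a := by
  have hX2 : ContDiffAt ℝ 2 X u := hX.of_le (by norm_num)
  set g := gram B X u with hg
  have hgs : g.transpose = g := by ext i j; exact gram_symm hB X u j i
  have has : a.transpose = a := by ext i j; simp [ha, vecDeriv_comm hX2 i j]
  have hu : IsUnit g.det := isUnit_iff_ne_zero.2 hdet
  have hlow := sum_riemann_mul_gram_of_null hB hdim hX hdet hnull hyy hXy hy ha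
  have hup : ∀ l k i j, riemann (gram B X) l k i j u
      = a i k * (1 : Matrix _ _ ℝ) j l + g i k * (a * g⁻¹) j l
        - (a j k * (1 : Matrix _ _ ℝ) i l + g j k * (a * g⁻¹) i l) := by
    intro l k i j
    have h1 : Matrix.vecMul (fun l => riemann (gram B X) l k i j u) g
        = fun m => a i k * g j m + g i k * a j m - (a j k * g i m + g j k * a i m) := by
      funext m
      exact hlow k i j m
    have h2 : Matrix.vecMul (Matrix.vecMul (fun l => riemann (gram B X) l k i j u) g) g⁻¹
        = fun l => riemann (gram B X) l k i j u := by
      rw [Matrix.vecMul_vecMul, Matrix.mul_nonsing_inv _ hu, Matrix.vecMul_one]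
    rw [← congrFun h2 l, h1, ← Matrix.mul_nonsing_inv _ hu]
    simp only [Matrix.vecMul, dotProduct, Matrix.mul_apply, Finset.mul_sum,
      ← Finset.sum_add_distrib, ← Finset.sum_sub_distrib]
    refine Finset.sum_congr rfl fun m _ => ?_
    ring
  have hric : ∀ j k, ricci (gram B X) u j k
      = -((finrank ℝ E : ℝ) - 2) * a j k - (a * g⁻¹).trace * g j k := by
    intro j k
    have e1 : ∑ i, a i k * (1 : Matrix (Fin (finrank ℝ E)) _ ℝ) j i = a j k := by
      simp [Matrix.one_apply]
    have e2 : ∑ i, g i k * (a * g⁻¹) j i = a j k := by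
      have : ((a * g⁻¹) * g) j k = a j k := by
        rw [Matrix.mul_assoc, Matrix.nonsing_inv_mul _ hu, Matrix.mul_one]
      rw [← this, Matrix.mul_apply]
      exact Finset.sum_congr rfl fun i _ => mul_comm _ _
    have e3 : ∑ i, a j k * (1 : Matrix (Fin (finrank ℝ E)) _ ℝ) i i = finrank ℝ E * a j k := by
      simp
    have e4 : ∑ i, g j k * (a * g⁻¹) i i = g j k * (a * g⁻¹).trace := by
      rw [Matrix.trace, Finset.mul_sum]; rfl
    simp only [ricci, hup, Finset.sum_sub_distrib, Finset.sum_add_distrib, e1, e2, e3, e4]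
    ring
  have hgi : g⁻¹.transpose = g⁻¹ := by rw [Matrix.transpose_nonsing_inv, hgs]
  have htr : ∀ c : Matrix (Fin (finrank ℝ E)) (Fin (finrank ℝ E)) ℝ,
      ∑ j, ∑ k, g⁻¹ j k * c j k = (c * g⁻¹).trace := by
    intro c
    simp only [Matrix.trace, Matrix.diag, Matrix.mul_apply]
    refine Finset.sum_congr rfl fun j _ => Finset.sum_congr rfl fun k _ => ?_
    rw [mul_comm, ← Matrix.transpose_apply g⁻¹, hgi]
  have hscal : scalarCurvature (gram B X) u
      = -(2 * ((finrank ℝ E : ℝ) - 1)) * (a * g⁻¹).trace := by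
    have : ricci (gram B X) u = -((finrank ℝ E : ℝ) - 2) • a - (a * g⁻¹).trace • g := by
      ext j k; rw [hric]; simp
    unfold scalarCurvature
    rw [← hg, htr, this]
    simp [Matrix.sub_mul, Matrix.mul_nonsing_inv _ hu]
    ring
  have hE' : (3 : ℝ) ≤ finrank ℝ E := by exact_mod_cast hE
  ext i j
  simp only [schouten, hric, hscal, ← hg, Matrix.neg_apply]
  have h1 : (finrank ℝ E : ℝ) - 2 ≠ 0 := by intro h; linarith
  have h2 : (finrank ℝ E : ℝ) - 1 ≠ 0 := by intro h; linarith
  field_simp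
  ring

/-- The metric induced by a map into the null cone and an affine hyperplane `B X y = -1` with `y`
null is flat. -/
theorem riemann_gram_eq_zero (hB : ∀ v w, B v w = B w v)
    (hdim : finrank ℝ W = finrank ℝ E + 2) {X : E → W} {u : E} (hX : ContDiffAt ℝ 3 X u)
    (hdet : (gram B X u).det ≠ 0) (hnull : ∀ᶠ w in 𝓝 u, B (X w) (X w) = 0) {y : W}
    (hyy : B y y = 0) (hXy : ∀ᶠ w in 𝓝 u, B (X w) y = -1) (l k i j : Fin (finrank ℝ E)) :
    riemann (gram B X) l k i j u = 0 := by
  have hX2 : ContDiffAt ℝ 2 X u := hX.of_le (by norm_num)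
  have hev : ∀ᶠ w in 𝓝 u, ContDiffAt ℝ 2 X w := hX2.eventually (by simp)
  have hder : ∀ {Y : E → W} {w : E} {c : ℝ} (i), DifferentiableAt ℝ Y w →
      (∀ᶠ v in 𝓝 w, B (Y v) y = c) → B (vecDeriv Y i w) y = 0 := by
    intro Y w c i hY h
    have h1 := partialDeriv_bilin B hY (differentiableAt_const y) i
    have h2 : (fun w => B (Y w) y) =ᶠ[𝓝 w] fun _ => c := h
    rw [partialDeriv_congr h2] at h1
    simp [partialDeriv, vecDeriv] at h1
    exact h1.symm
  have h1 : ∀ i, ∀ᶠ w in 𝓝 u, B (vecDeriv X i w) y = 0 := by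
    intro i
    filter_upwards [hev, hXy.eventually_nhds] with w hw hn
    exact hder i (hw.differentiableAt two_ne_zero) hn
  have hlow := sum_riemann_mul_gram_of_null hB hdim hX hdet hnull hyy hXy.self_of_nhds
    (fun i => (h1 i).self_of_nhds) (a := 0) (fun i j => by
      rw [hder i ((hX2.vecDeriv (m := 1) (by norm_num) j).differentiableAt one_ne_zero) (h1 j)]
      simp) k i j
  have h2 : Matrix.vecMul (fun l => riemann (gram B X) l k i j u) (gram B X u) = 0 := by
    funext m
    refine (hlow m).trans ?_
    simp
  exact congrFun (Matrix.eq_zero_of_vecMul_eq_zero hdet h2) l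

end Gauss

end Coord

section HomBundle

open Filter Topology

variable {E H M : Type*} [NormedAddCommGroup E] [NormedSpace ℝ E] [TopologicalSpace H]
  {I : ModelWithCorners ℝ E H} [TopologicalSpace M] [ChartedSpace H M]
  {F₁ F₂ : Type*} [NormedAddCommGroup F₁] [NormedSpace ℝ F₁] [FiniteDimensional ℝ F₁]
  [NormedAddCommGroup F₂] [NormedSpace ℝ F₂]
  {V₁ V₂ : M → Type*}
  [TopologicalSpace (TotalSpace F₁ V₁)] [∀ x, TopologicalSpace (V₁ x)]
  [∀ x, AddCommGroup (V₁ x)] [∀ x, Module ℝ (V₁ x)] [FiberBundle F₁ V₁] [VectorBundle ℝ F₁ V₁]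
  [TopologicalSpace (TotalSpace F₂ V₂)] [∀ x, TopologicalSpace (V₂ x)]
  [∀ x, AddCommGroup (V₂ x)] [∀ x, Module ℝ (V₂ x)] [FiberBundle F₂ V₂] [VectorBundle ℝ F₂ V₂]
  [∀ x, IsTopologicalAddGroup (V₂ x)] [∀ x, ContinuousSMul ℝ (V₂ x)]

/-- A family of continuous linear maps on a finite-dimensional space is smooth if it is smooth when
applied to each vector. -/
theorem contMDiffAt_clm_of_apply {n : ℕ∞ω} {A : M → F₁ →L[ℝ] F₂} {x₀ : M}
    (h : ∀ v, ContMDiffAt I 𝓘(ℝ, F₂) n (fun x => A x v) x₀) :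
    ContMDiffAt I 𝓘(ℝ, F₁ →L[ℝ] F₂) n A x₀ := by
  let b := finBasis ℝ F₁
  let c : Fin (finrank ℝ F₁) → F₁ →L[ℝ] ℝ := fun i => (b.coord i).toContinuousLinearMap
  have hA : A = fun x => ∑ i, ContinuousLinearMap.smulRightL ℝ F₁ F₂ (c i) (A x (b i)) := by
    funext x
    ext v
    have h1 := congrArg (A x) (b.sum_repr v)
    rw [map_sum] at h1
    simpa [c] using h1.symm
  rw [hA]
  refine ContMDiffAt.sum fun i _ => ?_
  exact ((ContinuousLinearMap.smulRightL ℝ F₁ F₂ (c i)).contMDiff.contMDiffAt).comp x₀ (h (b i))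

/-- A section of a bundle of homomorphisms is smooth at a point if it maps sections which are smooth
there to such sections. -/
theorem contMDiffAt_hom_of_apply {n : ℕ∞ω} [ContMDiffVectorBundle n F₁ V₁ I]
    {φ : ∀ x, V₁ x →L[ℝ] V₂ x} {x₀ : M}
    (h : ∀ σ : (∀ x, V₁ x),
      ContMDiffAt I (I.prod 𝓘(ℝ, F₁)) n (fun x => TotalSpace.mk' F₁ x (σ x)) x₀ →
      ContMDiffAt I (I.prod 𝓘(ℝ, F₂)) n (fun x => TotalSpace.mk' F₂ x (φ x (σ x))) x₀) :
    ContMDiffAt I (I.prod 𝓘(ℝ, F₁ →L[ℝ] F₂)) n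
      (fun x => TotalSpace.mk' (F₁ →L[ℝ] F₂) (E := fun x => V₁ x →L[ℝ] V₂ x) x (φ x)) x₀ := by
  rw [contMDiffAt_hom_bundle]
  refine ⟨contMDiffAt_id, contMDiffAt_clm_of_apply fun v => ?_⟩
  let e := trivializationAt F₁ V₁ x₀
  have h0 : x₀ ∈ e.baseSet := FiberBundle.mem_baseSet_trivializationAt' x₀
  have h0' := FiberBundle.mem_baseSet_trivializationAt' (F := F₂) (E := V₂) x₀
  have hσ : ContMDiffAt I (I.prod 𝓘(ℝ, F₁)) n
      (fun x => TotalSpace.mk' F₁ x (e.symm x v)) x₀ := by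
    refine (contMDiffAt_section x₀).2 ?_
    refine (contMDiffAt_const (c := v)).congr_of_eventuallyEq ?_
    filter_upwards [e.open_baseSet.mem_nhds h0] with x hx
    rw [show trivializationAt F₁ V₁ x₀ = e from rfl]
    rw [Trivialization.apply_mk_symm e hx]
  have h1 := (contMDiffAt_section x₀).1 (h _ hσ)
  refine h1.congr_of_eventuallyEq ?_
  filter_upwards [e.open_baseSet.mem_nhds h0,
    (trivializationAt F₂ V₂ x₀).open_baseSet.mem_nhds h0'] with x hx hx'
  rw [ContinuousLinearMap.inCoordinates_eq hx hx']
  simp only [ContinuousLinearMap.comp_apply, ContinuousLinearEquiv.coe_coe]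
  rw [Trivialization.continuousLinearEquivAt_apply]
  rfl

end HomBundle

section VectorValued

open Filter Topology

variable {E H M : Type*} [NormedAddCommGroup E] [NormedSpace ℝ E] [TopologicalSpace H]
  {I : ModelWithCorners ℝ E H} [TopologicalSpace M] [ChartedSpace H M] [IsManifold I ∞ M]
  {W : Type*} [NormedAddCommGroup W] [NormedSpace ℝ W]

/-- The derivative of a smooth vector-valued function in the direction of a smooth vector field is
smooth. -/
theorem ContMDiffAt.mvfderiv_apply {X : M → W} (hX : ContMDiff I 𝓘(ℝ, W) ∞ X)
    {σ : ∀ p : M, TangentSpace I p} {p₀ : M}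
    (hσ : ContMDiffAt I (I.prod 𝓘(ℝ, E)) ∞ (fun p => TotalSpace.mk' E p (σ p)) p₀) :
    ContMDiffAt I 𝓘(ℝ, W) ∞ (fun p => mvfderiv I X p (σ p)) p₀ := by
  have h1 := (hX.contMDiff_tangentMap (m := ∞) (by simp)).contMDiffAt
    (x := TotalSpace.mk' E p₀ (σ p₀))
  have h2 := h1.comp p₀ hσ
  exact (contMDiff_snd_tangentBundle_modelSpace W 𝓘(ℝ, W)).contMDiffAt.comp p₀ h2

theorem MDifferentiableAt.mvfderiv_apply {X : M → W} (hX : ContMDiff I 𝓘(ℝ, W) ∞ X)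
    {σ : ∀ p : M, TangentSpace I p} {p₀ : M}
    (hσ : MDifferentiableAt I (I.prod 𝓘(ℝ, E)) (fun p => TotalSpace.mk' E p (σ p)) p₀) :
    MDifferentiableAt I 𝓘(ℝ, W) (fun p => mvfderiv I X p (σ p)) p₀ := by
  have h1 := ((hX.contMDiff_tangentMap (m := ∞) (by simp)).contMDiffAt
    (x := TotalSpace.mk' E p₀ (σ p₀))).mdifferentiableAt (by simp)
  have h2 := h1.comp p₀ hσ
  have h3 : ContMDiff 𝓘(ℝ, W).tangent 𝓘(ℝ, W) ∞ (fun p : TangentBundle 𝓘(ℝ, W) W => p.2) :=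
    contMDiff_snd_tangentBundle_modelSpace W 𝓘(ℝ, W)
  exact (h3.contMDiffAt.mdifferentiableAt (by simp)).comp p₀ h2

end VectorValued

section SpacelikeProjection

variable {E W : Type*} [NormedAddCommGroup E] [NormedSpace ℝ E]
  [NormedAddCommGroup W] [NormedSpace ℝ W] (B : W →L[ℝ] W →L[ℝ] ℝ)

/-- The map `w ↦ B w ∘ L`. -/
noncomputable def pullForm (L : E →L[ℝ] W) : W →L[ℝ] E →L[ℝ] ℝ :=
  ((ContinuousLinearMap.compL ℝ E W ℝ).flip L).comp B

/-- The `B`-orthogonal projection of `W` to the range of the spacelike linear map `L`, read in the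
domain of `L`. -/
noncomputable def spacelikeProj (L : E →L[ℝ] W) : W →L[ℝ] E :=
  ((pullForm B L).comp L).inverse.comp (pullForm B L)

@[simp]
theorem pullForm_apply (L : E →L[ℝ] W) (w : W) (v : E) : pullForm B L w v = B w (L v) := rfl

variable {B} [FiniteDimensional ℝ E]

theorem isInvertible_pullForm {L : E →L[ℝ] W} (hL : ∀ v, v ≠ 0 → 0 < B (L v) (L v)) :
    ((pullForm B L).comp L).IsInvertible := by
  have hinj : Function.Injective ((pullForm B L).comp L) := by
    rw [injective_iff_map_eq_zero]
    intro v hv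
    by_contra h
    have h1 := hL v h
    have h2 : B (L v) (L v) = 0 := by
      rw [← pullForm_apply, ← ContinuousLinearMap.comp_apply, hv]
      rfl
    exact h1.ne' h2
  have hd : finrank ℝ E = finrank ℝ (E →L[ℝ] ℝ) := by
    rw [← (LinearMap.toContinuousLinearMap (𝕜 := ℝ) (E := E) (F' := ℝ)).finrank_eq,
      finrank_linearMap, finrank_self, mul_one]
  refine ⟨(LinearEquiv.ofInjectiveOfFinrankEq
    ((pullForm B L).comp L).toLinearMap hinj hd).toContinuousLinearEquiv, ?_⟩
  ext v
  rfl

theorem spacelikeProj_spec {L : E →L[ℝ] W} (hL : ∀ v, v ≠ 0 → 0 < B (L v) (L v)) (w : W) (v : E) :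
    B (L (spacelikeProj B L w)) (L v) = B w (L v) := by
  obtain ⟨A, hA⟩ := isInvertible_pullForm hL
  rw [← pullForm_apply, ← pullForm_apply, ← ContinuousLinearMap.comp_apply, ← hA, spacelikeProj,
    ← hA]
  simp

theorem eq_spacelikeProj {L : E →L[ℝ] W} (hL : ∀ v, v ≠ 0 → 0 < B (L v) (L v)) {w : W} {u : E}
    (h : ∀ v, B (L u) (L v) = B w (L v)) : u = spacelikeProj B L w := by
  by_contra hne
  have h1 := hL _ (sub_ne_zero.2 hne)
  have h2 : B (L (u - spacelikeProj B L w)) (L (u - spacelikeProj B L w)) = 0 := by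
    rw [map_sub L, map_sub B, sub_apply, ← map_sub L, h, spacelikeProj_spec hL, sub_self]
  exact h1.ne' h2

theorem spacelikeProj_apply_self {L : E →L[ℝ] W} (hL : ∀ v, v ≠ 0 → 0 < B (L v) (L v)) (v : E) :
    spacelikeProj B L (L v) = v :=
  (eq_spacelikeProj hL fun _ => rfl).symm

theorem spacelikeProj_comp {L : E →L[ℝ] W} (hL : ∀ v, v ≠ 0 → 0 < B (L v) (L v))
    {E' : Type*} [NormedAddCommGroup E'] [NormedSpace ℝ E'] [FiniteDimensional ℝ E']
    (A : E' ≃L[ℝ] E) (w : W) : A (spacelikeProj B (L.comp (A : E' →L[ℝ] E)) w)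
      = spacelikeProj B L w := by
  have hL' : ∀ v, v ≠ 0 → 0 < B (L.comp (A : E' →L[ℝ] E) v) (L.comp (A : E' →L[ℝ] E) v) :=
    fun v hv => hL _ (by simpa using hv)
  refine eq_spacelikeProj hL fun v => ?_
  simpa using spacelikeProj_spec hL' w (A.symm v)

set_option synthInstance.maxHeartbeats 200000 in
theorem contDiffAt_spacelikeProj {n : ℕ∞ω} {L : E →L[ℝ] W}
    (hL : ∀ v, v ≠ 0 → 0 < B (L v) (L v)) :
    ContDiffAt ℝ n (fun L : E →L[ℝ] W => spacelikeProj B L) L := by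
  have h0 : ContDiff ℝ n (fun L : E →L[ℝ] W => (ContinuousLinearMap.compL ℝ E W ℝ).flip L) :=
    ContinuousLinearMap.contDiff _
  have h1 : ContDiff ℝ n (fun L : E →L[ℝ] W => pullForm B L) := h0.clm_comp contDiff_const
  have h2 : ContDiff ℝ n (fun L : E →L[ℝ] W => (pullForm B L).comp L) := h1.clm_comp contDiff_id
  have h3 : ContDiffAt ℝ n (fun L : E →L[ℝ] W => ((pullForm B L).comp L).inverse) L :=
    ContDiffAt.comp (f := fun L : E →L[ℝ] W => (pullForm B L).comp L) L
      (isInvertible_pullForm hL).contDiffAt_map_inverse h2.contDiffAt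
  exact h3.clm_comp h1.contDiffAt

end SpacelikeProjection

section Immersion

open Filter Topology

variable {E H M : Type*} [NormedAddCommGroup E] [NormedSpace ℝ E] [TopologicalSpace H]
  {I : ModelWithCorners ℝ E H} [TopologicalSpace M] [ChartedSpace H M]
  {W : Type*} [NormedAddCommGroup W] [NormedSpace ℝ W]
  (B : W →L[ℝ] W →L[ℝ] ℝ) (f : M → W)

variable (I) in
/-- The map `f : M → W` is a spacelike immersion with respect to the bilinear form `B`. -/
def IsSpacelikeImmersion : Prop :=
  ContMDiff I 𝓘(ℝ, W) ∞ f ∧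
    ∀ (p : M) (v : TangentSpace I p), v ≠ 0 → 0 < B (mvfderiv I f p v) (mvfderiv I f p v)

variable (I) in
/-- The `B`-orthogonal projection of `W` to the tangent space at `p` of the immersion `f`. -/
noncomputable def tangentProj (p : M) : W →L[ℝ] TangentSpace I p :=
  spacelikeProj (E := E) B (mvfderiv I f p)

variable {B f}

variable (I B f) in
/-- The bilinear form `(v, w) ↦ B (df v, df w)` on a tangent space. -/
noncomputable def pullbackForm (p : M) : TangentSpace I p →L[ℝ] TangentSpace I p →L[ℝ] ℝ :=
  (pullForm (E := E) B (mvfderiv I f p)).comp (mvfderiv I f p)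

@[simp]
theorem pullbackForm_apply (p : M) (v w : TangentSpace I p) :
    pullbackForm I B f p v w = B (mvfderiv I f p v) (mvfderiv I f p w) := rfl

variable [FiniteDimensional ℝ E]

theorem tangentProj_spec (hf : IsSpacelikeImmersion I B f) (p : M) (w : W)
    (v : TangentSpace I p) :
    B (mvfderiv I f p (tangentProj I B f p w)) (mvfderiv I f p v) = B w (mvfderiv I f p v) :=
  spacelikeProj_spec (E := E) (hf.2 p) w v

theorem tangentProj_apply_self (hf : IsSpacelikeImmersion I B f) (p : M) (v : TangentSpace I p) :
    tangentProj I B f p (mvfderiv I f p v) = v :=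
  spacelikeProj_apply_self (E := E) (hf.2 p) v

variable [IsManifold I ∞ M]

/-- The tangential part of a smooth vector field along a spacelike immersion is smooth. -/
theorem IsSpacelikeImmersion.contMDiffAt_tangentProj (hf : IsSpacelikeImmersion I B f) {w : M → W}
    {p₀ : M} (hw : ContMDiffAt I 𝓘(ℝ, W) ∞ w p₀) :
    ContMDiffAt I (I.prod 𝓘(ℝ, E)) ∞ (fun p => TotalSpace.mk' E p (tangentProj I B f p (w p)))
      p₀ := by
  have : IsManifold I 1 M := IsManifold.of_le (n := ∞) (by norm_cast)
  let e := trivializationAt E (TangentSpace I : M → Type _) p₀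
  have h0 : p₀ ∈ e.baseSet := FiberBundle.mem_baseSet_trivializationAt' p₀
  let L : M → E →L[ℝ] W := fun p => (mvfderiv I f p).comp (e.symmL ℝ p)
  have hL : ContMDiffAt I 𝓘(ℝ, E →L[ℝ] W) ∞ L p₀ := by
    refine contMDiffAt_clm_of_apply fun v => ?_
    refine ContMDiffAt.mvfderiv_apply hf.1 (σ := fun p => e.symmL ℝ p v) ?_
    refine (contMDiffAt_section p₀).2 ?_
    refine (contMDiffAt_const (c := v)).congr_of_eventuallyEq ?_
    filter_upwards [e.open_baseSet.mem_nhds h0] with x hx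
    rw [show trivializationAt E (TangentSpace I : M → Type _) p₀ = e from rfl,
      Trivialization.symmL_apply e hx, Trivialization.apply_mk_symm e hx]
  have hcomp : ∀ p (hp : p ∈ e.baseSet), L p = (mvfderiv I f p).comp
      ((e.continuousLinearEquivAt ℝ p hp).symm : E →L[ℝ] TangentSpace I p) := by
    intro p hp
    ext v
    exact congrArg (mvfderiv I f p)
      (congrFun (Trivialization.symm_continuousLinearEquivAt_eq e hp) v).symm
  have hpos : ∀ p ∈ e.baseSet, ∀ v, v ≠ 0 → 0 < B (L p v) (L p v) := by
    intro p hp v hv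
    rw [hcomp p hp]
    exact hf.2 p _ fun h => hv ((e.continuousLinearEquivAt ℝ p hp).symm.injective
      (h.trans (map_zero (e.continuousLinearEquivAt ℝ p hp).symm).symm))
  have h1 : ContMDiffAt I 𝓘(ℝ, E) ∞ (fun p => spacelikeProj B (L p) (w p)) p₀ :=
    ContMDiffAt.clm_apply
      ((contDiffAt_spacelikeProj (hpos p₀ h0)).contMDiffAt.comp p₀ hL) hw
  refine (contMDiffAt_section p₀).2 (h1.congr_of_eventuallyEq ?_)
  filter_upwards [e.open_baseSet.mem_nhds h0] with p hp
  have h2 : ((e.continuousLinearEquivAt ℝ p hp).symm : E ≃L[ℝ] TangentSpace I p)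
      (spacelikeProj B (L p) (w p)) = tangentProj I B f p (w p) := by
    rw [hcomp p hp]
    exact spacelikeProj_comp (E := E) (hf.2 p) (e.continuousLinearEquivAt ℝ p hp).symm (w p)
  rw [← h2]
  have h3 := congrFun (Trivialization.continuousLinearEquivAt_apply ℝ e p hp)
    ((e.continuousLinearEquivAt ℝ p hp).symm (spacelikeProj B (L p) (w p)))
  rw [ContinuousLinearEquiv.apply_symm_apply] at h3
  exact h3.symm

theorem isVonNBounded_of_posDef {G : E →L[ℝ] E →L[ℝ] ℝ} (hG : ∀ v, v ≠ 0 → 0 < G v v) :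
    Bornology.IsVonNBounded ℝ {v : E | G v v < 1} := by
  rw [NormedSpace.isVonNBounded_iff]
  have hcont : Continuous fun v : E => G v v := by fun_prop
  have hcompact : IsCompact (Metric.sphere (0 : E) 1) := isCompact_sphere 0 1
  obtain ⟨m, hm, hmin⟩ : ∃ m : ℝ, 0 < m ∧ ∀ v ∈ Metric.sphere (0 : E) 1, m ≤ G v v := by
    rcases (Metric.sphere (0 : E) 1).eq_empty_or_nonempty with h | h
    · exact ⟨1, one_pos, by simp [h]⟩
    · obtain ⟨v₀, hv₀, hmin⟩ := hcompact.exists_isMinOn h hcont.continuousOn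
      refine ⟨G v₀ v₀, hG v₀ ?_, fun v hv => hmin hv⟩
      rintro rfl
      simp at hv₀
  refine (Metric.isBounded_iff_subset_closedBall 0).2 ⟨1 / √m, fun v hv => ?_⟩
  rw [mem_closedBall_zero_iff]
  by_cases h0 : v = 0
  · rw [h0, norm_zero]
    positivity
  have hn : 0 < ‖v‖ := norm_pos_iff.2 h0
  have h1 := hmin (‖v‖⁻¹ • v) (by simp [norm_smul, hn.ne'])
  simp only [map_smul, smul_apply, smul_eq_mul] at h1
  have h2 : m * ‖v‖ ^ 2 < 1 := by
    have : G v v < 1 := hv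
    have h3 : m * ‖v‖ ^ 2 ≤ G v v := by
      calc m * ‖v‖ ^ 2 ≤ ‖v‖⁻¹ * (‖v‖⁻¹ * G v v) * ‖v‖ ^ 2 := by gcongr
        _ = G v v := by field_simp
    linarith
  rw [le_div_iff₀ (Real.sqrt_pos.2 hm), ← abs_of_pos (mul_pos hn (Real.sqrt_pos.2 hm)),
    ← sq_le_one_iff_abs_le_one, mul_pow, Real.sq_sqrt hm.le]
  linarith

/-- The Riemannian metric induced by a spacelike immersion. -/
noncomputable def IsSpacelikeImmersion.inducedMetric (hf : IsSpacelikeImmersion I B f)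
    (hB : ∀ v w, B v w = B w v) :
    ContMDiffRiemannianMetric I ∞ E (TangentSpace I : M → Type _) where
  inner := pullbackForm I B f
  symm p v w := hB _ _
  pos p v hv := hf.2 p v hv
  isVonNBounded p := isVonNBounded_of_posDef (E := E) (G := pullbackForm I B f p) (hf.2 p)
  contMDiff p := by
    have : IsManifold I (∞ + 1) M := inferInstanceAs (IsManifold I ∞ M)
    refine contMDiffAt_hom_of_apply (V₂ := fun p : M => TangentSpace I p →L[ℝ] ℝ)
      fun σ hσ => ?_
    refine contMDiffAt_hom_of_apply (V₂ := Bundle.Trivial M ℝ) fun τ hτ => ?_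
    refine (contMDiffAt_section p).2 ?_
    have h1 := ContMDiffAt.mvfderiv_apply hf.1 hσ
    have h2 := ContMDiffAt.mvfderiv_apply hf.1 hτ
    exact ((contMDiffAt_const (c := B)).clm_apply h1).clm_apply h2

end Immersion

section Chart

open Filter Topology VectorField

variable {E H M : Type*} [NormedAddCommGroup E] [NormedSpace ℝ E]
  [TopologicalSpace H] {I : ModelWithCorners ℝ E H} [I.Boundaryless]
  [TopologicalSpace M] [ChartedSpace H M] [IsManifold I ∞ M]
  {W : Type*} [NormedAddCommGroup W] [NormedSpace ℝ W]

theorem mdifferentiableAt_extChartAt_symm_of_mem {q : M} {u : E}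
    (hu : u ∈ (extChartAt I q).target) :
    MDifferentiableAt 𝓘(ℝ, E) I (extChartAt I q).symm u :=
  ((contMDiffOn_extChartAt_symm (n := ∞) q).contMDiffAt
    ((isOpen_extChartAt_target q).mem_nhds hu)).mdifferentiableAt (by simp)

theorem fderiv_comp_extChartAt_symm {Z : M → W} {q : M} {u : E}
    (hu : u ∈ (extChartAt I q).target)
    (hZ : MDifferentiableAt I 𝓘(ℝ, W) Z ((extChartAt I q).symm u)) (v : E) :
    fderiv ℝ (Z ∘ (extChartAt I q).symm) u v
      = mvfderiv I Z ((extChartAt I q).symm u) (mfderiv 𝓘(ℝ, E) I (extChartAt I q).symm u v) := by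
  rw [← mfderiv_eq_fderiv]
  exact mfderiv_comp_apply u hZ (mdifferentiableAt_extChartAt_symm_of_mem hu) v

theorem mfderiv_extChartAt_symm_self (q : M) (v : E) :
    mfderiv 𝓘(ℝ, E) I (extChartAt I q).symm (extChartAt I q q) v = v := by
  have : IsManifold I 1 M := IsManifold.of_le (n := ∞) (by norm_cast)
  have h := mfderivWithin_range_extChartAt_symm (I := I) (x := q)
  rw [I.range_eq_univ, mfderivWithin_univ] at h
  rw [h]
  rfl

theorem fderiv_comp_extChartAt_symm_self {Z : M → W} {q : M}
    (hZ : MDifferentiableAt I 𝓘(ℝ, W) Z q) (v : TangentSpace I q) :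
    fderiv ℝ (Z ∘ (extChartAt I q).symm) (extChartAt I q q) v = mvfderiv I Z q v := by
  have h := fderiv_comp_extChartAt_symm (mem_extChartAt_target (I := I) q)
    (Z := Z) (by rwa [extChartAt_to_inv]) v
  rw [h]
  have h1 := mfderiv_extChartAt_symm_self (I := I) q v
  have h2 : ∀ p (w : E), p = q → mvfderiv I Z p w = mvfderiv I Z q w := by
    rintro p w rfl
    rfl
  rw [h1]
  exact h2 _ _ (extChartAt_to_inv q)

theorem contDiffAt_comp_extChartAt_symm {Z : M → W} (hZ : ContMDiff I 𝓘(ℝ, W) ∞ Z) {q : M} {u : E}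
    (hu : u ∈ (extChartAt I q).target) : ContDiffAt ℝ ∞ (Z ∘ (extChartAt I q).symm) u :=
  (hZ.contMDiffAt.comp u ((contMDiffOn_extChartAt_symm (n := ∞) q).contMDiffAt
    ((isOpen_extChartAt_target q).mem_nhds hu))).contDiffAt

variable [CompleteSpace E]

/-- The second derivative of a smooth vector-valued function commutes up to the Lie bracket. -/
theorem mvfderiv_mlieBracket {Z : M → W} (hZ : ContMDiff I 𝓘(ℝ, W) ∞ Z)
    {X Y : ∀ p : M, TangentSpace I p} {q : M}
    (hX : MDifferentiableAt I (I.prod 𝓘(ℝ, E)) (fun p => TotalSpace.mk' E p (X p)) q)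
    (hY : MDifferentiableAt I (I.prod 𝓘(ℝ, E)) (fun p => TotalSpace.mk' E p (Y p)) q) :
    mvfderiv I (fun p => mvfderiv I Z p (Y p)) q (X q)
        - mvfderiv I (fun p => mvfderiv I Z p (X p)) q (Y q)
      = mvfderiv I Z q (mlieBracket I X Y q) := by
  have : IsManifold I 1 M := IsManifold.of_le (n := ∞) (by norm_cast)
  have : IsManifold I 2 M := IsManifold.of_le (n := ∞) (by norm_cast)
  let x₀ := extChartAt I q q
  let Zc : E → W := Z ∘ (extChartAt I q).symm
  let pull : (∀ p : M, TangentSpace I p) → E → E := fun σ =>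
    mpullbackWithin 𝓘(ℝ, E) I (extChartAt I q).symm σ (Set.range I)
  have hZd : ∀ p, MDifferentiableAt I 𝓘(ℝ, W) Z p := fun p =>
    hZ.contMDiffAt.mdifferentiableAt (by simp)
  have hpull : ∀ σ, ∀ u ∈ (extChartAt I q).target,
      mfderiv 𝓘(ℝ, E) I (extChartAt I q).symm u (pull σ u) = σ ((extChartAt I q).symm u) := by
    intro σ u hu
    have h := isInvertible_mfderivWithin_extChartAt_symm (I := I) hu
    obtain ⟨A, hA⟩ := h
    have h1 : mfderiv 𝓘(ℝ, E) I (extChartAt I q).symm u = A := by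
      rw [hA, I.range_eq_univ, mfderivWithin_univ]
    have h2 : pull σ u = A.symm (σ ((extChartAt I q).symm u)) := by
      simp only [pull, mpullbackWithin_apply]
      rw [← hA, ContinuousLinearMap.inverse_equiv]
      rfl
    rw [h1, h2]
    exact A.apply_symm_apply _
  have hself : ∀ σ, pull σ x₀ = σ q := by
    intro σ
    have h := hpull σ x₀ (mem_extChartAt_target q)
    rw [mfderiv_extChartAt_symm_self] at h
    have h2 : ∀ p, p = q → (σ p : E) = σ q := by
      rintro p rfl
      rfl
    exact h.trans (h2 _ (extChartAt_to_inv q))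
  have hdiff : ∀ σ : (∀ p : M, TangentSpace I p),
      MDifferentiableAt I (I.prod 𝓘(ℝ, E)) (fun p => TotalSpace.mk' E p (σ p)) q →
      DifferentiableAt ℝ (pull σ) x₀ := by
    intro σ hσ
    have h := MDifferentiableWithinAt.differentiableWithinAt_mpullbackWithin_vectorField
      (s := Set.univ) (hσ.mdifferentiableWithinAt)
    rw [Set.preimage_univ, Set.univ_inter] at h
    have h' : DifferentiableWithinAt ℝ (pull σ) (Set.range I) x₀ := h
    rwa [I.range_eq_univ, differentiableWithinAt_univ] at h'
  have hZ2 : ContDiffAt ℝ 2 Zc x₀ :=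
    (contDiffAt_comp_extChartAt_symm hZ (mem_extChartAt_target q)).of_le (by norm_cast)
  have hdd : DifferentiableAt ℝ (fderiv ℝ Zc) x₀ :=
    (hZ2.fderiv_right (m := 1) (by norm_num)).differentiableAt one_ne_zero
  have hsecond : ∀ σ : (∀ p : M, TangentSpace I p),
      MDifferentiableAt I (I.prod 𝓘(ℝ, E)) (fun p => TotalSpace.mk' E p (σ p)) q →
      ∀ v : TangentSpace I q, mvfderiv I (fun p => mvfderiv I Z p (σ p)) q v
        = fderiv ℝ (fderiv ℝ Zc) x₀ v (σ q) + fderiv ℝ Zc x₀ (fderiv ℝ (pull σ) x₀ v) := by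
    intro σ hσ v
    rw [← fderiv_comp_extChartAt_symm_self (MDifferentiableAt.mvfderiv_apply hZ hσ)]
    have hev : ((fun p => mvfderiv I Z p (σ p)) ∘ (extChartAt I q).symm)
        =ᶠ[𝓝 x₀] fun u => fderiv ℝ Zc u (pull σ u) := by
      filter_upwards [(isOpen_extChartAt_target q).mem_nhds (mem_extChartAt_target (I := I) q)]
        with u hu
      rw [Function.comp_apply, fderiv_comp_extChartAt_symm hu (hZd _), hpull σ u hu]
    have h1 : ∀ v : E, fderiv ℝ (fun u => fderiv ℝ Zc u (pull σ u)) x₀ v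
        = fderiv ℝ (fderiv ℝ Zc) x₀ v (pull σ x₀)
          + fderiv ℝ Zc x₀ (fderiv ℝ (pull σ) x₀ v) := by
      intro v
      rw [fderiv_clm_apply hdd (hdiff σ hσ)]
      simp only [add_apply, ContinuousLinearMap.comp_apply, ContinuousLinearMap.flip_apply]
      rw [add_comm]
    rw [hev.fderiv_eq]
    refine (h1 v).trans ?_
    rw [hself]
  rw [hsecond Y hY, hsecond X hX, ← fderiv_comp_extChartAt_symm_self (hZd q)]
  have hsymm := (hZ2.isSymmSndFDerivAt (by simp)).eq (X q : E) (Y q : E)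
  have hbr : (mlieBracket I X Y q : E)
      = fderiv ℝ (pull Y) x₀ (X q) - fderiv ℝ (pull X) x₀ (Y q) := by
    rw [← mlieBracketWithin_univ, mlieBracketWithin_apply, Set.preimage_univ, Set.univ_inter]
    rw [mfderiv_extChartAt_self]
    have h1 : ∀ v : E, (ContinuousLinearMap.id ℝ E).inverse v = v := fun v => by
      rw [ContinuousLinearMap.inverse_id]
      rfl
    refine (h1 _).trans ?_
    change lieBracketWithin ℝ (pull X) (pull Y) (Set.range I) x₀ = _
    rw [I.range_eq_univ, lieBracketWithin_univ, lieBracket_eq]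
    change fderiv ℝ (pull Y) x₀ (pull X x₀) - fderiv ℝ (pull X) x₀ (pull Y x₀) = _
    rw [hself, hself]
  rw [hbr, map_sub, hsymm]
  abel

end Chart

section TangentialConnection

open Filter Topology VectorField

variable {E H M : Type*} [NormedAddCommGroup E] [NormedSpace ℝ E]
  [TopologicalSpace H] {I : ModelWithCorners ℝ E H}
  [TopologicalSpace M] [ChartedSpace H M]
  {W : Type*} [NormedAddCommGroup W] [NormedSpace ℝ W]
  {B : W →L[ℝ] W →L[ℝ] ℝ} {f : M → W}

theorem mvfderiv_bilin {X Y : M → W} {p : M} (hX : MDifferentiableAt I 𝓘(ℝ, W) X p)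
    (hY : MDifferentiableAt I 𝓘(ℝ, W) Y p) (v : TangentSpace I p) :
    mvfderiv I (fun q => B (X q) (Y q)) p v
      = B (mvfderiv I X p v) (Y p) + B (X p) (mvfderiv I Y p v) := by
  have h1 : HasFDerivAt (fun z : W × W => B z.1 z.2)
      (B.flip (Y p) ∘L ContinuousLinearMap.fst ℝ W W + B (X p) ∘L ContinuousLinearMap.snd ℝ W W)
      (X p, Y p) := by
    have h := B.hasFDerivAt_of_bilinear (hasFDerivAt_fst (𝕜 := ℝ) (p := (X p, Y p)))
      (hasFDerivAt_snd (𝕜 := ℝ) (p := (X p, Y p)))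
    refine h.congr_fderiv ?_
    ext w <;> simp
  have h2 : HasMFDerivAt I 𝓘(ℝ, W × W) (fun q => (X q, Y q)) p
      ((mvfderiv I X p).prod (mvfderiv I Y p)) :=
    ⟨hX.hasMFDerivAt.1.prodMk hY.hasMFDerivAt.1, hX.hasMFDerivAt.2.prodMk hY.hasMFDerivAt.2⟩
  have h3 := DFunLike.congr_fun (h1.hasMFDerivAt.comp p h2).mfderiv v
  exact h3

variable [FiniteDimensional ℝ E]

/-- The bundle homomorphism `TM → TM` which is the tangential part of the differential of `X`. -/
noncomputable def tangentialDifferential (I : ModelWithCorners ℝ E H) (B : W →L[ℝ] W →L[ℝ] ℝ)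
    (f X : M → W) (p : M) :
    TangentSpace I p →L[ℝ] TangentSpace I p :=
  (tangentProj I B f p).comp (mvfderiv I X p)

theorem mvfderiv_tangentialDifferential (hf : IsSpacelikeImmersion I B f) {X : M → W} {p : M}
    {v : TangentSpace I p} (h : ∃ v', mvfderiv I f p v' = mvfderiv I X p v) :
    mvfderiv I f p (tangentialDifferential I B f X p v) = mvfderiv I X p v := by
  obtain ⟨v', hv'⟩ := h
  rw [tangentialDifferential, ContinuousLinearMap.comp_apply, ← hv', tangentProj_apply_self hf]

variable [IsManifold I ∞ M]

/-- The connection on the tangent bundle which is the tangential part of the derivative in the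
ambient space of a spacelike immersion. -/
noncomputable def IsSpacelikeImmersion.connection (hf : IsSpacelikeImmersion I B f) :
    CovariantDerivative I E (TangentSpace I : M → Type _) where
  toFun s p := (tangentProj I B f p).comp (mvfderiv I (fun q => mvfderiv I f q (s q)) p)
  isCovariantDerivativeOnUniv :=
    { add := by
        intro σ σ' p hσ hσ' _
        have h := mvfderiv_fun_add (MDifferentiableAt.mvfderiv_apply hf.1 hσ)
          (MDifferentiableAt.mvfderiv_apply hf.1 hσ')
        ext v
        have h1 : (fun q => mvfderiv I f q ((σ + σ') q))
            = fun q => mvfderiv I f q (σ q) + mvfderiv I f q (σ' q) := by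
          funext q
          exact map_add _ _ _
        simp only [h1, h, ContinuousLinearMap.comp_apply, add_apply, map_add]
      leibniz := by
        intro σ g p hσ hg _
        have h := mvfderiv_fun_smul hg (MDifferentiableAt.mvfderiv_apply hf.1 hσ)
        ext v
        have h1 : (fun q => mvfderiv I f q ((g • σ) q))
            = fun q => g q • mvfderiv I f q (σ q) := by
          funext q
          exact map_smul _ _ _
        simp only [h1, h, ContinuousLinearMap.comp_apply, add_apply, map_add, smul_apply, map_smul,
          ContinuousLinearMap.smulRight_apply, tangentProj_apply_self hf] }

theorem IsSpacelikeImmersion.connection_apply (hf : IsSpacelikeImmersion I B f)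
    (s : ∀ p : M, TangentSpace I p) (p : M) (v : TangentSpace I p) :
    hf.connection s p v
      = tangentProj I B f p (mvfderiv I (fun q => mvfderiv I f q (s q)) p v) := rfl

theorem IsSpacelikeImmersion.contMDiffCovariantDerivativeOn (hf : IsSpacelikeImmersion I B f) :
    letI : IsManifold I 1 M := IsManifold.of_le (n := ∞) (by norm_cast)
    ContMDiffCovariantDerivativeOn E ∞ hf.connection.toFun Set.univ := by
  refine ⟨fun {σ} hσ p _ => ContMDiffAt.contMDiffWithinAt ?_⟩
  have : IsManifold I (∞ + 1) M := inferInstanceAs (IsManifold I ∞ M)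
  have hσ' : ContMDiff I (I.prod 𝓘(ℝ, E)) ∞ (fun p => TotalSpace.mk' E p (σ p)) :=
    contMDiffOn_univ.1 hσ
  have h1 : ContMDiff I 𝓘(ℝ, W) ∞ (fun q => mvfderiv I f q (σ q)) := fun q =>
    ContMDiffAt.mvfderiv_apply hf.1 (hσ' q)
  refine contMDiffAt_hom_of_apply fun τ hτ => ?_
  exact hf.contMDiffAt_tangentProj (ContMDiffAt.mvfderiv_apply h1 hτ)

theorem IsSpacelikeImmersion.connection_metric (hf : IsSpacelikeImmersion I B f)
    (hB : ∀ v w, B v w = B w v) {s t : ∀ p : M, TangentSpace I p}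
    (hs : ContMDiff I (I.prod 𝓘(ℝ, E)) ∞ (fun p => TotalSpace.mk' E p (s p)))
    (ht : ContMDiff I (I.prod 𝓘(ℝ, E)) ∞ (fun p => TotalSpace.mk' E p (t p)))
    (p : M) (v : TangentSpace I p) :
    mvfderiv I (fun q => pullbackForm I B f q (s q) (t q)) p v
      = pullbackForm I B f p (hf.connection s p v) (t p)
        + pullbackForm I B f p (s p) (hf.connection t p v) := by
  have h1 := (ContMDiffAt.mvfderiv_apply hf.1 (hs p)).mdifferentiableAt (by simp)
  have h2 := (ContMDiffAt.mvfderiv_apply hf.1 (ht p)).mdifferentiableAt (by simp)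
  simp only [pullbackForm_apply, hf.connection_apply]
  rw [mvfderiv_bilin h1 h2, tangentProj_spec hf, hB (mvfderiv I f p (s p)) (mvfderiv I f p _),
    tangentProj_spec hf, hB (mvfderiv I _ p v) (mvfderiv I f p (s p))]

theorem isSmoothBundleHom_tangentialDifferential [I.Boundaryless] [T2Space M]
    (hf : IsSpacelikeImmersion I B f)
    {X : M → W} (hX : ContMDiff I 𝓘(ℝ, W) ∞ X) :
    IsSmoothBundleHom E (V := (TangentSpace I : M → Type _))
      (tangentialDifferential I B f X) := by
  intro p
  have : IsManifold I (∞ + 1) M := inferInstanceAs (IsManifold I ∞ M)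
  refine contMDiffAt_hom_of_apply fun τ hτ => ?_
  exact hf.contMDiffAt_tangentProj (ContMDiffAt.mvfderiv_apply hX hτ)

/-- The coherent tangent bundle on `TM` induced by a spacelike immersion `f` and a map `X` whose
differential takes values in the range of the differential of `f`. -/
noncomputable def IsSpacelikeImmersion.coherentTangentBundle [I.Boundaryless] [T2Space M]
    (hf : IsSpacelikeImmersion I B f) (hB : ∀ v w, B v w = B w v) {X : M → W}
    (hX : ContMDiff I 𝓘(ℝ, W) ∞ X)
    (hXf : ∀ (p : M) (v : TangentSpace I p), ∃ v', mvfderiv I f p v' = mvfderiv I X p v) :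
    CoherentTangentBundle I M E (TangentSpace I : M → Type _) where
  rank_eq := rfl
  metric := hf.inducedMetric hB
  D := hf.connection
  D_smooth := hf.contMDiffCovariantDerivativeOn
  D_metric s t hs ht p v := hf.connection_metric hB hs ht p v
  φ := tangentialDifferential I B f X
  φ_smooth := isSmoothBundleHom_tangentialDifferential hf hX
  coherent σ τ hσ hτ p := by
    have h := mvfderiv_mlieBracket hX ((hσ p).mdifferentiableAt (by simp))
      ((hτ p).mdifferentiableAt (by simp))
    simp only [hf.connection_apply, mvfderiv_tangentialDifferential hf (hXf _ _)]
    rw [← map_sub, h]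
    exact sub_self _

end TangentialConnection

section InducedCurvature

open Filter Topology

variable {E H M : Type*} [NormedAddCommGroup E] [NormedSpace ℝ E]
  [TopologicalSpace H] {I : ModelWithCorners ℝ E H} [TopologicalSpace M] [ChartedSpace H M]
  {W : Type*} [NormedAddCommGroup W] [NormedSpace ℝ W]
  {B : W →L[ℝ] W →L[ℝ] ℝ} {X Y : M → W} {q : M} {U : Set M}

theorem eventually_extChartAt_symm_mem (hU : IsOpen U) (hq : q ∈ U) :
    ∀ᶠ u in 𝓝 (extChartAt I q q), (extChartAt I q).symm u ∈ U := by
  have h : ContinuousAt (extChartAt I q).symm (extChartAt I q q) := continuousAt_extChartAt_symm q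
  refine h.eventually_mem (hU.mem_nhds ?_)
  rwa [extChartAt_to_inv]

variable [I.Boundaryless] [IsManifold I ∞ M]

theorem ContMDiffOn.contDiffAt_comp_extChartAt_symm (hU : IsOpen U) (hq : q ∈ U)
    (hX : ContMDiffOn I 𝓘(ℝ, W) ∞ X U) :
    ContDiffAt ℝ 3 (X ∘ (extChartAt I q).symm) (extChartAt I q q) := by
  have h1 : ContMDiffAt I 𝓘(ℝ, W) ∞ X ((extChartAt I q).symm (extChartAt I q q)) :=
    hX.contMDiffAt (hU.mem_nhds (by rwa [extChartAt_to_inv]))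
  have h2 := h1.comp (extChartAt I q q) ((contMDiffOn_extChartAt_symm (n := ∞) q).contMDiffAt
    ((isOpen_extChartAt_target q).mem_nhds (mem_extChartAt_target (I := I) q)))
  exact h2.contDiffAt.of_le (by norm_cast)

variable [FiniteDimensional ℝ E]

theorem vecDeriv_comp_extChartAt_symm_self (hX : MDifferentiableAt I 𝓘(ℝ, W) X q)
    (i : Fin (finrank ℝ E)) :
    Coord.vecDeriv (X ∘ (extChartAt I q).symm) i (extChartAt I q q)
      = mvfderiv I X q (coordFrame I q i) :=
  fderiv_comp_extChartAt_symm_self hX _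

/-- In the preferred chart, a metric induced by a map `X` has the Gram matrix of the coordinate
derivatives of `X` as its coefficients. -/
theorem coordMetric_eventuallyEq_gram {g : ∀ p : M, TangentSpace I p → TangentSpace I p → ℝ}
    (hU : IsOpen U) (hq : q ∈ U) (hX : ContMDiffOn I 𝓘(ℝ, W) ∞ X U)
    (hg : ∀ p ∈ U, ∀ v w, g p v w = B (mvfderiv I X p v) (mvfderiv I X p w)) :
    coordMetric I g q =ᶠ[𝓝 (extChartAt I q q)] Coord.gram B (X ∘ (extChartAt I q).symm) := by
  filter_upwards [eventually_extChartAt_symm_mem hU hq,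
    (isOpen_extChartAt_target q).mem_nhds (mem_extChartAt_target (I := I) q)] with u hu hu'
  ext i j
  have hd : MDifferentiableAt I 𝓘(ℝ, W) X ((extChartAt I q).symm u) :=
    (hX.contMDiffAt (hU.mem_nhds hu)).mdifferentiableAt (by simp)
  rw [coordMetric, hg _ hu]
  simp only [Coord.gram, Coord.vecDeriv]
  rw [fderiv_comp_extChartAt_symm hu' hd, fderiv_comp_extChartAt_symm hu' hd]
  rfl

theorem det_gram_ne_zero (hX : MDifferentiableAt I 𝓘(ℝ, W) X q)
    (hpos : ∀ v : TangentSpace I q, v ≠ 0 → 0 < B (mvfderiv I X q v) (mvfderiv I X q v)) :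
    (Coord.gram B (X ∘ (extChartAt I q).symm) (extChartAt I q q)).det ≠ 0 := by
  intro hdet
  obtain ⟨c, hc, hmul⟩ := Matrix.exists_mulVec_eq_zero_iff.2 hdet
  let v : TangentSpace I q := ∑ i, c i • coordFrame I q i
  have hv : v ≠ 0 := by
    intro h0
    refine hc (funext fun i => ?_)
    exact (Fintype.linearIndependent_iff.1 (coordFrame I q).linearIndependent) c h0 i
  have h1 : ∀ i, B (mvfderiv I X q (coordFrame I q i)) (mvfderiv I X q v) = 0 := by
    intro i
    have h2 := congrFun hmul i
    simp only [Matrix.mulVec, dotProduct, Coord.gram, vecDeriv_comp_extChartAt_symm_self hX,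
      Pi.zero_apply] at h2
    simp only [v, map_sum, map_smul, smul_eq_mul]
    rw [← h2]
    exact Finset.sum_congr rfl fun j _ => mul_comm _ _
  have h3 : B (mvfderiv I X q v) (mvfderiv I X q v) = 0 := by
    have h4 : mvfderiv I X q v = ∑ i, c i • mvfderiv I X q (coordFrame I q i) := by
      simp only [v, map_sum, map_smul]
    have h5 : B (∑ i, c i • mvfderiv I X q (coordFrame I q i)) (mvfderiv I X q v) = 0 := by
      rw [map_sum, sum_apply]
      refine Finset.sum_eq_zero fun i _ => ?_
      rw [map_smul, smul_apply, h1, smul_zero]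
    rwa [← h4] at h5
  exact (hpos v hv).ne' h3

variable [FiniteDimensional ℝ W]

/-- A metric induced by a map into the section of the null cone by an affine hyperplane with null
normal is flat. -/
theorem sectionalCurvature_eq_zero_of_null (hB : ∀ v w, B v w = B w v)
    (hdim : finrank ℝ W = finrank ℝ E + 2)
    {g : ∀ p : M, TangentSpace I p → TangentSpace I p → ℝ}
    (hU : IsOpen U) (hq : q ∈ U) (hX : ContMDiffOn I 𝓘(ℝ, W) ∞ X U)
    (hg : ∀ p ∈ U, ∀ v w, g p v w = B (mvfderiv I X p v) (mvfderiv I X p w))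
    (hpos : ∀ v : TangentSpace I q, v ≠ 0 → 0 < B (mvfderiv I X q v) (mvfderiv I X q v))
    (hnull : ∀ p ∈ U, B (X p) (X p) = 0) {y : W} (hyy : B y y = 0)
    (hXy : ∀ p ∈ U, B (X p) y = -1) (v w : TangentSpace I q) :
    sectionalCurvature I g q v w = 0 := by
  have hXq : MDifferentiableAt I 𝓘(ℝ, W) X q :=
    (hX.contMDiffAt (hU.mem_nhds hq)).mdifferentiableAt (by simp)
  have h : ∀ l k i j, Coord.riemann (coordMetric I g q) l k i j (extChartAt I q q) = 0 := by
    intro l k i j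
    rw [Coord.riemann_congr (coordMetric_eventuallyEq_gram hU hq hX hg)]
    refine Coord.riemann_gram_eq_zero hB hdim (hX.contDiffAt_comp_extChartAt_symm hU hq)
      (det_gram_ne_zero hXq hpos) ?_ hyy ?_ l k i j
    · exact (eventually_extChartAt_symm_mem hU hq).mono fun u hu => hnull _ hu
    · exact (eventually_extChartAt_symm_mem hU hq).mono fun u hu => hXy _ hu
  simp only [sectionalCurvature, h, mul_zero, zero_mul, Finset.sum_const_zero, zero_div]

/-- The metric induced by a map into the null cone is conformally flat. -/
theorem isConformallyFlatOn_of_null (hB : ∀ v w, B v w = B w v)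
    (hdim : finrank ℝ W = finrank ℝ E + 2)
    {g : ∀ p : M, TangentSpace I p → TangentSpace I p → ℝ} {R : Set M} (hR : IsOpen R)
    (hX : ContMDiff I 𝓘(ℝ, W) ∞ X)
    (hg : ∀ p v w, g p v w = B (mvfderiv I X p v) (mvfderiv I X p w))
    (hpos : ∀ p ∈ R, ∀ v : TangentSpace I p, v ≠ 0 →
      0 < B (mvfderiv I X p v) (mvfderiv I X p v))
    (hnull : ∀ p, B (X p) (X p) = 0) (hyy : ∀ p, B (Y p) (Y p) = 0)
    (hXy : ∀ p, B (X p) (Y p) = -1) :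
    IsConformallyFlatOn I g R := by
  intro p hp
  let h : M → ℝ := fun q => -B (X q) (Y p)
  have hh : ContMDiff I 𝓘(ℝ, ℝ) ∞ h :=
    (((contMDiff_const (c := B)).clm_apply hX).clm_apply contMDiff_const).neg
  let U : Set M := R ∩ {q | 0 < h q}
  have hU : IsOpen U := hR.inter (isOpen_lt continuous_const hh.continuous)
  have hpU : p ∈ U := ⟨hp, by simp [h, hXy]⟩
  have hinv : ContMDiffOn I 𝓘(ℝ, ℝ) ∞ (fun q => (h q)⁻¹) U := fun q hq =>
    ((contDiffAt_inv ℝ hq.2.ne').contMDiffAt.comp q hh.contMDiffAt).contMDiffWithinAt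
  let X' : M → W := fun q => (h q)⁻¹ • X q
  have hX' : ContMDiffOn I 𝓘(ℝ, W) ∞ X' U := hinv.smul hX.contMDiffOn
  have horth : ∀ q (v : TangentSpace I q), B (mvfderiv I X q v) (X q) = 0 := by
    intro q v
    have hd : MDifferentiableAt I 𝓘(ℝ, W) X q := hX.contMDiffAt.mdifferentiableAt (by simp)
    have h1 := mvfderiv_bilin (B := B) hd hd v
    simp only [hnull] at h1
    rw [hB (X q), mvfderiv_const] at h1
    simp only [zero_apply] at h1
    linarith
  have hdX' : ∀ q ∈ U, ∀ v w : TangentSpace I q,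
      B (mvfderiv I X' q v) (mvfderiv I X' q w) = (h q)⁻¹ ^ 2 * g q v w := by
    intro q hq v w
    have hd : MDifferentiableAt I 𝓘(ℝ, W) X q := hX.contMDiffAt.mdifferentiableAt (by simp)
    have hd' : MDifferentiableAt I 𝓘(ℝ, ℝ) (fun q => (h q)⁻¹) q :=
      (hinv.contMDiffAt (hU.mem_nhds hq)).mdifferentiableAt (by simp)
    have h1 := mvfderiv_fun_smul hd' hd
    rw [show mvfderiv I X' q = _ from h1, hg]
    simp only [add_apply, smul_apply, map_add, map_smul, smul_eq_mul,
      ContinuousLinearMap.smulRight_apply, horth, hB (X q) (mvfderiv I X q _), hnull]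
    ring
  refine ⟨U, hU, hpU, Set.inter_subset_left, fun q => -Real.log (h q), ?_, ?_⟩
  · intro q hq
    exact ((Real.contDiffAt_log.2 hq.2.ne').neg.contMDiffAt.comp q
      hh.contMDiffAt).contMDiffWithinAt
  · intro q hq v w _
    have hexp : ∀ r ∈ U, Real.exp (2 * -Real.log (h r)) = (h r)⁻¹ ^ 2 := by
      intro r hr
      rw [show 2 * -Real.log (h r) = -Real.log (h r) + -Real.log (h r) by ring, Real.exp_add,
        Real.exp_neg, Real.exp_log hr.2, sq]
    refine sectionalCurvature_eq_zero_of_null hB hdim hU hq hX' ?_ ?_ ?_ (hyy p) ?_ v w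
    · intro r hr a b
      rw [hdX' r hr, hexp r hr]
    · intro a ha
      rw [hdX' q hq, hg]
      exact mul_pos (pow_pos (inv_pos.2 hq.2) 2) (hpos q hq.1 a ha)
    · intro r _
      simp [X', hnull]
    · intro r hr
      have h2 : B (X r) (Y p) = -h r := by simp [h]
      simp only [X', map_smul, smul_apply, h2, smul_eq_mul]
      rw [mul_neg, inv_mul_cancel₀ hr.2.ne']

end InducedCurvature

section NullPair

open Filter Topology

variable {E H M : Type*} [NormedAddCommGroup E] [NormedSpace ℝ E] [FiniteDimensional ℝ E]
  [TopologicalSpace H] {I : ModelWithCorners ℝ E H} [I.Boundaryless]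
  [TopologicalSpace M] [ChartedSpace H M] [IsManifold I ∞ M]
  {W : Type*} [NormedAddCommGroup W] [NormedSpace ℝ W]
  {B : W →L[ℝ] W →L[ℝ] ℝ} {X Y : M → W} {q : M}

/-- If `Y` is orthogonal to the differential of `X`, then the second derivatives of `X` in a chart
have the components `-B (dX, dY)` along `Y`. -/
theorem bilin_vecDeriv_vecDeriv (hX : ContMDiff I 𝓘(ℝ, W) ∞ X) (hY : ContMDiff I 𝓘(ℝ, W) ∞ Y)
    (horth : ∀ p (v : TangentSpace I p), B (mvfderiv I X p v) (Y p) = 0) (q : M)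
    (i j : Fin (finrank ℝ E)) :
    B (Coord.vecDeriv (Coord.vecDeriv (X ∘ (extChartAt I q).symm) j) i (extChartAt I q q)) (Y q)
      = -B (mvfderiv I X q (coordFrame I q j)) (mvfderiv I Y q (coordFrame I q i)) := by
  have hXd : ∀ p, MDifferentiableAt I 𝓘(ℝ, W) X p := fun p =>
    hX.contMDiffAt.mdifferentiableAt (by simp)
  have hYd : ∀ p, MDifferentiableAt I 𝓘(ℝ, W) Y p := fun p =>
    hY.contMDiffAt.mdifferentiableAt (by simp)
  have hmem := mem_extChartAt_target (I := I) q
  have h1 : DifferentiableAt ℝ (Coord.vecDeriv (X ∘ (extChartAt I q).symm) j)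
      (extChartAt I q q) :=
    ((contDiffAt_comp_extChartAt_symm hX hmem).vecDeriv (m := 1) (by norm_cast) j).differentiableAt
      one_ne_zero
  have h2 : DifferentiableAt ℝ (Y ∘ (extChartAt I q).symm) (extChartAt I q q) :=
    (contDiffAt_comp_extChartAt_symm hY hmem).differentiableAt (by simp)
  have h3 := Coord.partialDeriv_bilin B h1 h2 i
  have h4 : (fun u => B (Coord.vecDeriv (X ∘ (extChartAt I q).symm) j u)
      ((Y ∘ (extChartAt I q).symm) u)) =ᶠ[𝓝 (extChartAt I q q)] fun _ => 0 := by
    filter_upwards [(isOpen_extChartAt_target q).mem_nhds hmem] with u hu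
    rw [Coord.vecDeriv, fderiv_comp_extChartAt_symm hu (hXd _)]
    exact horth _ _
  rw [Coord.partialDeriv_congr h4, vecDeriv_comp_extChartAt_symm_self (hXd q),
    vecDeriv_comp_extChartAt_symm_self (hYd q), Function.comp_apply, extChartAt_to_inv] at h3
  simp only [Coord.partialDeriv, fderiv_fun_const, Pi.zero_apply, zero_apply] at h3
  linarith

/-- The second fundamental form `-B (dX, dY)` is symmetric. -/
theorem bilin_mvfderiv_comm (hX : ContMDiff I 𝓘(ℝ, W) ∞ X) (hY : ContMDiff I 𝓘(ℝ, W) ∞ Y)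
    (horth : ∀ p (v : TangentSpace I p), B (mvfderiv I X p v) (Y p) = 0) (q : M)
    (v w : TangentSpace I q) :
    B (mvfderiv I X q v) (mvfderiv I Y q w) = B (mvfderiv I X q w) (mvfderiv I Y q v) := by
  have hbasis : ∀ i j, B (mvfderiv I X q (coordFrame I q j)) (mvfderiv I Y q (coordFrame I q i))
      = B (mvfderiv I X q (coordFrame I q i)) (mvfderiv I Y q (coordFrame I q j)) := by
    intro i j
    have h1 := bilin_vecDeriv_vecDeriv hX hY horth q i j
    have h2 := bilin_vecDeriv_vecDeriv hX hY horth q j i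
    rw [Coord.vecDeriv_comm ((contDiffAt_comp_extChartAt_symm hX
      (mem_extChartAt_target (I := I) q)).of_le (by norm_cast)), h2] at h1
    linarith
  rw [← (coordFrame I q).sum_repr v, ← (coordFrame I q).sum_repr w]
  simp only [map_sum, map_smul, sum_apply, smul_apply, smul_eq_mul, Finset.mul_sum]
  rw [Finset.sum_comm]
  refine Finset.sum_congr rfl fun i _ => Finset.sum_congr rfl fun j _ => ?_
  rw [hbasis]
  ring

variable [FiniteDimensional ℝ W]

theorem schoutenMatrix_of_null (hB : ∀ v w, B v w = B w v)
    (hdim : finrank ℝ W = finrank ℝ E + 2) (hE : 3 ≤ finrank ℝ E)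
    {g : ∀ p : M, TangentSpace I p → TangentSpace I p → ℝ}
    (hX : ContMDiff I 𝓘(ℝ, W) ∞ X) (hY : ContMDiff I 𝓘(ℝ, W) ∞ Y)
    (hg : ∀ p v w, g p v w = B (mvfderiv I X p v) (mvfderiv I X p w))
    (hpos : ∀ v : TangentSpace I q, v ≠ 0 → 0 < B (mvfderiv I X q v) (mvfderiv I X q v))
    (hnull : ∀ p, B (X p) (X p) = 0) (hyy : ∀ p, B (Y p) (Y p) = 0)
    (hXy : ∀ p, B (X p) (Y p) = -1)
    (horth : ∀ p (v : TangentSpace I p), B (mvfderiv I X p v) (Y p) = 0)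
    (i j : Fin (finrank ℝ E)) :
    schoutenMatrix I g q i j
      = -B (mvfderiv I X q (coordFrame I q i)) (mvfderiv I Y q (coordFrame I q j)) := by
  have hXq : MDifferentiableAt I 𝓘(ℝ, W) X q := hX.contMDiffAt.mdifferentiableAt (by simp)
  have h := Coord.schouten_gram_of_null hB hdim hE (X := X ∘ (extChartAt I q).symm)
    (u := extChartAt I q q) (y := Y q)
    (a := Matrix.of fun i j =>
      B (mvfderiv I X q (coordFrame I q j)) (mvfderiv I Y q (coordFrame I q i)))
    ((contDiffAt_comp_extChartAt_symm hX (mem_extChartAt_target (I := I) q)).of_le (by norm_cast))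
    (det_gram_ne_zero hXq hpos) (Eventually.of_forall fun u => hnull _) (hyy q)
    (by rw [Function.comp_apply, extChartAt_to_inv, hXy])
    (fun i => by rw [vecDeriv_comp_extChartAt_symm_self hXq, horth])
    (fun i j => by rw [bilin_vecDeriv_vecDeriv hX hY horth, neg_neg, Matrix.of_apply])
  rw [schoutenMatrix, Coord.schouten_congr (coordMetric_eventuallyEq_gram isOpen_univ
    (Set.mem_univ q) hX.contMDiffOn fun p _ => hg p), h, Matrix.neg_apply, Matrix.of_apply,
    bilin_mvfderiv_comm hX hY horth]

/-- The Schouten tensor of the metric induced by a map `X` into the null cone is `-B (dX, dY)`. -/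
theorem schoutenTensor_of_null (hB : ∀ v w, B v w = B w v)
    (hdim : finrank ℝ W = finrank ℝ E + 2) (hE : 3 ≤ finrank ℝ E)
    {g : ∀ p : M, TangentSpace I p → TangentSpace I p → ℝ}
    (hX : ContMDiff I 𝓘(ℝ, W) ∞ X) (hY : ContMDiff I 𝓘(ℝ, W) ∞ Y)
    (hg : ∀ p v w, g p v w = B (mvfderiv I X p v) (mvfderiv I X p w))
    (hpos : ∀ v : TangentSpace I q, v ≠ 0 → 0 < B (mvfderiv I X q v) (mvfderiv I X q v))
    (hnull : ∀ p, B (X p) (X p) = 0) (hyy : ∀ p, B (Y p) (Y p) = 0)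
    (hXy : ∀ p, B (X p) (Y p) = -1)
    (horth : ∀ p (v : TangentSpace I p), B (mvfderiv I X p v) (Y p) = 0)
    (v w : TangentSpace I q) :
    schoutenTensor I g q v w = -B (mvfderiv I X q v) (mvfderiv I Y q w) := by
  conv_rhs => rw [← (coordFrame I q).sum_repr v, ← (coordFrame I q).sum_repr w]
  simp only [schoutenTensor, schoutenMatrix_of_null hB hdim hE hX hY hg hpos hnull hyy hXy horth,
    map_sum, map_smul, sum_apply, smul_apply, smul_eq_mul, Finset.mul_sum, ← Finset.sum_neg_distrib]
  rw [Finset.sum_comm]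
  exact Finset.sum_congr rfl fun i _ => Finset.sum_congr rfl fun j _ => by ring

theorem bilin_schoutenEndo_of_null (hB : ∀ v w, B v w = B w v)
    (hdim : finrank ℝ W = finrank ℝ E + 2) (hE : 3 ≤ finrank ℝ E)
    {g : ∀ p : M, TangentSpace I p → TangentSpace I p → ℝ}
    (hX : ContMDiff I 𝓘(ℝ, W) ∞ X) (hY : ContMDiff I 𝓘(ℝ, W) ∞ Y)
    (hg : ∀ p v w, g p v w = B (mvfderiv I X p v) (mvfderiv I X p w))
    (hpos : ∀ v : TangentSpace I q, v ≠ 0 → 0 < B (mvfderiv I X q v) (mvfderiv I X q v))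
    (hnull : ∀ p, B (X p) (X p) = 0) (hyy : ∀ p, B (Y p) (Y p) = 0)
    (hXy : ∀ p, B (X p) (Y p) = -1)
    (horth : ∀ p (v : TangentSpace I p), B (mvfderiv I X p v) (Y p) = 0)
    (v w : TangentSpace I q) :
    B (mvfderiv I X q (schoutenEndo I g q v)) (mvfderiv I X q w)
      = -B (mvfderiv I Y q v) (mvfderiv I X q w) := by
  have hXq : MDifferentiableAt I 𝓘(ℝ, W) X q := hX.contMDiffAt.mdifferentiableAt (by simp)
  let G := coordMetric I g q (extChartAt I q q)
  have hG : G = Coord.gram B (X ∘ (extChartAt I q).symm) (extChartAt I q q) :=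
    (coordMetric_eventuallyEq_gram isOpen_univ (Set.mem_univ q) hX.contMDiffOn
      fun p _ => hg p).eq_of_nhds
  have hGij : ∀ i j, G i j
      = B (mvfderiv I X q (coordFrame I q i)) (mvfderiv I X q (coordFrame I q j)) := by
    intro i j
    rw [hG]
    simp only [Coord.gram, vecDeriv_comp_extChartAt_symm_self hXq]
  have hdet : IsUnit G.det := isUnit_iff_ne_zero.2 (hG ▸ det_gram_ne_zero hXq hpos)
  let b := coordFrame I q
  have hrepr : ∀ i, b.repr (schoutenEndo I g q v) i
      = ((G⁻¹ * schoutenMatrix I g q).mulVec (b.repr v)) i := by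
    intro i
    have h := Matrix.repr_toLin b b (G⁻¹ * schoutenMatrix I g q) v
    exact congrFun h i
  have h1 : ∀ j, B (mvfderiv I X q (schoutenEndo I g q v)) (mvfderiv I X q (b j))
      = -B (mvfderiv I Y q v) (mvfderiv I X q (b j)) := by
    intro j
    have h2 : B (mvfderiv I X q (schoutenEndo I g q v)) (mvfderiv I X q (b j))
        = G.mulVec ((G⁻¹ * schoutenMatrix I g q).mulVec (b.repr v)) j := by
      conv_lhs => rw [← b.sum_repr (schoutenEndo I g q v)]
      simp only [map_sum, map_smul, sum_apply, smul_apply, smul_eq_mul, hrepr]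
      rw [Matrix.mulVec, dotProduct]
      refine Finset.sum_congr rfl fun i _ => ?_
      rw [hGij, hB, mul_comm]
    rw [h2, Matrix.mulVec_mulVec, ← Matrix.mul_assoc, Matrix.mul_nonsing_inv _ hdet,
      Matrix.one_mul]
    conv_rhs => rw [← b.sum_repr v]
    simp only [Matrix.mulVec, dotProduct, map_sum, map_smul, sum_apply, smul_apply, smul_eq_mul,
      schoutenMatrix_of_null hB hdim hE hX hY hg hpos hnull hyy hXy horth,
      ← Finset.sum_neg_distrib]
    refine Finset.sum_congr rfl fun i _ => ?_
    rw [hB (mvfderiv I Y q (b i))]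
    ring
  conv_lhs => rw [← b.sum_repr w]
  conv_rhs => rw [← b.sum_repr w]
  simp only [map_sum, map_smul, smul_eq_mul, h1, ← Finset.sum_neg_distrib, mul_neg]

/-- A spacelike immersion `f` together with a pair `X`, `Y` of maps to the null cone, dual to each
other and with differentials in the range of the differential of `f`, yields an admissible
generalized conformally flat manifold. -/
theorem IsSpacelikeImmersion.isAdmissibleGCF [T2Space M] {f : M → W}
    (hf : IsSpacelikeImmersion I B f)
    (hB : ∀ v w, B v w = B w v)
    (hdim : finrank ℝ W = finrank ℝ E + 2) (hE : 3 ≤ finrank ℝ E)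
    (hX : ContMDiff I 𝓘(ℝ, W) ∞ X) (hY : ContMDiff I 𝓘(ℝ, W) ∞ Y)
    (hXf : ∀ (p : M) (v : TangentSpace I p), ∃ v', mvfderiv I f p v' = mvfderiv I X p v)
    (hYf : ∀ (p : M) (v : TangentSpace I p), ∃ v', mvfderiv I f p v' = mvfderiv I Y p v)
    (hnull : ∀ p, B (X p) (X p) = 0) (hyy : ∀ p, B (Y p) (Y p) = 0)
    (hXy : ∀ p, B (X p) (Y p) = -1)
    (horth : ∀ p (v : TangentSpace I p), B (mvfderiv I X p v) (Y p) = 0)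
    (hopen : IsOpen {p | Function.Injective (mvfderiv I X p)})
    (hdense : Dense {p | Function.Injective (mvfderiv I X p) ∧
      Function.Injective (mvfderiv I Y p)}) :
    (hf.coherentTangentBundle hB hX hXf).IsAdmissibleGCF := by
  let C := hf.coherentTangentBundle hB hX hXf
  have hφ : ∀ p v, mvfderiv I f p (C.φ p v) = mvfderiv I X p v := fun p v =>
    mvfderiv_tangentialDifferential hf (hXf p v)
  have hfinj : ∀ p, Function.Injective (mvfderiv I f p) := by
    intro p
    rw [injective_iff_map_eq_zero]
    intro v hv
    by_contra h
    have h1 := hf.2 p v h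
    rw [hv, map_zero] at h1
    exact h1.ne' rfl
  have hreg : C.regularSet = {p | Function.Injective (mvfderiv I X p)} := by
    ext p
    have h1 : (mvfderiv I X p : TangentSpace I p → W) = mvfderiv I f p ∘ C.φ p :=
      funext fun v => (hφ p v).symm
    simp only [CoherentTangentBundle.regularSet, Set.mem_ofPred_eq, h1]
    exact ((hfinj p).of_comp_iff _).symm
  have hg : ∀ p v w, C.inducedMetric p v w = B (mvfderiv I X p v) (mvfderiv I X p w) := by
    intro p v w
    rw [← hφ, ← hφ]
    rfl
  have hpos : ∀ p ∈ C.regularSet, ∀ v : TangentSpace I p, v ≠ 0 →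
      0 < B (mvfderiv I X p v) (mvfderiv I X p v) := by
    intro p hp v hv
    rw [← hφ]
    exact hf.2 p _ fun h => hv (hp (h.trans (map_zero (C.φ p)).symm))
  have hsurj : ∀ p ∈ C.regularSet, ∀ v, ∃ w, mvfderiv I X p w = mvfderiv I f p v := by
    intro p hp v
    have : FiniteDimensional ℝ (TangentSpace I p) := inferInstanceAs (FiniteDimensional ℝ E)
    obtain ⟨w, hw⟩ := (LinearMap.injective_iff_surjective (f := (C.φ p).toLinearMap)).1 hp v
    exact ⟨w, by rw [← hφ]; exact congrArg (mvfderiv I f p) hw⟩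
  have hYX : ∀ p ∈ C.regularSet, ∀ v, ∃ w, mvfderiv I X p w = mvfderiv I Y p v := by
    intro p hp v
    obtain ⟨v', hv'⟩ := hYf p v
    rw [← hv']
    exact hsurj p hp v'
  have hRdense : Dense C.regularSet := by
    rw [hreg]
    exact hdense.mono fun p hp => hp.1
  refine ⟨⟨hE, hRdense, ?_⟩, ?_, fun p => -tangentialDifferential I B f Y p, ?_, ?_⟩
  · exact isConformallyFlatOn_of_null hB hdim (hreg ▸ hopen) hX hg hpos hnull hyy hXy
  · refine hdense.mono fun p hp => ?_
    have hpR : p ∈ C.regularSet := by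
      rw [hreg]
      exact hp.1
    refine ⟨hpR, fun v hv => ?_⟩
    obtain ⟨w, hw⟩ := hYX p hpR v
    have h1 := hv w
    rw [schoutenTensor_of_null hB hdim hE hX hY hg (hpos p hpR) hnull hyy hXy horth,
      bilin_mvfderiv_comm hX hY horth, ← hw, neg_eq_zero] at h1
    have h2 : w = 0 := by
      by_contra h
      exact (hpos p hpR w h).ne' h1
    rw [h2, map_zero] at hw
    exact hp.2 (hw.symm.trans (map_zero _).symm)
  · intro p
    have : IsManifold I (∞ + 1) M := inferInstanceAs (IsManifold I ∞ M)
    refine contMDiffAt_hom_of_apply fun τ hτ => ?_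
    have h1 := hf.contMDiffAt_tangentProj (ContMDiffAt.mvfderiv_apply hY hτ).neg
    refine h1.congr_of_eventuallyEq (Eventually.of_forall fun r => ?_)
    simp [tangentialDifferential]
  · intro p hp v
    refine hfinj p ?_
    have h1 : mvfderiv I f p (tangentialDifferential I B f Y p v) = mvfderiv I Y p v :=
      mvfderiv_tangentialDifferential hf (hYf p v)
    have h2 : mvfderiv I f p (-tangentialDifferential I B f Y p v) = -mvfderiv I Y p v := by
      rw [map_neg, h1]
    refine h2.trans ?_
    rw [hφ]
    obtain ⟨w, hw⟩ := hYX p hp v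
    have h3 := bilin_schoutenEndo_of_null hB hdim hE hX hY hg (hpos p hp) hnull hyy hXy horth v
      (schoutenEndo I C.inducedMetric p v + w)
    have h4 : schoutenEndo I C.inducedMetric p v + w = 0 := by
      by_contra h
      have h5 : ∀ z, B (mvfderiv I X p (schoutenEndo I C.inducedMetric p v + w)) z
          = B (mvfderiv I X p (schoutenEndo I C.inducedMetric p v)) z
            + B (mvfderiv I X p w) z := by
        intro z
        rw [map_add, map_add, add_apply]
      refine (hpos p hp _ h).ne' ?_
      rw [h5, h3, hw]
      exact neg_add_cancel _
    rw [← hw, ← map_neg]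
    exact congrArg _ (neg_eq_of_add_eq_zero_left h4)

end NullPair

section InnerForm

variable (W : Type*) [NormedAddCommGroup W] [InnerProductSpace ℝ W] [FiniteDimensional ℝ W]

/-- The inner product as a continuous bilinear form. -/
noncomputable def innerForm : W →L[ℝ] W →L[ℝ] ℝ := (innerₗ W).toContinuousBilinearMap

@[simp]
theorem innerForm_apply (v w : W) : innerForm W v w = inner ℝ v w := rfl

end InnerForm

section Boost

variable {N : ℕ}

theorem contMDiff_coe_sph :
    ContMDiff (𝓡 N) 𝓘(ℝ, EuclideanSpace ℝ (Fin (N + 1))) ∞ fun z : Sph N => z.1 := by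
  have : Fact (finrank ℝ (EuclideanSpace ℝ (Fin (N + 1))) = N + 1) :=
    EuclideanSpace.instFactEqNatFinrankFin (N + 1)
  exact contMDiff_coe_sphere

theorem contMDiff_codRestrict_sph {f : Sph N → EuclideanSpace ℝ (Fin (N + 1))}
    (hf : ContMDiff (𝓡 N) 𝓘(ℝ, EuclideanSpace ℝ (Fin (N + 1))) ∞ f)
    (hf' : ∀ z, f z ∈ Metric.sphere 0 1) :
    ContMDiff (𝓡 N) (𝓡 N) ∞ fun z => (⟨f z, hf' z⟩ : Sph N) := by
  have : Fact (finrank ℝ (EuclideanSpace ℝ (Fin (N + 1))) = N + 1) :=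
    EuclideanSpace.instFactEqNatFinrankFin (N + 1)
  exact hf.codRestrict_sphere hf'

theorem injective_mvfderiv_coe_sph (z : Sph N) :
    Function.Injective (mvfderiv (𝓡 N) (fun z : Sph N => z.1) z) := by
  have : Fact (finrank ℝ (EuclideanSpace ℝ (Fin (N + 1))) = N + 1) :=
    EuclideanSpace.instFactEqNatFinrankFin (N + 1)
  exact injective_mvfderiv_subtypeVal_sphere z

/-- The first vector of the standard basis. -/
noncomputable def axis (N : ℕ) : EuclideanSpace ℝ (Fin (N + 1)) := EuclideanSpace.single 0 1

@[simp]
theorem axis_apply_zero : axis N 0 = 1 := by simp [axis]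

@[simp]
theorem inner_axis_right (z : EuclideanSpace ℝ (Fin (N + 1))) : inner ℝ z (axis N) = z 0 := by
  rw [axis, EuclideanSpace.inner_single_right]
  simp

@[simp]
theorem inner_axis_left (z : EuclideanSpace ℝ (Fin (N + 1))) : inner ℝ (axis N) z = z 0 := by
  rw [real_inner_comm, inner_axis_right]

theorem axis_apply_succ (i : Fin N) : axis N i.succ = 0 := by simp [axis]

theorem lorentz_eq_inner (z w : EuclideanSpace ℝ (Fin (N + 1))) :
    lorentz z w = inner ℝ z w - 2 * (z 0 * w 0) := by
  rw [lorentz, PiLp.inner_apply, Fin.sum_univ_succ]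
  have h : ∀ a b : ℝ, inner ℝ a b = a * b := fun a b => by
    rw [real_inner_eq_re_inner, RCLike.inner_apply]
    simp [mul_comm]
  simp only [h]
  ring

/-- The Lorentz product as a continuous bilinear form. -/
noncomputable def lorentzForm (N : ℕ) :
    EuclideanSpace ℝ (Fin (N + 1)) →L[ℝ] EuclideanSpace ℝ (Fin (N + 1)) →L[ℝ] ℝ :=
  innerForm (EuclideanSpace ℝ (Fin (N + 1)))
    - (2 : ℝ) • (EuclideanSpace.proj (𝕜 := ℝ) (0 : Fin (N + 1))).smulRight
      (EuclideanSpace.proj (𝕜 := ℝ) (0 : Fin (N + 1)))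

@[simp]
theorem lorentzForm_apply (z w : EuclideanSpace ℝ (Fin (N + 1))) :
    lorentzForm N z w = lorentz z w := by
  rw [lorentz_eq_inner]
  rfl

theorem lorentzForm_comm (z w : EuclideanSpace ℝ (Fin (N + 1))) :
    lorentzForm N z w = lorentzForm N w z := by
  rw [lorentzForm_apply, lorentzForm_apply, lorentz_eq_inner, lorentz_eq_inner,
    real_inner_comm, mul_comm (z 0)]

theorem abs_apply_zero_le_one (z : Sph N) : |z.1 0| ≤ 1 := by
  have hn : ‖z.1‖ = 1 := by simp
  rw [← inner_axis_right]
  refine (abs_real_inner_le_norm _ _).trans ?_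
  simp [hn, axis]

theorem inner_self_sph (z : Sph N) : inner ℝ z.1 z.1 = 1 := by
  have hn : ‖z.1‖ = 1 := by simp
  rw [real_inner_self_eq_norm_sq, hn, one_pow]

theorem abs_lt_sqrt_one_add_sq (b : ℝ) : |b| < √(1 + b ^ 2) :=
  Real.lt_sqrt_of_sq_lt (by rw [sq_abs]; linarith)

theorem boost_denom_pos (b : ℝ) (z : Sph N) : 0 < √(1 + b ^ 2) + b * z.1 0 := by
  have h1 := abs_apply_zero_le_one z
  have h2 := abs_lt_sqrt_one_add_sq b
  have h3 : |b * z.1 0| ≤ |b| := by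
    rw [abs_mul]
    exact mul_le_of_le_one_right (abs_nonneg b) h1
  have h4 := neg_abs_le (b * z.1 0)
  linarith

/-- The map `z ↦ (c z⁰ + b, z') / (c + b z⁰)` with `c² = 1 + b²`, which a Lorentz boost induces on
the sphere. -/
noncomputable def boostFun (b : ℝ) (z : EuclideanSpace ℝ (Fin (N + 1))) :
    EuclideanSpace ℝ (Fin (N + 1)) :=
  (√(1 + b ^ 2) + b * z 0)⁻¹ • (z + ((√(1 + b ^ 2) - 1) * z 0 + b) • axis N)

theorem boostFun_apply_zero (b : ℝ) (z : EuclideanSpace ℝ (Fin (N + 1))) :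
    boostFun b z 0 = (√(1 + b ^ 2) + b * z 0)⁻¹ * (√(1 + b ^ 2) * z 0 + b) := by
  simp only [boostFun, PiLp.smul_apply, PiLp.add_apply, axis_apply_zero, smul_eq_mul]
  ring

theorem boostFun_mem (b : ℝ) (z : Sph N) : boostFun b z.1 ∈ Metric.sphere 0 1 := by
  have h0 := boost_denom_pos b z
  have hc : √(1 + b ^ 2) ^ 2 = 1 + b ^ 2 := Real.sq_sqrt (by positivity)
  have h1 : ‖boostFun b z.1‖ ^ 2 = 1 := by
    rw [← real_inner_self_eq_norm_sq, boostFun]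
    simp only [inner_smul_left, inner_smul_right, inner_add_left, inner_add_right, inner_self_sph,
      inner_axis_left, inner_axis_right, axis_apply_zero, RCLike.conj_to_real]
    field_simp
    linear_combination (z.1 0 ^ 2 - 1) * hc
  rw [mem_sphere_zero_iff_norm]
  nlinarith [norm_nonneg (boostFun b z.1)]

theorem boostFun_neg_boostFun (b : ℝ) (z : Sph N) : boostFun (-b) (boostFun b z.1) = z.1 := by
  have h0 := boost_denom_pos b z
  have hc : √(1 + b ^ 2) ^ 2 = 1 + b ^ 2 := Real.sq_sqrt (by positivity)
  have h1 : √(1 + b ^ 2) + -b * boostFun b z.1 0 = (√(1 + b ^ 2) + b * z.1 0)⁻¹ := by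
    rw [boostFun_apply_zero]
    field_simp
    linear_combination hc
  rw [boostFun, neg_sq, h1, inv_inv, smul_add, smul_smul]
  conv_lhs => enter [1]; rw [boostFun]
  rw [smul_smul, mul_inv_cancel₀ h0.ne', one_smul, add_assoc, ← add_smul, boostFun_apply_zero]
  convert add_zero z.1
  rw [smul_eq_zero]
  left
  field_simp
  linear_combination z.1 0 * hc

theorem contMDiff_boostFun (b : ℝ) :
    ContMDiff (𝓡 N) 𝓘(ℝ, EuclideanSpace ℝ (Fin (N + 1))) ∞ fun z : Sph N => boostFun b z.1 := by
  intro z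
  have h0 := boost_denom_pos b z
  have h1 : ContDiffAt ℝ ∞ (boostFun b) z.1 := by
    have hp : ContDiff ℝ ∞ fun z : EuclideanSpace ℝ (Fin (N + 1)) => z 0 :=
      (EuclideanSpace.proj (𝕜 := ℝ) (0 : Fin (N + 1))).contDiff
    exact ((contDiff_const.add (contDiff_const.mul hp)).contDiffAt.inv h0.ne').smul
      (contDiff_id.add (((contDiff_const.mul hp).add contDiff_const).smul
        contDiff_const)).contDiffAt
  exact h1.contMDiffAt.comp z (contMDiff_coe_sph z)

/-- The conformal transformation of the sphere which a Lorentz boost induces. -/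
noncomputable def boost (N : ℕ) (b : ℝ) : Diffeomorph (𝓡 N) (𝓡 N) (Sph N) (Sph N) ∞ where
  toFun z := ⟨boostFun b z.1, boostFun_mem b z⟩
  invFun z := ⟨boostFun (-b) z.1, boostFun_mem (-b) z⟩
  left_inv z := Subtype.ext (boostFun_neg_boostFun b z)
  right_inv z := Subtype.ext (by simpa using boostFun_neg_boostFun (-b) z)
  contMDiff_toFun := contMDiff_codRestrict_sph (contMDiff_boostFun b) (boostFun_mem b)
  contMDiff_invFun := contMDiff_codRestrict_sph (contMDiff_boostFun (-b)) (boostFun_mem (-b))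

theorem boost_apply (b : ℝ) (z : Sph N) : (boost N b z).1 = boostFun b z.1 := rfl

end Boost

section Calculus

variable {E H M : Type*} [NormedAddCommGroup E] [NormedSpace ℝ E]
  [TopologicalSpace H] {I : ModelWithCorners ℝ E H} [TopologicalSpace M] [ChartedSpace H M]
  {W : Type*} [NormedAddCommGroup W] {p : M}

theorem mvfderiv_clm_comp [NormedSpace ℝ W] {W' : Type*} [NormedAddCommGroup W'] [NormedSpace ℝ W']
    (A : W →L[ℝ] W') {X : M → W} (hX : MDifferentiableAt I 𝓘(ℝ, W) X p) (v : TangentSpace I p) :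
    mvfderiv I (fun q => A (X q)) p v = A (mvfderiv I X p v) := by
  have h := mfderiv_comp_apply p (A.differentiableAt.mdifferentiableAt (x := X p)) hX v
  rw [mfderiv_eq_fderiv, A.fderiv] at h
  exact h

theorem inner_mvfderiv_self [InnerProductSpace ℝ W] [FiniteDimensional ℝ W] {X : M → W}
    (hX : MDifferentiableAt I 𝓘(ℝ, W) X p) {r : ℝ}
    (h : ∀ q, inner ℝ (X q) (X q) = r) (v : TangentSpace I p) :
    inner ℝ (mvfderiv I X p v) (X p) = 0 := by
  have h1 := mvfderiv_bilin (B := innerForm W) hX hX v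
  simp only [innerForm_apply, h] at h1
  rw [mvfderiv_const, real_inner_comm (mvfderiv I X p v)] at h1
  simp only [zero_apply] at h1
  linarith

end Calculus

section BoostConformal

variable {N : ℕ}

theorem isConformalTransformation_boost (N : ℕ) (b : ℝ) :
    IsConformalTransformation (boost N b) := by
  intro z
  have h0 := boost_denom_pos b z
  have hc : √(1 + b ^ 2) ^ 2 = 1 + b ^ 2 := Real.sq_sqrt (by positivity)
  set c := √(1 + b ^ 2) with hcdef
  refine ⟨(c + b * z.1 0)⁻¹ ^ 2, by positivity, ?_⟩
  let ι : Sph N → EuclideanSpace ℝ (Fin (N + 1)) := fun z => z.1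
  let π₀ : EuclideanSpace ℝ (Fin (N + 1)) →L[ℝ] ℝ := EuclideanSpace.proj 0
  let A : EuclideanSpace ℝ (Fin (N + 1)) →L[ℝ] EuclideanSpace ℝ (Fin (N + 1)) :=
    ContinuousLinearMap.id ℝ _ + ((c - 1) • π₀).smulRight (axis N)
  let X : Sph N → EuclideanSpace ℝ (Fin (N + 1)) := fun z => (boost N b z).1
  have hπ : ∀ w, π₀ w = w 0 := fun w => rfl
  have hA : ∀ w, A w = w + ((c - 1) * w 0) • axis N := fun w => by simp [A, hπ]
  have hι : ContMDiff (𝓡 N) 𝓘(ℝ, EuclideanSpace ℝ (Fin (N + 1))) ∞ ι :=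
    contMDiff_coe_sph
  have hιd : MDifferentiableAt (𝓡 N) 𝓘(ℝ, EuclideanSpace ℝ (Fin (N + 1))) ι z :=
    (hι z).mdifferentiableAt (by simp)
  have hXd : MDifferentiableAt (𝓡 N) 𝓘(ℝ, EuclideanSpace ℝ (Fin (N + 1))) X z :=
    (contMDiff_boostFun b z).mdifferentiableAt (by simp)
  have hlin : MDifferentiableAt (𝓡 N) 𝓘(ℝ, ℝ) (fun q => b • π₀ (ι q)) z :=
    (b • π₀).differentiableAt.mdifferentiableAt.comp z hιd
  have hlind : ∀ v, mvfderiv (𝓡 N) (fun q => b • π₀ (ι q)) z v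
      = b • π₀ (mvfderiv (𝓡 N) ι z v) := mvfderiv_clm_comp (b • π₀) hιd
  have hAd : MDifferentiableAt (𝓡 N) 𝓘(ℝ, EuclideanSpace ℝ (Fin (N + 1)))
      (fun q => A (ι q)) z := A.differentiableAt.mdifferentiableAt.comp z hιd
  have hlam : ∀ v, mvfderiv (𝓡 N) (fun q => c + b • π₀ (ι q)) z v
      = b * (mvfderiv (𝓡 N) ι z v) 0 := by
    intro v
    rw [mvfderiv_fun_add mdifferentiableAt_const hlin, mvfderiv_const, zero_add,
      hlind]
    rfl
  have hlamd : MDifferentiableAt (𝓡 N) 𝓘(ℝ, ℝ) (fun q => c + b • π₀ (ι q)) z :=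
    mdifferentiableAt_const.add hlin
  have heq : (fun q => (c + b • π₀ (ι q)) • X q) = fun q => b • axis N + A (ι q) := by
    funext q
    have hq := boost_denom_pos b q
    have h1 : b • π₀ (ι q) = b * q.1 0 := rfl
    simp only [X, boost_apply, boostFun, hA, ι]
    rw [h1, smul_smul, mul_inv_cancel₀ hq.ne', one_smul]
    module
  have hd : ∀ v, (c + b * z.1 0) • mvfderiv (𝓡 N) X z v
      = A (mvfderiv (𝓡 N) ι z v) - (b * (mvfderiv (𝓡 N) ι z v) 0) • X z := by
    intro v
    have h1 := mvfderiv_fun_smul hlamd hXd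
    rw [heq, mvfderiv_fun_add mdifferentiableAt_const hAd, mvfderiv_const, zero_add] at h1
    have h2 := DFunLike.congr_fun h1 v
    rw [mvfderiv_clm_comp _ hιd] at h2
    simp only [add_apply, smul_apply, ContinuousLinearMap.smulRight_apply, hlam] at h2
    rw [h2]
    simp [hπ, ι]
  have horth : ∀ v, inner ℝ (mvfderiv (𝓡 N) ι z v) z.1 = 0 := fun v =>
    inner_mvfderiv_self hιd inner_self_sph v
  have hX : X z = (c + b * z.1 0)⁻¹ • (z.1 + ((c - 1) * z.1 0 + b) • axis N) := rfl
  have hXX : inner ℝ (X z) (X z) = 1 := inner_self_sph (boost N b z)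
  have hAX : ∀ v, inner ℝ (A (mvfderiv (𝓡 N) ι z v)) (X z)
      = b * (mvfderiv (𝓡 N) ι z v) 0 := by
    intro v
    rw [hX, hA]
    simp only [inner_smul_left, inner_smul_right, inner_add_left, inner_add_right, horth,
      inner_axis_left, inner_axis_right, axis_apply_zero, RCLike.conj_to_real]
    field_simp
    linear_combination (mvfderiv (𝓡 N) ι z v 0 * z.1 0) * hc
  intro v w
  change inner ℝ (mvfderiv (𝓡 N) X z v) (mvfderiv (𝓡 N) X z w)
    = _ * inner ℝ (mvfderiv (𝓡 N) ι z v) (mvfderiv (𝓡 N) ι z w)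
  have hd' : ∀ v, mvfderiv (𝓡 N) X z v = (c + b * z.1 0)⁻¹ •
      (A (mvfderiv (𝓡 N) ι z v) - (b * (mvfderiv (𝓡 N) ι z v) 0) • X z) := fun v => by
    rw [← hd, smul_smul, inv_mul_cancel₀ h0.ne', one_smul]
  rw [hd' v, hd' w]
  have hXA : ∀ v, inner ℝ (X z) (A (mvfderiv (𝓡 N) ι z v)) = b * (mvfderiv (𝓡 N) ι z v) 0 :=
    fun v => by rw [real_inner_comm, hAX]
  have hAA : inner ℝ (A (mvfderiv (𝓡 N) ι z v)) (A (mvfderiv (𝓡 N) ι z w))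
      = inner ℝ (mvfderiv (𝓡 N) ι z v) (mvfderiv (𝓡 N) ι z w)
        + b ^ 2 * ((mvfderiv (𝓡 N) ι z v) 0 * (mvfderiv (𝓡 N) ι z w) 0) := by
    rw [hA, hA]
    simp only [inner_smul_left, inner_smul_right, inner_add_left, inner_add_right,
      inner_axis_left, inner_axis_right, axis_apply_zero, RCLike.conj_to_real]
    linear_combination (mvfderiv (𝓡 N) ι z v 0 * mvfderiv (𝓡 N) ι z w 0) * hc
  simp only [inner_smul_left, inner_smul_right, inner_sub_left, inner_sub_right, hAA, hAX, hXA,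
    hXX, RCLike.conj_to_real]
  ring

end BoostConformal

section HyperbolicLift

variable {N : ℕ}

/-- The linear map which multiplies the coordinate `z⁰` by `b`. -/
noncomputable def axisScale (N : ℕ) (b : ℝ) :
    EuclideanSpace ℝ (Fin (N + 1)) →L[ℝ] EuclideanSpace ℝ (Fin (N + 1)) :=
  ContinuousLinearMap.id ℝ _
    + ((b - 1) • (EuclideanSpace.proj (𝕜 := ℝ) (0 : Fin (N + 1)))).smulRight (axis N)

theorem axisScale_apply (b : ℝ) (w : EuclideanSpace ℝ (Fin (N + 1))) :
    axisScale N b w = w + ((b - 1) * w 0) • axis N := rfl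

theorem axisScale_apply_zero (b : ℝ) (w : EuclideanSpace ℝ (Fin (N + 1))) :
    axisScale N b w 0 = b * w 0 := by
  simp only [axisScale_apply, PiLp.add_apply, PiLp.smul_apply, axis_apply_zero, smul_eq_mul]
  ring

theorem lorentzForm_axisScale_axisScale (b : ℝ) (w w' : EuclideanSpace ℝ (Fin (N + 1))) :
    lorentzForm N (axisScale N b w) (axisScale N b w')
      = inner ℝ w w' - (1 + b ^ 2) * (w 0 * w' 0) := by
  rw [lorentzForm_apply, lorentz_eq_inner, axisScale_apply_zero, axisScale_apply_zero,
    axisScale_apply, axisScale_apply]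
  simp only [inner_smul_left, inner_smul_right, inner_add_left, inner_add_right,
    inner_axis_left, inner_axis_right, axis_apply_zero, RCLike.conj_to_real]
  ring

theorem lorentzForm_axisScale_axis (b : ℝ) (w : EuclideanSpace ℝ (Fin (N + 1))) :
    lorentzForm N (axisScale N b w) (axis N) = -(b * w 0) := by
  rw [lorentzForm_apply, lorentz_eq_inner, axisScale_apply_zero, inner_axis_right,
    axisScale_apply_zero, axis_apply_zero]
  ring

theorem lorentzForm_axis_axisScale (b : ℝ) (w : EuclideanSpace ℝ (Fin (N + 1))) :
    lorentzForm N (axis N) (axisScale N b w) = -(b * w 0) := by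
  rw [lorentzForm_comm, lorentzForm_axisScale_axis]

theorem lorentzForm_axis_axis : lorentzForm N (axis N) (axis N) = -1 := by
  rw [lorentzForm_apply, lorentz_eq_inner, inner_axis_right, axis_apply_zero]
  norm_num

/-- The point of the hyperbolic space which corresponds to the boosted point `z` of the sphere. -/
noncomputable def hyperbolicLift (b : ℝ) (z : EuclideanSpace ℝ (Fin (N + 1))) :
    EuclideanSpace ℝ (Fin (N + 1)) :=
  (√(1 + b ^ 2) * z 0 + b)⁻¹ • (axisScale N b z + √(1 + b ^ 2) • axis N)

/-- The normal vector in the Lorentz-Minkowski space which corresponds to the normal vector `n` at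
the point `z` of the sphere. -/
noncomputable def normalLift (b : ℝ) (z n : EuclideanSpace ℝ (Fin (N + 1))) :
    EuclideanSpace ℝ (Fin (N + 1)) :=
  axisScale N b n - (√(1 + b ^ 2) * n 0) • hyperbolicLift b z

theorem hemisphereToHyperbolic_boostFun (b : ℝ) (z : Sph N) :
    hemisphereToHyperbolic (boostFun b z.1) = hyperbolicLift b z.1 := by
  have h0 := (boost_denom_pos b z).ne'
  have hz : boostFun b z.1 0 = (√(1 + b ^ 2) + b * z.1 0)⁻¹ * (√(1 + b ^ 2) * z.1 0 + b) :=
    boostFun_apply_zero b z.1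
  ext i
  refine Fin.cases ?_ (fun i => ?_) i
  · simp only [hemisphereToHyperbolic, hyperbolicLift, Fin.cons_zero, hz, PiLp.smul_apply,
      PiLp.add_apply, axisScale_apply_zero, axis_apply_zero, smul_eq_mul, mul_one]
    rw [one_div, mul_inv, inv_inv]
    ring
  · have hs : boostFun b z.1 i.succ = (√(1 + b ^ 2) + b * z.1 0)⁻¹ * z.1 i.succ := by
      simp only [boostFun, PiLp.smul_apply, PiLp.add_apply, axis_apply_succ, smul_eq_mul, mul_zero,
        add_zero]
    simp only [hemisphereToHyperbolic, hyperbolicLift, Fin.cons_succ, hz, hs,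
      axisScale_apply, PiLp.smul_apply, PiLp.add_apply, axis_apply_succ, smul_eq_mul, mul_zero,
      add_zero]
    rw [div_eq_mul_inv, mul_inv, inv_inv]
    field_simp

section Vector

variable {b : ℝ} {z n : EuclideanSpace ℝ (Fin (N + 1))}

theorem lorentzForm_hyperbolicLift_self (hz : inner ℝ z z = 1) (hμ : 0 < √(1 + b ^ 2) * z 0 + b) :
    lorentzForm N (hyperbolicLift b z) (hyperbolicLift b z) = -1 := by
  have hc : √(1 + b ^ 2) ^ 2 = 1 + b ^ 2 := Real.sq_sqrt (by positivity)
  simp only [hyperbolicLift, map_add, map_smul, add_apply, smul_apply, smul_eq_mul,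
    lorentzForm_axisScale_axisScale, lorentzForm_axisScale_axis, lorentzForm_axis_axisScale,
    lorentzForm_axis_axis, hz]
  field_simp
  linear_combination (z 0 ^ 2 - 1) * hc

theorem lorentzForm_axisScale_hyperbolicLift (w : EuclideanSpace ℝ (Fin (N + 1)))
    (hw : inner ℝ w z = 0) (hμ : 0 < √(1 + b ^ 2) * z 0 + b) :
    lorentzForm N (axisScale N b w) (hyperbolicLift b z) = -(√(1 + b ^ 2) * w 0) := by
  have hc : √(1 + b ^ 2) ^ 2 = 1 + b ^ 2 := Real.sq_sqrt (by positivity)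
  simp only [hyperbolicLift, map_add, map_smul, smul_eq_mul,
    lorentzForm_axisScale_axisScale, lorentzForm_axisScale_axis, hw]
  field_simp
  linear_combination (z 0 * w 0) * hc

theorem lorentzForm_normalLift_hyperbolicLift (hz : inner ℝ z z = 1) (hn : inner ℝ n z = 0)
    (hμ : 0 < √(1 + b ^ 2) * z 0 + b) :
    lorentzForm N (normalLift b z n) (hyperbolicLift b z) = 0 := by
  rw [normalLift, map_sub, map_smul, sub_apply, smul_apply,
    lorentzForm_axisScale_hyperbolicLift n hn hμ, lorentzForm_hyperbolicLift_self hz hμ]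
  simp

theorem lorentzForm_normalLift_self (hz : inner ℝ z z = 1) (hnn : inner ℝ n n = 1)
    (hn : inner ℝ n z = 0) (hμ : 0 < √(1 + b ^ 2) * z 0 + b) :
    lorentzForm N (normalLift b z n) (normalLift b z n) = 1 := by
  have hc : √(1 + b ^ 2) ^ 2 = 1 + b ^ 2 := Real.sq_sqrt (by positivity)
  have h1 := lorentzForm_normalLift_hyperbolicLift hz hn hμ
  conv_lhs => enter [2]; rw [normalLift]
  rw [map_sub, map_smul, h1, normalLift, map_sub, map_smul, sub_apply, smul_apply,
    lorentzForm_axisScale_axisScale, lorentzForm_comm (hyperbolicLift b z),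
    lorentzForm_axisScale_hyperbolicLift n hn hμ, hnn]
  simp only [smul_eq_mul]
  linear_combination n 0 ^ 2 * hc

end Vector

section Manifold

variable {E H M : Type*} [NormedAddCommGroup E] [NormedSpace ℝ E]
  [TopologicalSpace H] {I : ModelWithCorners ℝ E H} [TopologicalSpace M] [ChartedSpace H M]
  {b : ℝ} {z n : M → EuclideanSpace ℝ (Fin (N + 1))}

theorem contMDiff_hyperbolicLift
    (hz : ContMDiff I 𝓘(ℝ, EuclideanSpace ℝ (Fin (N + 1))) ∞ z)
    (hμ : ∀ p, 0 < √(1 + b ^ 2) * z p 0 + b) :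
    ContMDiff I 𝓘(ℝ, EuclideanSpace ℝ (Fin (N + 1))) ∞ fun p => hyperbolicLift b (z p) := by
  intro p
  have hp : ContDiff ℝ ∞ fun z : EuclideanSpace ℝ (Fin (N + 1)) => z 0 :=
    (EuclideanSpace.proj (𝕜 := ℝ) (0 : Fin (N + 1))).contDiff
  have h1 : ContDiffAt ℝ ∞ (hyperbolicLift (N := N) b) (z p) :=
    ((contDiff_const.mul hp).add contDiff_const).contDiffAt.inv (hμ p).ne' |>.smul
      ((axisScale N b).contDiff.add contDiff_const).contDiffAt
  exact h1.contMDiffAt.comp p (hz p)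

theorem contMDiff_normalLift
    (hz : ContMDiff I 𝓘(ℝ, EuclideanSpace ℝ (Fin (N + 1))) ∞ z)
    (hn : ContMDiff I 𝓘(ℝ, EuclideanSpace ℝ (Fin (N + 1))) ∞ n)
    (hμ : ∀ p, 0 < √(1 + b ^ 2) * z p 0 + b) :
    ContMDiff I 𝓘(ℝ, EuclideanSpace ℝ (Fin (N + 1))) ∞ fun p => normalLift b (z p) (n p) := by
  have hp : ContDiff ℝ ∞ fun z : EuclideanSpace ℝ (Fin (N + 1)) => √(1 + b ^ 2) * z 0 :=
    contDiff_const.mul (EuclideanSpace.proj (𝕜 := ℝ) (0 : Fin (N + 1))).contDiff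
  exact ((axisScale N b).contDiff.contMDiff.comp hn).sub
    ((hp.contMDiff.comp hn).smul (contMDiff_hyperbolicLift hz hμ))

theorem mvfderiv_coord {z : M → EuclideanSpace ℝ (Fin (N + 1))} {p : M}
    (hz : MDifferentiableAt I 𝓘(ℝ, EuclideanSpace ℝ (Fin (N + 1))) z p) (a : ℝ)
    (v : TangentSpace I p) :
    MDifferentiableAt I 𝓘(ℝ, ℝ) (fun q => a * z q 0) p ∧
      mvfderiv I (fun q => a * z q 0) p v = a * mvfderiv I z p v 0 :=
  ⟨(a • EuclideanSpace.proj (𝕜 := ℝ) (0 : Fin (N + 1))).differentiableAt.mdifferentiableAt.comp p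
    hz, mvfderiv_clm_comp (a • EuclideanSpace.proj (𝕜 := ℝ) (0 : Fin (N + 1))) hz v⟩

theorem mvfderiv_hyperbolicLift
    (hz : ContMDiff I 𝓘(ℝ, EuclideanSpace ℝ (Fin (N + 1))) ∞ z)
    (hμ : ∀ p, 0 < √(1 + b ^ 2) * z p 0 + b) (p : M) (v : TangentSpace I p) :
    (√(1 + b ^ 2) * z p 0 + b) • mvfderiv I (fun q => hyperbolicLift b (z q)) p v
      = axisScale N b (mvfderiv I z p v)
        - (√(1 + b ^ 2) * mvfderiv I z p v 0) • hyperbolicLift b (z p) := by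
  have hzd : MDifferentiableAt I 𝓘(ℝ, EuclideanSpace ℝ (Fin (N + 1))) z p :=
    hz.contMDiffAt.mdifferentiableAt (by simp)
  have hfd : MDifferentiableAt I 𝓘(ℝ, EuclideanSpace ℝ (Fin (N + 1)))
      (fun q => hyperbolicLift b (z q)) p :=
    (contMDiff_hyperbolicLift hz hμ).contMDiffAt.mdifferentiableAt (by simp)
  obtain ⟨hcd, hcv⟩ := mvfderiv_coord hzd (√(1 + b ^ 2)) v
  have hAd : MDifferentiableAt I 𝓘(ℝ, EuclideanSpace ℝ (Fin (N + 1)))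
      (fun q => axisScale N b (z q)) p :=
    (axisScale N b).differentiableAt.mdifferentiableAt.comp p hzd
  have hμd : MDifferentiableAt I 𝓘(ℝ, ℝ) (fun q => √(1 + b ^ 2) * z q 0 + b) p :=
    hcd.add mdifferentiableAt_const
  have heq : (fun q => (√(1 + b ^ 2) * z q 0 + b) • hyperbolicLift b (z q))
      = fun q => axisScale N b (z q) + √(1 + b ^ 2) • axis N := by
    funext q
    rw [hyperbolicLift, smul_smul, mul_inv_cancel₀ (hμ q).ne', one_smul]
  have h1 := mvfderiv_fun_smul hμd hfd
  rw [heq, mvfderiv_fun_add hAd mdifferentiableAt_const, mvfderiv_const, add_zero,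
    mvfderiv_fun_add hcd mdifferentiableAt_const, mvfderiv_const, add_zero] at h1
  have h2 := DFunLike.congr_fun h1 v
  rw [mvfderiv_clm_comp _ hzd] at h2
  simp only [add_apply, smul_apply, ContinuousLinearMap.smulRight_apply, hcv] at h2
  rw [h2]
  abel

theorem lorentzForm_mvfderiv_hyperbolicLift_self
    (hz : ContMDiff I 𝓘(ℝ, EuclideanSpace ℝ (Fin (N + 1))) ∞ z)
    (hzz : ∀ p, inner ℝ (z p) (z p) = 1)
    (hμ : ∀ p, 0 < √(1 + b ^ 2) * z p 0 + b) (p : M) (v : TangentSpace I p) :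
    lorentzForm N (mvfderiv I (fun q => hyperbolicLift b (z q)) p v) (hyperbolicLift b (z p))
      = 0 := by
  have hfd : MDifferentiableAt I 𝓘(ℝ, EuclideanSpace ℝ (Fin (N + 1)))
      (fun q => hyperbolicLift b (z q)) p :=
    (contMDiff_hyperbolicLift hz hμ).contMDiffAt.mdifferentiableAt (by simp)
  have h1 := mvfderiv_bilin (B := lorentzForm N) hfd hfd v
  simp only [fun q => lorentzForm_hyperbolicLift_self (hzz q) (hμ q)] at h1
  rw [mvfderiv_const, lorentzForm_comm (hyperbolicLift b (z p))] at h1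
  simp only [zero_apply] at h1
  linarith

theorem lorentzForm_mvfderiv_hyperbolicLift_normalLift
    (hz : ContMDiff I 𝓘(ℝ, EuclideanSpace ℝ (Fin (N + 1))) ∞ z)
    (hzz : ∀ p, inner ℝ (z p) (z p) = 1) (hnz : ∀ p, inner ℝ (n p) (z p) = 0)
    (hdn : ∀ p (v : TangentSpace I p), inner ℝ (mvfderiv I z p v) (n p) = 0)
    (hμ : ∀ p, 0 < √(1 + b ^ 2) * z p 0 + b) (p : M) (v : TangentSpace I p) :
    lorentzForm N (mvfderiv I (fun q => hyperbolicLift b (z q)) p v) (normalLift b (z p) (n p))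
      = 0 := by
  have hc : √(1 + b ^ 2) ^ 2 = 1 + b ^ 2 := Real.sq_sqrt (by positivity)
  have h1 := lorentzForm_mvfderiv_hyperbolicLift_self hz hzz hμ p v
  have h2 : lorentzForm N ((√(1 + b ^ 2) * z p 0 + b) •
      mvfderiv I (fun q => hyperbolicLift b (z q)) p v) (axisScale N b (n p)) = 0 := by
    rw [mvfderiv_hyperbolicLift hz hμ, map_sub, map_smul, sub_apply, smul_apply,
      lorentzForm_axisScale_axisScale, lorentzForm_comm (hyperbolicLift b (z p)),
      lorentzForm_axisScale_hyperbolicLift _ (hnz p) (hμ p), hdn, smul_eq_mul]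
    linear_combination (mvfderiv I z p v 0 * n p 0) * hc
  rw [map_smul, smul_apply, smul_eq_mul, mul_eq_zero] at h2
  rw [normalLift, map_sub, map_smul, h1, h2.resolve_left (hμ p).ne', smul_zero, sub_zero]

theorem lorentzForm_mvfderiv_hyperbolicLift_mvfderiv
    (hz : ContMDiff I 𝓘(ℝ, EuclideanSpace ℝ (Fin (N + 1))) ∞ z)
    (hzz : ∀ p, inner ℝ (z p) (z p) = 1)
    (hμ : ∀ p, 0 < √(1 + b ^ 2) * z p 0 + b) (p : M) (v : TangentSpace I p) :
    (√(1 + b ^ 2) * z p 0 + b) ^ 2 *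
        lorentzForm N (mvfderiv I (fun q => hyperbolicLift b (z q)) p v)
          (mvfderiv I (fun q => hyperbolicLift b (z q)) p v)
      = inner ℝ (mvfderiv I z p v) (mvfderiv I z p v) := by
  have hc : √(1 + b ^ 2) ^ 2 = 1 + b ^ 2 := Real.sq_sqrt (by positivity)
  have hzd : MDifferentiableAt I 𝓘(ℝ, EuclideanSpace ℝ (Fin (N + 1))) z p :=
    hz.contMDiffAt.mdifferentiableAt (by simp)
  have h2 : lorentzForm N ((√(1 + b ^ 2) * z p 0 + b) •
        mvfderiv I (fun q => hyperbolicLift b (z q)) p v) ((√(1 + b ^ 2) * z p 0 + b) •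
        mvfderiv I (fun q => hyperbolicLift b (z q)) p v)
      = inner ℝ (mvfderiv I z p v) (mvfderiv I z p v) := by
    have h3 := lorentzForm_axisScale_hyperbolicLift (b := b) _
      (inner_mvfderiv_self hzd hzz v) (hμ p)
    rw [mvfderiv_hyperbolicLift hz hμ]
    simp only [map_sub, map_smul, sub_apply, smul_apply, smul_eq_mul,
      lorentzForm_axisScale_axisScale, h3,
      lorentzForm_comm (hyperbolicLift b (z p)) (axisScale N b _),
      lorentzForm_hyperbolicLift_self (hzz p) (hμ p)]
    linear_combination (mvfderiv I z p v 0) ^ 2 * hc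
  rw [← h2]
  simp only [map_smul, smul_apply, smul_eq_mul]
  ring

theorem mvfderiv_normalLift
    (hz : ContMDiff I 𝓘(ℝ, EuclideanSpace ℝ (Fin (N + 1))) ∞ z)
    (hn : ContMDiff I 𝓘(ℝ, EuclideanSpace ℝ (Fin (N + 1))) ∞ n)
    (hμ : ∀ p, 0 < √(1 + b ^ 2) * z p 0 + b) {p : M} {v w : TangentSpace I p}
    (hw : mvfderiv I n p v = mvfderiv I z p w) :
    mvfderiv I (fun q => normalLift b (z q) (n q)) p v
      = mvfderiv I (fun q => hyperbolicLift b (z q)) p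
        ((√(1 + b ^ 2) * z p 0 + b) • w - (√(1 + b ^ 2) * n p 0) • v) := by
  have hnd : MDifferentiableAt I 𝓘(ℝ, EuclideanSpace ℝ (Fin (N + 1))) n p :=
    hn.contMDiffAt.mdifferentiableAt (by simp)
  have hfd : MDifferentiableAt I 𝓘(ℝ, EuclideanSpace ℝ (Fin (N + 1)))
      (fun q => hyperbolicLift b (z q)) p :=
    (contMDiff_hyperbolicLift hz hμ).contMDiffAt.mdifferentiableAt (by simp)
  obtain ⟨hcd, hcv⟩ := mvfderiv_coord hnd (√(1 + b ^ 2)) v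
  have hAd : MDifferentiableAt I 𝓘(ℝ, EuclideanSpace ℝ (Fin (N + 1)))
      (fun q => axisScale N b (n q)) p :=
    (axisScale N b).differentiableAt.mdifferentiableAt.comp p hnd
  have h1 : mvfderiv I (fun q => normalLift b (z q) (n q)) p v
      = axisScale N b (mvfderiv I n p v)
        - ((√(1 + b ^ 2) * n p 0) • mvfderiv I (fun q => hyperbolicLift b (z q)) p v
          + (√(1 + b ^ 2) * mvfderiv I n p v 0) • hyperbolicLift b (z p)) := by
    have hsd : MDifferentiableAt I 𝓘(ℝ, EuclideanSpace ℝ (Fin (N + 1)))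
        (fun q => (√(1 + b ^ 2) * n q 0) • hyperbolicLift b (z q)) p := hcd.smul hfd
    simp only [normalLift]
    rw [mvfderiv_fun_sub hAd hsd, sub_apply, mvfderiv_clm_comp _ hnd,
      mvfderiv_fun_smul hcd hfd]
    simp only [add_apply, smul_apply, ContinuousLinearMap.smulRight_apply, hcv]
  rw [h1, map_sub, map_smul, map_smul, mvfderiv_hyperbolicLift hz hμ, hw]
  abel

end Manifold

end HyperbolicLift

section CliffordTorus

variable {k : ℕ}

/-- The concatenation of vectors `(u, v) ↦ (v, u)`. -/
noncomputable def appendCLM (k : ℕ) :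
    EuclideanSpace ℝ (Fin 3) × EuclideanSpace ℝ (Fin (k + 1)) →L[ℝ]
      EuclideanSpace ℝ (Fin (k + 3 + 1)) :=
  LinearMap.toContinuousLinearMap
    { toFun := fun x => WithLp.toLp 2 (Fin.append (m := k + 1) (n := 3) x.2.ofLp x.1.ofLp)
      map_add' := fun x y => by
        ext i
        refine Fin.addCases (m := k + 1) (n := 3) (fun i => ?_) (fun i => ?_) i
        · simp [Fin.append_left]
        · simp [Fin.append_right]
      map_smul' := fun a x => by
        ext i
        refine Fin.addCases (m := k + 1) (n := 3) (fun i => ?_) (fun i => ?_) i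
        · simp [Fin.append_left]
        · simp [Fin.append_right] }

theorem appendCLM_castAdd (x : EuclideanSpace ℝ (Fin 3) × EuclideanSpace ℝ (Fin (k + 1)))
    (i : Fin (k + 1)) : appendCLM k x (Fin.castAdd 3 i) = x.2 i :=
  Fin.append_left (m := k + 1) (n := 3) x.2.ofLp x.1.ofLp i

theorem appendCLM_natAdd (x : EuclideanSpace ℝ (Fin 3) × EuclideanSpace ℝ (Fin (k + 1)))
    (i : Fin 3) : appendCLM k x (Fin.natAdd (k + 1) i) = x.1 i :=
  Fin.append_right (m := k + 1) (n := 3) x.2.ofLp x.1.ofLp i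

theorem appendCLM_apply_zero (x : EuclideanSpace ℝ (Fin 3) × EuclideanSpace ℝ (Fin (k + 1))) :
    appendCLM k x 0 = x.2 0 :=
  appendCLM_castAdd x 0

theorem inner_appendCLM (x y : EuclideanSpace ℝ (Fin 3) × EuclideanSpace ℝ (Fin (k + 1))) :
    inner ℝ (appendCLM k x) (appendCLM k y) = inner ℝ x.1 y.1 + inner ℝ x.2 y.2 := by
  rw [PiLp.inner_apply, PiLp.inner_apply, PiLp.inner_apply]
  refine (Fin.sum_univ_add (a := k + 1) (b := 3)
    fun i => inner ℝ (appendCLM k x i) (appendCLM k y i)).trans ?_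
  simp only [appendCLM_castAdd, appendCLM_natAdd]
  exact add_comm _ _

theorem cliffordTorus_eq (a c : ℝ) (p : SphProd k) :
    cliffordTorus k a c p = appendCLM k (a • p.1.1, c • p.2.1) := rfl

theorem cliffordTorus_apply_zero (a c : ℝ) (p : SphProd k) :
    cliffordTorus k a c p 0 = c * p.2.1 0 := by
  rw [cliffordTorus_eq, appendCLM_apply_zero]
  rfl

theorem inner_cliffordTorus (a c a' c' : ℝ) (p : SphProd k) :
    inner ℝ (cliffordTorus k a c p) (cliffordTorus k a' c' p) = a * a' + c * c' := by
  rw [cliffordTorus_eq, cliffordTorus_eq, inner_appendCLM]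
  simp only [inner_smul_left, inner_smul_right, inner_self_sph, RCLike.conj_to_real]
  ring

theorem contMDiff_cliffordTorus (a c : ℝ) :
    ContMDiff (modelSphProd k) 𝓘(ℝ, EuclideanSpace ℝ (Fin (k + 3 + 1))) ∞
      (cliffordTorus k a c) := by
  have h1 : ContMDiff (modelSphProd k) 𝓘(ℝ, EuclideanSpace ℝ (Fin 3)) ∞
      fun p : SphProd k => p.1.1 := contMDiff_coe_sph.comp contMDiff_fst
  have h2 : ContMDiff (modelSphProd k) 𝓘(ℝ, EuclideanSpace ℝ (Fin (k + 1))) ∞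
      fun p : SphProd k => p.2.1 := contMDiff_coe_sph.comp contMDiff_snd
  exact (appendCLM k).contDiff.contMDiff.comp
    (((contDiff_const_smul a).contMDiff.comp h1).prodMk_space
      ((contDiff_const_smul c).contMDiff.comp h2))

theorem mvfderiv_cliffordTorus (a c : ℝ) (p : SphProd k)
    (ξ : EuclideanSpace ℝ (Fin 2) × EuclideanSpace ℝ (Fin k)) :
    mvfderiv (modelSphProd k) (cliffordTorus k a c) p ξ
      = appendCLM k (a • mvfderiv (𝓡 2) (fun z : Sph 2 => z.1) p.1 ξ.1,
          c • mvfderiv (𝓡 k) (fun z : Sph k => z.1) p.2 ξ.2) := by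
  have hd1 : MDifferentiableAt (𝓡 2) 𝓘(ℝ, EuclideanSpace ℝ (Fin 3)) (fun z : Sph 2 => z.1) p.1 :=
    (contMDiff_coe_sph p.1).mdifferentiableAt (by simp)
  have hd2 : MDifferentiableAt (𝓡 k) 𝓘(ℝ, EuclideanSpace ℝ (Fin (k + 1)))
      (fun z : Sph k => z.1) p.2 := (contMDiff_coe_sph p.2).mdifferentiableAt (by simp)
  have hf1 : MDifferentiableAt (modelSphProd k) 𝓘(ℝ, EuclideanSpace ℝ (Fin 3))
      (fun p : SphProd k => p.1.1) p := hd1.comp p mdifferentiableAt_fst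
  have hf2 : MDifferentiableAt (modelSphProd k) 𝓘(ℝ, EuclideanSpace ℝ (Fin (k + 1)))
      (fun p : SphProd k => p.2.1) p := hd2.comp p mdifferentiableAt_snd
  let A := (appendCLM k).comp ((a • ContinuousLinearMap.id ℝ _).prod 0)
  let B := (appendCLM k).comp (ContinuousLinearMap.prod 0 (c • ContinuousLinearMap.id ℝ _))
  have hA : MDifferentiableAt (modelSphProd k) 𝓘(ℝ, EuclideanSpace ℝ (Fin (k + 3 + 1)))
      (fun p : SphProd k => A p.1.1) p := A.differentiableAt.mdifferentiableAt.comp p hf1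
  have hB : MDifferentiableAt (modelSphProd k) 𝓘(ℝ, EuclideanSpace ℝ (Fin (k + 3 + 1)))
      (fun p : SphProd k => B p.2.1) p := B.differentiableAt.mdifferentiableAt.comp p hf2
  have h1 : mvfderiv (modelSphProd k) (fun p : SphProd k => p.1.1) p ξ
      = mvfderiv (𝓡 2) (fun z : Sph 2 => z.1) p.1 ξ.1 := by
    have h := mfderiv_comp_apply p hd1 (mdifferentiableAt_fst (I := 𝓡 2) (I' := 𝓡 k)) ξ
    rw [mfderiv_fst] at h
    exact h
  have h2 : mvfderiv (modelSphProd k) (fun p : SphProd k => p.2.1) p ξ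
      = mvfderiv (𝓡 k) (fun z : Sph k => z.1) p.2 ξ.2 := by
    have h := mfderiv_comp_apply p hd2 (mdifferentiableAt_snd (I := 𝓡 2) (I' := 𝓡 k)) ξ
    rw [mfderiv_snd] at h
    exact h
  have heq : cliffordTorus k a c = fun p => A p.1.1 + B p.2.1 := by
    funext p
    rw [cliffordTorus_eq]
    simp only [A, B, ContinuousLinearMap.comp_apply, ← map_add]
    simp
  rw [heq]
  refine (DFunLike.congr_fun (mvfderiv_fun_add hA hB) ξ).trans ?_
  refine (congrArg₂ (· + ·) (mvfderiv_clm_comp A hf1 ξ) (mvfderiv_clm_comp B hf2 ξ)).trans ?_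
  rw [h1, h2]
  simp only [A, B, ContinuousLinearMap.comp_apply, ← map_add]
  simp

theorem mvfderiv_cliffordTorus_smul (a c s t : ℝ) (p : SphProd k)
    (ξ : EuclideanSpace ℝ (Fin 2) × EuclideanSpace ℝ (Fin k)) :
    mvfderiv (modelSphProd k) (cliffordTorus k a c) p (s • ξ.1, t • ξ.2)
      = mvfderiv (modelSphProd k) (cliffordTorus k (a * s) (c * t)) p ξ := by
  have h1 : ∀ u : EuclideanSpace ℝ (Fin 2), mvfderiv (𝓡 2) (fun z : Sph 2 => z.1) p.1 (s • u)
      = s • mvfderiv (𝓡 2) (fun z : Sph 2 => z.1) p.1 u := fun u => map_smul _ s u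
  have h2 : ∀ u : EuclideanSpace ℝ (Fin k), mvfderiv (𝓡 k) (fun z : Sph k => z.1) p.2 (t • u)
      = t • mvfderiv (𝓡 k) (fun z : Sph k => z.1) p.2 u := fun u => map_smul _ t u
  rw [mvfderiv_cliffordTorus, mvfderiv_cliffordTorus, mul_smul, mul_smul]
  exact congrArg _ (Prod.ext (congrArg (a • ·) (h1 ξ.1)) (congrArg (c • ·) (h2 ξ.2)))

theorem inner_mvfderiv_cliffordTorus (a c a' c' : ℝ) (p : SphProd k)
    (ξ : EuclideanSpace ℝ (Fin 2) × EuclideanSpace ℝ (Fin k)) :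
    inner ℝ (mvfderiv (modelSphProd k) (cliffordTorus k a c) p ξ) (cliffordTorus k a' c' p)
      = 0 := by
  have h1 := inner_mvfderiv_self ((contMDiff_coe_sph p.1).mdifferentiableAt (by simp))
    inner_self_sph ξ.1
  have h2 := inner_mvfderiv_self ((contMDiff_coe_sph p.2).mdifferentiableAt (by simp))
    inner_self_sph ξ.2
  rw [mvfderiv_cliffordTorus, cliffordTorus_eq, inner_appendCLM]
  simp only [inner_smul_left, inner_smul_right, h1, h2]
  simp

theorem injective_mvfderiv_cliffordTorus {a c : ℝ} (ha : a ≠ 0) (hc : c ≠ 0) (p : SphProd k)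
    {ξ : EuclideanSpace ℝ (Fin 2) × EuclideanSpace ℝ (Fin k)} (hξ : ξ ≠ 0) :
    mvfderiv (modelSphProd k) (cliffordTorus k a c) p ξ ≠ 0 := by
  intro h
  refine hξ ?_
  rw [mvfderiv_cliffordTorus] at h
  have h0 := inner_appendCLM
    (a • mvfderiv (𝓡 2) (fun z : Sph 2 => z.1) p.1 ξ.1,
          c • mvfderiv (𝓡 k) (fun z : Sph k => z.1) p.2 ξ.2)
    (a • mvfderiv (𝓡 2) (fun z : Sph 2 => z.1) p.1 ξ.1,
          c • mvfderiv (𝓡 k) (fun z : Sph k => z.1) p.2 ξ.2)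
  rw [h, inner_zero_left] at h0
  have h1 := real_inner_self_nonneg (x := a • mvfderiv (𝓡 2) (fun z : Sph 2 => z.1) p.1 ξ.1)
  have h2 := real_inner_self_nonneg (x := c • mvfderiv (𝓡 k) (fun z : Sph k => z.1) p.2 ξ.2)
  have h3 := inner_self_eq_zero.1 (le_antisymm (by linarith) h1)
  have h4 := inner_self_eq_zero.1 (le_antisymm (by linarith) h2)
  have h5 := (smul_eq_zero.1 h3).resolve_left ha
  have h6 := (smul_eq_zero.1 h4).resolve_left hc
  exact Prod.ext (injective_mvfderiv_coe_sph p.1 (h5.trans (map_zero _).symm))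
    (injective_mvfderiv_coe_sph p.2 (h6.trans (map_zero _).symm))

theorem dense_setOf_apply_zero_ne (hk : k ≠ 0) (t : ℝ) : Dense {v : Sph k | v.1 0 ≠ t} := by
  intro v
  by_cases hv : v.1 0 = t
  swap
  · exact subset_closure hv
  obtain ⟨w, hw1, hwv, hw⟩ : ∃ w : EuclideanSpace ℝ (Fin (k + 1)), inner ℝ w w = 1 ∧
      inner ℝ w v.1 = 0 ∧ (t = 0 → w 0 ≠ 0) := by
    by_cases ht : t = 0
    · exact ⟨axis k, by rw [inner_axis_right, axis_apply_zero], by simp [hv, ht], by simp⟩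
    · have : Nonempty (Fin k) := ⟨⟨0, Nat.pos_of_ne_zero hk⟩⟩
      obtain ⟨ξ, hξ⟩ := exists_ne (0 : EuclideanSpace ℝ (Fin k))
      have hd := inner_mvfderiv_self ((contMDiff_coe_sph v).mdifferentiableAt (by simp))
        inner_self_sph ξ
      set d := mvfderiv (𝓡 k) (fun z : Sph k => z.1) v ξ with hdef
      have hd0 : d ≠ 0 := fun h =>
        hξ (injective_mvfderiv_coe_sph v (h.trans (map_zero _).symm))
      have hd1 : ‖d‖ ≠ 0 := norm_ne_zero_iff.2 hd0
      refine ⟨‖d‖⁻¹ • d, ?_, ?_, fun h => absurd h ht⟩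
      · rw [inner_smul_left, inner_smul_right, real_inner_self_eq_norm_sq]
        simp only [RCLike.conj_to_real]
        field_simp
      · rw [inner_smul_left, hd, mul_zero]
  have hγ : ∀ s : ℝ, Real.cos s • v.1 + Real.sin s • w ∈
      Metric.sphere (0 : EuclideanSpace ℝ (Fin (k + 1))) 1 := by
    intro s
    have h1 : ‖Real.cos s • v.1 + Real.sin s • w‖ ^ 2 = 1 := by
      rw [← real_inner_self_eq_norm_sq]
      simp only [inner_smul_left, inner_smul_right, inner_add_left, inner_add_right,
        inner_self_sph, hw1, hwv, real_inner_comm w v.1, RCLike.conj_to_real]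
      linear_combination Real.sin_sq_add_cos_sq s
    rw [mem_sphere_zero_iff_norm]
    nlinarith [norm_nonneg (Real.cos s • v.1 + Real.sin s • w)]
  let γ : ℝ → Sph k := fun s => ⟨Real.cos s • v.1 + Real.sin s • w, hγ s⟩
  have hγc : Continuous γ := by
    refine Continuous.subtype_mk ?_ _
    fun_prop
  have hγ0 : γ 0 = v := Subtype.ext (by simp [γ])
  rw [mem_closure_iff]
  intro U hU hvU
  have hn : ∀ᶠ s in nhds (0 : ℝ), γ s ∈ U :=
    hγc.continuousAt.eventually_mem (by rw [hγ0]; exact hU.mem_nhds hvU)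
  have hn' : ∀ᶠ s in nhds (0 : ℝ), γ (-s) ∈ U :=
    (hγc.comp continuous_neg).continuousAt.eventually_mem
      (by simp only [Function.comp_apply, neg_zero]; rw [hγ0]; exact hU.mem_nhds hvU)
  have hlt : ∀ᶠ s in nhds (0 : ℝ), s < Real.pi := Iio_mem_nhds Real.pi_pos
  obtain ⟨s, ⟨⟨hs1, hs2⟩, hs3⟩, hs0⟩ :=
    ((((hn.and hn').and hlt).filter_mono nhdsWithin_le_nhds).and
      (self_mem_nhdsWithin (a := (0 : ℝ)) (s := Set.Ioi 0))).exists
  have hsin : 0 < Real.sin s := Real.sin_pos_of_pos_of_lt_pi hs0 hs3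
  by_cases h1 : (γ s).1 0 = t
  swap
  · exact ⟨γ s, hs1, h1⟩
  by_cases h2 : (γ (-s)).1 0 = t
  swap
  · exact ⟨γ (-s), hs2, h2⟩
  exfalso
  have e1 : Real.cos s * t + Real.sin s * w 0 = t := by
    rw [← hv] at h1 ⊢
    exact h1
  have e2 : Real.cos s * t - Real.sin s * w 0 = t := by
    have e3 : (γ (-s)).1 0 = Real.cos (-s) * v.1 0 + Real.sin (-s) * w 0 := rfl
    rw [e3, Real.cos_neg, Real.sin_neg, hv] at h2
    linarith
  have e3 : w 0 = 0 := by
    have : Real.sin s * w 0 = 0 := by linarith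
    exact (mul_eq_zero.1 this).resolve_left hsin.ne'
  have e4 : t ≠ 0 := fun h => hw h e3
  have e5 : Real.cos s = 1 := by
    rw [e3, mul_zero, add_zero] at e1
    exact mul_right_cancel₀ e4 (by rw [e1, one_mul])
  have e6 := Real.sin_sq_add_cos_sq s
  rw [e5] at e6
  nlinarith

end CliffordTorus

section CliffordTorusFront

variable {k : ℕ} {r₁ r₂ b : ℝ}

/-- The immersion into the hyperbolic space which corresponds to the boosted Clifford torus. -/
noncomputable def torusLift (k : ℕ) (r₁ r₂ b : ℝ) (p : SphProd k) :
    EuclideanSpace ℝ (Fin (k + 3 + 1)) :=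
  hyperbolicLift b (cliffordTorus k r₁ r₂ p)

/-- The unit normal vector field of `torusLift`. -/
noncomputable def torusNormal (k : ℕ) (r₁ r₂ b : ℝ) (p : SphProd k) :
    EuclideanSpace ℝ (Fin (k + 3 + 1)) :=
  normalLift b (cliffordTorus k r₁ r₂ p) (cliffordTorus k (-r₂) r₁ p)

/-- The lightlike maps `(f + ε ν) / √2`. -/
noncomputable def torusFront (k : ℕ) (r₁ r₂ b ε : ℝ) (p : SphProd k) :
    EuclideanSpace ℝ (Fin (k + 3 + 1)) :=
  (1 / √2 : ℝ) • (torusLift k r₁ r₂ b p + ε • torusNormal k r₁ r₂ b p)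

theorem torusHeight_pos (h₁ : 0 < r₁) (h₂ : 0 < r₂) (hb : r₂ < b * r₁)
    (hr : r₁ ^ 2 + r₂ ^ 2 = 1) (p : SphProd k) :
    0 < √(1 + b ^ 2) * cliffordTorus k r₁ r₂ p 0 + b := by
  have hb0 : 0 < b := by
    by_contra h
    have := mul_nonpos_of_nonpos_of_nonneg (not_lt.1 h) h₁.le
    linarith
  have h0 : √(1 + b ^ 2) * r₂ < b := by
    rw [← lt_div_iff₀ h₂, Real.sqrt_lt (by positivity) (by positivity), div_pow,
      lt_div_iff₀ (by positivity)]
    nlinarith [mul_pos hb0 h₁]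
  have h1 := neg_le_of_abs_le (abs_apply_zero_le_one p.2)
  have h2 : 0 ≤ √(1 + b ^ 2) * r₂ := by positivity
  rw [cliffordTorus_apply_zero]
  nlinarith

theorem contMDiff_torusLift (hμ : ∀ p, 0 < √(1 + b ^ 2) * cliffordTorus k r₁ r₂ p 0 + b) :
    ContMDiff (modelSphProd k) 𝓘(ℝ, EuclideanSpace ℝ (Fin (k + 3 + 1))) ∞
      (torusLift k r₁ r₂ b) :=
  contMDiff_hyperbolicLift (contMDiff_cliffordTorus r₁ r₂) hμ

theorem contMDiff_torusNormal (hμ : ∀ p, 0 < √(1 + b ^ 2) * cliffordTorus k r₁ r₂ p 0 + b) :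
    ContMDiff (modelSphProd k) 𝓘(ℝ, EuclideanSpace ℝ (Fin (k + 3 + 1))) ∞
      (torusNormal k r₁ r₂ b) :=
  contMDiff_normalLift (contMDiff_cliffordTorus r₁ r₂) (contMDiff_cliffordTorus (-r₂) r₁) hμ

theorem contMDiff_torusFront (hμ : ∀ p, 0 < √(1 + b ^ 2) * cliffordTorus k r₁ r₂ p 0 + b)
    (ε : ℝ) :
    ContMDiff (modelSphProd k) 𝓘(ℝ, EuclideanSpace ℝ (Fin (k + 3 + 1))) ∞
      (torusFront k r₁ r₂ b ε) :=
  (contDiff_const_smul (1 / √2 : ℝ)).contMDiff.comp ((contMDiff_torusLift hμ).add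
    ((contDiff_const_smul ε).contMDiff.comp (contMDiff_torusNormal hμ)))

theorem inner_cliffordTorus_self (hr : r₁ ^ 2 + r₂ ^ 2 = 1) (p : SphProd k) :
    inner ℝ (cliffordTorus k r₁ r₂ p) (cliffordTorus k r₁ r₂ p) = 1 := by
  rw [inner_cliffordTorus]
  linarith

theorem inner_cliffordTorus_normal (p : SphProd k) :
    inner ℝ (cliffordTorus k (-r₂) r₁ p) (cliffordTorus k r₁ r₂ p) = 0 := by
  rw [inner_cliffordTorus]
  ring

theorem lorentzForm_torusLift_self (hr : r₁ ^ 2 + r₂ ^ 2 = 1)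
    (hμ : ∀ p, 0 < √(1 + b ^ 2) * cliffordTorus k r₁ r₂ p 0 + b) (p : SphProd k) :
    lorentzForm (k + 3) (torusLift k r₁ r₂ b p) (torusLift k r₁ r₂ b p) = -1 :=
  lorentzForm_hyperbolicLift_self (inner_cliffordTorus_self hr p) (hμ p)

theorem lorentzForm_torusNormal_torusLift (hr : r₁ ^ 2 + r₂ ^ 2 = 1)
    (hμ : ∀ p, 0 < √(1 + b ^ 2) * cliffordTorus k r₁ r₂ p 0 + b) (p : SphProd k) :
    lorentzForm (k + 3) (torusNormal k r₁ r₂ b p) (torusLift k r₁ r₂ b p) = 0 :=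
  lorentzForm_normalLift_hyperbolicLift (inner_cliffordTorus_self hr p)
    (inner_cliffordTorus_normal p) (hμ p)

theorem lorentzForm_torusNormal_self (hr : r₁ ^ 2 + r₂ ^ 2 = 1)
    (hμ : ∀ p, 0 < √(1 + b ^ 2) * cliffordTorus k r₁ r₂ p 0 + b) (p : SphProd k) :
    lorentzForm (k + 3) (torusNormal k r₁ r₂ b p) (torusNormal k r₁ r₂ b p) = 1 := by
  refine lorentzForm_normalLift_self (inner_cliffordTorus_self hr p) ?_
    (inner_cliffordTorus_normal p) (hμ p)
  rw [inner_cliffordTorus]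
  linarith

theorem lorentzForm_torusFront (hr : r₁ ^ 2 + r₂ ^ 2 = 1)
    (hμ : ∀ p, 0 < √(1 + b ^ 2) * cliffordTorus k r₁ r₂ p 0 + b) (ε δ : ℝ) (p : SphProd k) :
    lorentzForm (k + 3) (torusFront k r₁ r₂ b ε p) (torusFront k r₁ r₂ b δ p)
      = (ε * δ - 1) / 2 := by
  have h2 : √2 ^ 2 = (2 : ℝ) := Real.sq_sqrt (by norm_num)
  simp only [torusFront, map_add, map_smul, add_apply, smul_apply, smul_eq_mul,
    lorentzForm_torusLift_self hr hμ, lorentzForm_torusNormal_torusLift hr hμ,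
    lorentzForm_torusNormal_self hr hμ,
    lorentzForm_comm (torusLift k r₁ r₂ b p) (torusNormal k r₁ r₂ b p)]
  field_simp
  rw [h2]
  ring

theorem lorentzForm_mvfderiv_torusLift_self (hr : r₁ ^ 2 + r₂ ^ 2 = 1)
    (hμ : ∀ p, 0 < √(1 + b ^ 2) * cliffordTorus k r₁ r₂ p 0 + b) (p : SphProd k)
    (ξ : TangentSpace (modelSphProd k) p) :
    lorentzForm (k + 3) (mvfderiv (modelSphProd k) (torusLift k r₁ r₂ b) p ξ)
      (torusLift k r₁ r₂ b p) = 0 :=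
  lorentzForm_mvfderiv_hyperbolicLift_self (contMDiff_cliffordTorus r₁ r₂)
    (inner_cliffordTorus_self hr) hμ p ξ

theorem lorentzForm_mvfderiv_torusLift_torusNormal (hr : r₁ ^ 2 + r₂ ^ 2 = 1)
    (hμ : ∀ p, 0 < √(1 + b ^ 2) * cliffordTorus k r₁ r₂ p 0 + b) (p : SphProd k)
    (ξ : TangentSpace (modelSphProd k) p) :
    lorentzForm (k + 3) (mvfderiv (modelSphProd k) (torusLift k r₁ r₂ b) p ξ)
      (torusNormal k r₁ r₂ b p) = 0 :=
  lorentzForm_mvfderiv_hyperbolicLift_normalLift (contMDiff_cliffordTorus r₁ r₂)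
    (inner_cliffordTorus_self hr) inner_cliffordTorus_normal
    (fun p ξ => inner_mvfderiv_cliffordTorus r₁ r₂ (-r₂) r₁ p ξ) hμ p ξ

theorem lorentzForm_mvfderiv_torusLift_torusFront (hr : r₁ ^ 2 + r₂ ^ 2 = 1)
    (hμ : ∀ p, 0 < √(1 + b ^ 2) * cliffordTorus k r₁ r₂ p 0 + b) (ε : ℝ) (p : SphProd k)
    (ξ : TangentSpace (modelSphProd k) p) :
    lorentzForm (k + 3) (mvfderiv (modelSphProd k) (torusLift k r₁ r₂ b) p ξ)
      (torusFront k r₁ r₂ b ε p) = 0 := by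
  simp only [torusFront, map_add, map_smul, lorentzForm_mvfderiv_torusLift_self hr hμ,
    lorentzForm_mvfderiv_torusLift_torusNormal hr hμ, smul_zero, add_zero]

theorem isSpacelikeImmersion_torusLift (h₁ : r₁ ≠ 0) (h₂ : r₂ ≠ 0) (hr : r₁ ^ 2 + r₂ ^ 2 = 1)
    (hμ : ∀ p, 0 < √(1 + b ^ 2) * cliffordTorus k r₁ r₂ p 0 + b) :
    IsSpacelikeImmersion (modelSphProd k) (lorentzForm (k + 3)) (torusLift k r₁ r₂ b) := by
  refine ⟨contMDiff_torusLift hμ, fun p ξ hξ => ?_⟩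
  have h := lorentzForm_mvfderiv_hyperbolicLift_mvfderiv (contMDiff_cliffordTorus r₁ r₂)
    (inner_cliffordTorus_self hr) hμ p ξ
  have h0 : 0 < (inner ℝ (mvfderiv (modelSphProd k) (cliffordTorus k r₁ r₂) p ξ)
      (mvfderiv (modelSphProd k) (cliffordTorus k r₁ r₂) p ξ) : ℝ) :=
    real_inner_self_pos.2 (injective_mvfderiv_cliffordTorus h₁ h₂ p hξ)
  rw [← h] at h0
  exact pos_of_mul_pos_right h0 (sq_nonneg _)

/-- The principal curvature of `torusLift` in the direction of `S^2`. -/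
noncomputable def torusCurvature (r₁ r₂ b : ℝ) (p : SphProd k) : ℝ :=
  -(√(1 + b ^ 2) * p.2.1 0 + b * r₂) / r₁

theorem mvfderiv_torusNormal (h₁ : r₁ ≠ 0) (h₂ : r₂ ≠ 0) (hr : r₁ ^ 2 + r₂ ^ 2 = 1)
    (hμ : ∀ p, 0 < √(1 + b ^ 2) * cliffordTorus k r₁ r₂ p 0 + b) (p : SphProd k)
    (ξ : EuclideanSpace ℝ (Fin 2) × EuclideanSpace ℝ (Fin k)) :
    mvfderiv (modelSphProd k) (torusNormal k r₁ r₂ b) p ξ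
      = mvfderiv (modelSphProd k) (torusLift k r₁ r₂ b) p
        (torusCurvature r₁ r₂ b p • ξ.1, (b * r₁ / r₂) • ξ.2) := by
  have hw : mvfderiv (modelSphProd k) (cliffordTorus k (-r₂) r₁) p ξ
      = mvfderiv (modelSphProd k) (cliffordTorus k r₁ r₂) p
        ((-r₂ / r₁) • ξ.1, (r₁ / r₂) • ξ.2) := by
    rw [mvfderiv_cliffordTorus_smul, mul_div_cancel₀ _ h₁, mul_div_cancel₀ _ h₂]
  refine (mvfderiv_normalLift (contMDiff_cliffordTorus r₁ r₂) (contMDiff_cliffordTorus (-r₂) r₁)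
    hμ hw).trans ?_
  refine congrArg (mvfderiv (modelSphProd k) (torusLift k r₁ r₂ b) p) ?_
  refine Prod.ext ?_ ?_
  · change (√(1 + b ^ 2) * cliffordTorus k r₁ r₂ p 0 + b) • ((-r₂ / r₁) • ξ.1)
      - (√(1 + b ^ 2) * cliffordTorus k (-r₂) r₁ p 0) • ξ.1 = torusCurvature r₁ r₂ b p • ξ.1
    rw [smul_smul, ← sub_smul, cliffordTorus_apply_zero, cliffordTorus_apply_zero, torusCurvature]
    congr 1
    field_simp
    linear_combination -(√(1 + b ^ 2) * p.2.1 0) * hr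
  · change (√(1 + b ^ 2) * cliffordTorus k r₁ r₂ p 0 + b) • ((r₁ / r₂) • ξ.2)
      - (√(1 + b ^ 2) * cliffordTorus k (-r₂) r₁ p 0) • ξ.2 = (b * r₁ / r₂) • ξ.2
    rw [smul_smul, ← sub_smul, cliffordTorus_apply_zero, cliffordTorus_apply_zero]
    congr 1
    field_simp
    ring

theorem mvfderiv_torusFront (h₁ : r₁ ≠ 0) (h₂ : r₂ ≠ 0) (hr : r₁ ^ 2 + r₂ ^ 2 = 1)
    (hμ : ∀ p, 0 < √(1 + b ^ 2) * cliffordTorus k r₁ r₂ p 0 + b) (ε : ℝ) (p : SphProd k)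
    (ξ : EuclideanSpace ℝ (Fin 2) × EuclideanSpace ℝ (Fin k)) :
    mvfderiv (modelSphProd k) (torusFront k r₁ r₂ b ε) p ξ
      = mvfderiv (modelSphProd k) (torusLift k r₁ r₂ b) p
        (((1 / √2) * (1 + ε * torusCurvature r₁ r₂ b p)) • ξ.1,
          ((1 / √2) * (1 + ε * (b * r₁ / r₂))) • ξ.2) := by
  have hfd : MDifferentiableAt (modelSphProd k) 𝓘(ℝ, EuclideanSpace ℝ (Fin (k + 3 + 1)))
      (torusLift k r₁ r₂ b) p := (contMDiff_torusLift hμ p).mdifferentiableAt (by simp)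
  have hnd : MDifferentiableAt (modelSphProd k) 𝓘(ℝ, EuclideanSpace ℝ (Fin (k + 3 + 1)))
      (torusNormal k r₁ r₂ b) p := (contMDiff_torusNormal hμ p).mdifferentiableAt (by simp)
  let A : ℝ → EuclideanSpace ℝ (Fin (k + 3 + 1)) →L[ℝ] EuclideanSpace ℝ (Fin (k + 3 + 1)) :=
    fun a => a • ContinuousLinearMap.id ℝ _
  have hnd' : MDifferentiableAt (modelSphProd k) 𝓘(ℝ, EuclideanSpace ℝ (Fin (k + 3 + 1)))
      (fun q => A ε (torusNormal k r₁ r₂ b q)) p :=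
    (A ε).differentiableAt.mdifferentiableAt.comp p hnd
  have h1 : mvfderiv (modelSphProd k) (torusFront k r₁ r₂ b ε) p ξ
      = (1 / √2 : ℝ) • mvfderiv (modelSphProd k)
        (fun q => torusLift k r₁ r₂ b q + A ε (torusNormal k r₁ r₂ b q)) p ξ :=
    mvfderiv_clm_comp (A (1 / √2)) (hfd.add hnd') ξ
  have h2 : mvfderiv (modelSphProd k)
        (fun q => torusLift k r₁ r₂ b q + A ε (torusNormal k r₁ r₂ b q)) p ξ
      = mvfderiv (modelSphProd k) (torusLift k r₁ r₂ b) p ξ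
        + ε • mvfderiv (modelSphProd k) (torusNormal k r₁ r₂ b) p ξ :=
    (DFunLike.congr_fun (mvfderiv_fun_add hfd hnd') ξ).trans
      (congrArg (mvfderiv (modelSphProd k) (torusLift k r₁ r₂ b) p ξ + ·)
        (mvfderiv_clm_comp (A ε) hnd ξ))
  rw [h1, h2, mvfderiv_torusNormal h₁ h₂ hr hμ]
  let L : EuclideanSpace ℝ (Fin 2) × EuclideanSpace ℝ (Fin k) →L[ℝ]
    EuclideanSpace ℝ (Fin (k + 3 + 1)) := mvfderiv (modelSphProd k) (torusLift k r₁ r₂ b) p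
  change (1 / √2 : ℝ) • (L ξ + ε • L (torusCurvature r₁ r₂ b p • ξ.1, (b * r₁ / r₂) • ξ.2)) = L _
  rw [← map_smul, ← map_add, ← map_smul]
  refine congrArg L (Prod.ext ?_ ?_)
  · change (1 / √2 : ℝ) • (ξ.1 + ε • torusCurvature r₁ r₂ b p • ξ.1) = _
    module
  · change (1 / √2 : ℝ) • (ξ.2 + ε • (b * r₁ / r₂) • ξ.2) = _
    module

theorem injective_mvfderiv_torusFront_iff (h₁ : r₁ ≠ 0) (h₂ : r₂ ≠ 0)
    (hr : r₁ ^ 2 + r₂ ^ 2 = 1)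
    (hμ : ∀ p, 0 < √(1 + b ^ 2) * cliffordTorus k r₁ r₂ p 0 + b) {ε : ℝ}
    (hε : 1 + ε * (b * r₁ / r₂) ≠ 0) (p : SphProd k) :
    Function.Injective (mvfderiv (modelSphProd k) (torusFront k r₁ r₂ b ε) p)
      ↔ 1 + ε * torusCurvature r₁ r₂ b p ≠ 0 := by
  have hs : (1 / √2 : ℝ) ≠ 0 := by positivity
  have hf := isSpacelikeImmersion_torusLift h₁ h₂ hr hμ
  have hdf : ∀ ξ : EuclideanSpace ℝ (Fin 2) × EuclideanSpace ℝ (Fin k),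
      mvfderiv (modelSphProd k) (torusLift k r₁ r₂ b) p ξ = 0 → ξ = 0 := by
    intro ξ h
    by_contra hξ
    have h1 := hf.2 p ξ hξ
    rw [h, map_zero] at h1
    exact h1.ne' rfl
  constructor
  · intro hinj h
    obtain ⟨u, hu⟩ := exists_ne (0 : EuclideanSpace ℝ (Fin 2))
    have h1 := mvfderiv_torusFront h₁ h₂ hr hμ ε p (u, 0)
    rw [h, mul_zero, zero_smul, smul_zero] at h1
    have h2 : mvfderiv (modelSphProd k) (torusFront k r₁ r₂ b ε) p
        ((u, 0) : EuclideanSpace ℝ (Fin 2) × EuclideanSpace ℝ (Fin k)) = 0 :=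
      h1.trans (map_zero (mvfderiv (modelSphProd k) (torusLift k r₁ r₂ b) p))
    exact hu (congrArg Prod.fst (hinj (h2.trans (map_zero _).symm)))
  · intro h
    rw [injective_iff_map_eq_zero]
    intro ξ hξ
    have h1 := hdf _ ((mvfderiv_torusFront h₁ h₂ hr hμ ε p ξ).symm.trans hξ)
    exact Prod.ext ((smul_eq_zero.1 (congrArg Prod.fst h1)).resolve_left (mul_ne_zero hs h))
      ((smul_eq_zero.1 (congrArg Prod.snd h1)).resolve_left (mul_ne_zero hs hε))

theorem continuous_torusCurvature : Continuous (torusCurvature (k := k) r₁ r₂ b) := by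
  unfold torusCurvature
  fun_prop

theorem dense_setOf_torusCurvature_ne (hk : k ≠ 0) (h₁ : r₁ ≠ 0) (ε : ℝ) :
    Dense {p : SphProd k | 1 + ε * torusCurvature r₁ r₂ b p ≠ 0} := by
  have hc : 0 < √(1 + b ^ 2) := by positivity
  by_cases hε : ε = 0
  · simp [hε]
  have hd := (dense_setOf_apply_zero_ne hk ((r₁ / ε - b * r₂) / √(1 + b ^ 2))).preimage
    (isOpenMap_snd (X := Sph 2))
  refine Dense.mono (fun p hp h => ?_) hd
  rw [torusCurvature] at h
  refine hp ?_
  field_simp at h ⊢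
  linarith

theorem torusFront_apply_zero_pos (h₁ : 0 < r₁) (h₂ : 0 < r₂) (hb : r₂ < b * r₁)
    (hr : r₁ ^ 2 + r₂ ^ 2 = 1) (p : SphProd k) : 0 < torusFront k r₁ r₂ b (-1) p 0 := by
  have hμ := torusHeight_pos h₁ h₂ hb hr p
  have hc : √(1 + b ^ 2) ^ 2 = 1 + b ^ 2 := Real.sq_sqrt (by positivity)
  have hc0 : 0 < √(1 + b ^ 2) := by positivity
  have hb0 : 0 < b := by
    by_contra h
    have := mul_nonpos_of_nonpos_of_nonneg (not_lt.1 h) h₁.le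
    linarith
  have h0 : torusFront k r₁ r₂ b (-1) p 0
      = (1 / √2 : ℝ) * ((√(1 + b ^ 2) * cliffordTorus k r₁ r₂ p 0 + b)⁻¹
        * (√(1 + b ^ 2) + (b * r₂ + r₁) * p.2.1 0)) := by
    simp only [torusFront, torusLift, torusNormal, normalLift, hyperbolicLift, PiLp.smul_apply,
      PiLp.add_apply, PiLp.sub_apply, smul_eq_mul, axisScale_apply_zero, axis_apply_zero]
    rw [cliffordTorus_apply_zero] at hμ ⊢
    rw [cliffordTorus_apply_zero]
    obtain ⟨μ, hμe⟩ : ∃ μ, μ = √(1 + b ^ 2) * (r₂ * p.2.1 0) + b := ⟨_, rfl⟩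
    rw [← hμe] at hμ ⊢
    field_simp
    linear_combination (r₁ * p.2.1 0) * hc - (b * r₁ * p.2.1 0) * hμe
  rw [h0]
  have h3 : b * r₂ + r₁ < √(1 + b ^ 2) := by
    refine Real.lt_sqrt_of_sq_lt ?_
    nlinarith [sq_pos_of_pos (sub_pos.2 hb)]
  have h4 := neg_le_of_abs_le (abs_apply_zero_le_one p.2)
  have h5 : 0 < b * r₂ + r₁ := by positivity
  have h6 : 0 < √(1 + b ^ 2) + (b * r₂ + r₁) * p.2.1 0 := by nlinarith
  positivity

theorem exists_isAdmissibleGCF_torusFront (hk : 2 ≤ k) (h₁ : 0 < r₁) (h₂ : 0 < r₂)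
    (hr : r₁ ^ 2 + r₂ ^ 2 = 1) (hb : r₂ < b * r₁) :
    ∃ C : CoherentTangentBundle (modelSphProd k) (SphProd k)
        (EuclideanSpace ℝ (Fin 2) × EuclideanSpace ℝ (Fin k))
        (TangentSpace (modelSphProd k) : SphProd k → Type),
      (∀ p v w, C.metric.inner p v w
        = lorentz (diffAt (torusLift k r₁ r₂ b) p v) (diffAt (torusLift k r₁ r₂ b) p w)) ∧
      (∀ p v, diffAt (torusLift k r₁ r₂ b) p (C.φ p v)
        = diffAt (torusFront k r₁ r₂ b (-1)) p v) ∧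
      C.IsAdmissibleGCF := by
  have hμ := torusHeight_pos (k := k) h₁ h₂ hb hr
  have hf := isSpacelikeImmersion_torusLift h₁.ne' h₂.ne' hr hμ
  have hB : ∀ v w, lorentzForm (k + 3) v w = lorentzForm (k + 3) w v := lorentzForm_comm
  have hE : finrank ℝ (EuclideanSpace ℝ (Fin 2) × EuclideanSpace ℝ (Fin k)) = 2 + k := by
    simp
  have hXf : ∀ (ε : ℝ) (p : SphProd k) (v : TangentSpace (modelSphProd k) p), ∃ v',
      mvfderiv (modelSphProd k) (torusLift k r₁ r₂ b) p v'
        = mvfderiv (modelSphProd k) (torusFront k r₁ r₂ b ε) p v := fun ε p v =>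
    ⟨_, (mvfderiv_torusFront h₁.ne' h₂.ne' hr hμ ε p v).symm⟩
  have hκ : 1 < b * r₁ / r₂ := (one_lt_div h₂).2 hb
  have hκ1 : 1 + (-1) * (b * r₁ / r₂) ≠ 0 := by linarith
  have hκ2 : 1 + 1 * (b * r₁ / r₂) ≠ 0 := by linarith
  have hset : {p : SphProd k | Function.Injective
      (mvfderiv (modelSphProd k) (torusFront k r₁ r₂ b (-1)) p)}
      = {p | 1 + (-1) * torusCurvature r₁ r₂ b p ≠ 0} :=
    Set.ext fun p => injective_mvfderiv_torusFront_iff h₁.ne' h₂.ne' hr hμ hκ1 p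
  have hopen : IsOpen {p : SphProd k | 1 + (-1) * torusCurvature r₁ r₂ b p ≠ 0} :=
    isOpen_ne_fun
      (continuous_const.add (continuous_const.mul continuous_torusCurvature)) continuous_const
  refine ⟨hf.coherentTangentBundle hB (contMDiff_torusFront hμ (-1)) (hXf (-1)), ?_, ?_, ?_⟩
  · intro p v w
    exact lorentzForm_apply _ _
  · intro p v
    exact mvfderiv_tangentialDifferential hf (hXf (-1) p v)
  · refine hf.isAdmissibleGCF hB ?_ ?_ (contMDiff_torusFront hμ (-1)) (contMDiff_torusFront hμ 1)
      (hXf (-1)) (hXf 1) ?_ ?_ ?_ ?_ ?_ ?_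
    · rw [hE, finrank_euclideanSpace_fin]
      ring
    · rw [hE]
      omega
    · intro p
      rw [lorentzForm_torusFront hr hμ]
      norm_num
    · intro p
      rw [lorentzForm_torusFront hr hμ]
      norm_num
    · intro p
      rw [lorentzForm_torusFront hr hμ]
      norm_num
    · intro p v
      obtain ⟨v', hv⟩ := hXf (-1) p v
      rw [← hv]
      exact lorentzForm_mvfderiv_torusLift_torusFront hr hμ 1 p v'
    · rw [hset]
      exact hopen
    · refine ((dense_setOf_torusCurvature_ne (b := b) (r₂ := r₂) (by omega) h₁.ne'
        (-1)).inter_of_isOpen_left (dense_setOf_torusCurvature_ne (b := b) (r₂ := r₂)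
          (by omega) h₁.ne' 1) hopen).mono fun p hp => ⟨?_, ?_⟩
      · exact (injective_mvfderiv_torusFront_iff h₁.ne' h₂.ne' hr hμ hκ1 p).2 hp.1
      · exact (injective_mvfderiv_torusFront_iff h₁.ne' h₂.ne' hr hμ hκ2 p).2 hp.2

end CliffordTorusFront

theorem mainTheorem9 (k : ℕ) (hk : 2 ≤ k) :
    CompactSpace (SphProd k) ∧ SimplyConnectedSpace (SphProd k) ∧
    (∀ m : ℕ, IsEmpty (SphProd k ≃ₜ Sph m)) ∧
    ∀ (r₁ r₂ : ℝ) (_ : 0 < r₁) (_ : 0 < r₂) (hr : r₁ ^ 2 + r₂ ^ 2 = 1),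
      ∃ T : Diffeomorph (𝓡 (k + 3)) (𝓡 (k + 3)) (Sph (k + 3)) (Sph (k + 3)) ∞,
        IsConformalTransformation T ∧
        (∀ p, 0 < (T ⟨cliffordTorus k r₁ r₂ p, cliffordTorus_mem k hr p⟩).1 0) ∧
        ∃ f ν x : SphProd k → EuclideanSpace ℝ (Fin (k + 3 + 1)),
          (∀ p, f p = hemisphereToHyperbolic
            (T ⟨cliffordTorus k r₁ r₂ p, cliffordTorus_mem k hr p⟩).1) ∧
          IsUnitNormal f ν ∧
          (∀ p, x p = (1 / √2 : ℝ) • (f p - ν p)) ∧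
          (∀ p, x p ∈ upperLightcone (k + 3)) ∧
          ∃ C : CoherentTangentBundle (modelSphProd k) (SphProd k)
              (EuclideanSpace ℝ (Fin 2) × EuclideanSpace ℝ (Fin k))
              (TangentSpace (modelSphProd k) : SphProd k → Type),
            (∀ p v w, C.metric.inner p v w = lorentz (diffAt f p v) (diffAt f p w)) ∧
            (∀ p v, diffAt f p (C.φ p v) = diffAt x p v) ∧
            C.IsAdmissibleGCF := by
  have := simplyConnectedSpace_sphere (le_refl 2)
  have := simplyConnectedSpace_sphere hk
  refine ⟨inferInstance, simplyConnectedSpace_prod, isEmpty_sphProd_homeomorph_sphere k,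
    fun r₁ r₂ h₁ h₂ hr => ?_⟩
  obtain ⟨b, hb⟩ : ∃ b, r₂ < b * r₁ :=
    ⟨r₂ / r₁ + 1, by rw [add_mul, div_mul_cancel₀ _ h₁.ne']; linarith⟩
  have hμ := torusHeight_pos (k := k) h₁ h₂ hb hr
  refine ⟨boost (k + 3) b, isConformalTransformation_boost _ b, fun p => ?_,
    torusLift k r₁ r₂ b, torusNormal k r₁ r₂ b, torusFront k r₁ r₂ b (-1), fun p => ?_,
    ⟨contMDiff_torusNormal hμ, fun p => ⟨?_, ?_, fun v => ?_⟩⟩, fun p => ?_, fun p => ⟨?_, ?_⟩,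
    exists_isAdmissibleGCF_torusFront hk h₁ h₂ hr hb⟩
  · rw [boost_apply, boostFun_apply_zero]
    exact mul_pos (inv_pos.2 (boost_denom_pos b
      ⟨cliffordTorus k r₁ r₂ p, cliffordTorus_mem k hr p⟩)) (hμ p)
  · rw [boost_apply]
    exact (hemisphereToHyperbolic_boostFun b
      ⟨cliffordTorus k r₁ r₂ p, cliffordTorus_mem k hr p⟩).symm
  · rw [← lorentzForm_apply, lorentzForm_torusNormal_self hr hμ]
  · rw [← lorentzForm_apply, lorentzForm_torusNormal_torusLift hr hμ]
  · rw [← lorentzForm_apply]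
    exact lorentzForm_mvfderiv_torusLift_torusNormal hr hμ p v
  · rw [torusFront, neg_one_smul, sub_eq_add_neg]
  · rw [← lorentzForm_apply, lorentzForm_torusFront hr hμ]
    norm_num
  · exact torusFront_apply_zero_pos h₁ h₂ hb hr p
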